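/- Let $R$ be an Iwanaga-Gorenstein ring, i.e. a left and right Noetherian ring with finite injective dimension both as a left and as a right module over itself. Let $\mathsf{CM}\,R$ be the category of finitely presented right $R$-modules $X$ with $\operatorname{Ext}^i_R(X,R)=0$ for all $i>0$. Let $\mathsf{Mor}^{\mathrm e}(\mathsf{CM}\,R)$ be the category whose objects are the surjective $R$-linear maps $\alpha:X\to T$ with $X,T\in\mathsf{CM}\,R$ and whose morphisms are the commutative squares. With the (componentwise) short exact sequences both are exact categories; let $\underline{\mathsf{CM}}\,R$ and $\underline{\mathsf{Mor}}^{\mathrm e}(\mathsf{CM}\,R)$ be their stable categories (morphisms modulo those factoring through a projective object of the exact category). Let $\underline{\mathsf{Mor}}^{01}$, $\underline{\mathsf{Mor}}^{10}$, $\underline{\mathsf{Mor}}^{11}$ be the full subcategories of $\underline{\mathsf{Mor}}^{\mathrm e}(\mathsf{CM}\,R)$ of the objects isomorphic in it to some $P\to T$ with $P$ projective, to some $X\to 0$, and to some identity $T\xrightarrow{1}T$, respectively. A pair $(\mathcal U,\mathcal V)$ of full subcategories of a triangulated category $\mathcal D$ with translation $\Sigma$ is a stable t-structure if $\mathcal U=\Sigma\mathcal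 U$, $\mathcal V=\Sigma\mathcal V$, $\operatorname{Hom}_{\mathcal D}(\mathcal U,\mathcal V)=0$ and every $X\in\mathcal D$ lies in a triangle $U\to X\to V\to\Sigma U$ with $U\in\mathcal U$, $V\in\mathcal V$. Triangulated full subcategories $(\mathcal U,\mathcal V,\mathcal W)$ form a triangle of recollements in $\mathcal D$ if $(\mathcal U,\mathcal V)$, $(\mathcal V,\mathcal W)$ and $(\mathcal W,\mathcal U)$ are stable t-structures. Then $\underline{\mathsf{CM}}\,R$ and $\underline{\mathsf{Mor}}^{\mathrm e}(\mathsf{CM}\,R)$ carry the usual (Happel) triangulated structure of the stable category of a Frobenius category, and with respect to it: (1) $(\underline{\mathsf{Mor}}^{01},\underline{\mathsf{Mor}}^{10},\underline{\mathsf{Mor}}^{11})$ is a triangle of recollements in $\underline{\mathsf{Mor}}^{\mathrm e}(\mathsf{CM}\,R)$; in particular the three are triangulated subcategories. (2) Let $i_*:\underline{\mathsf{Mor}}^{10}\to\underline{\mathsf{Mor}}^{\mathrm e}(\mathsf{CM}\,R)$ be the inclusion and $j^*:\underline{\mathsf{Mor}}^{\mathrm e}(\mathsf{CM}\,R)\to\underline{\mathsf{Mor}}^{\mathrm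 e}(\mathsf{CM}\,R)/\underline{\mathsf{Mor}}^{10}$ the Verdier quotient functor. There is a recollement $(i^*,i_*,i^!;\,j_!,j^*,j_*)$, that is, there are triangle functors $i^*,i^!,j_!,j_*$ with $i^*\dashv i_*\dashv i^!$ and $j_!\dashv j^*\dashv j_*$, with $i_*,j_!,j_*$ fully faithful, and with essential images $\operatorname{Im}j_!=\operatorname{Ker}i^*$, $\operatorname{Im}i_*=\operatorname{Ker}j^*$, $\operatorname{Im}j_*=\operatorname{Ker}i^!$, such that moreover $\operatorname{Im}j_!=\underline{\mathsf{Mor}}^{01}$ and $\operatorname{Im}j_*=\underline{\mathsf{Mor}}^{11}$. (3) There are triangle equivalences $\underline{\mathsf{CM}}\,R\simeq\underline{\mathsf{Mor}}^{10}\simeq\underline{\mathsf{Mor}}^{11}\simeq\underline{\mathsf{Mor}}^{01}$. -/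

import Mathlib

open CategoryTheory CategoryTheory.Limits CategoryTheory.Pretriangulated
open scoped ZeroObject

universe u

namespace Frobenius

section StableCategory

variable {C : Type*} [Category C] [Preadditive C]

/-! An exact category is given by an additive category `C` together with its class
`E` of conflations (admissible short exact sequences). -/

/-- Projective objects of the exact category `(C, E)`. -/
def relProjective (E : ObjectProperty (ShortComplex C)) : ObjectProperty C := fun Q =>
  ∀ (S : ShortComplex C), E S → ∀ f : Q ⟶ S.X₃, ∃ g : Q ⟶ S.X₂, g ≫ S.g = f

/-- Injective objects of the exact category `(C, E)`. -/
def relInjective (E : ObjectProperty (ShortComplex C)) : ObjectProperty C := fun I =>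
  ∀ (S : ShortComplex C), E S → ∀ f : S.X₁ ⟶ I, ∃ g : S.X₂ ⟶ I, S.f ≫ g = f

/-- Two parallel morphisms are identified in the stable category when their difference
factors through a projective object of the exact category. -/
def stableRel (E : ObjectProperty (ShortComplex C)) : HomRel C := fun X Y f g =>
  ∃ (Q : C) (_ : relProjective E Q) (a : X ⟶ Q) (b : Q ⟶ Y), f - g = a ≫ b

variable (E : ObjectProperty (ShortComplex C)) [HasBinaryBiproducts C]

lemma stableRel_add {X Y : C} (f₁ f₂ g₁ g₂ : X ⟶ Y)
    (hf : stableRel E f₁ f₂) (hg : stableRel E g₁ g₂) :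
    stableRel E (f₁ + g₁) (f₂ + g₂) := by
  obtain ⟨Q, hQ, a, b, h⟩ := hf
  obtain ⟨Q', hQ', a', b', h'⟩ := hg
  refine ⟨Q ⊞ Q', ?_, biprod.lift a a', biprod.desc b b', ?_⟩
  · intro S hS f
    obtain ⟨g, hg⟩ := hQ S hS (biprod.inl ≫ f)
    obtain ⟨g', hg'⟩ := hQ' S hS (biprod.inr ≫ f)
    exact ⟨biprod.desc g g', by ext <;> simp [hg, hg']⟩
  · rw [biprod.lift_desc, ← h, ← h']
    abel

variable [HasZeroObject C]

instance stableRel_congruence : Congruence (stableRel E) where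
  comp_left := by
    rintro X Y Z f g g' ⟨Q, hQ, a, b, h⟩
    exact ⟨Q, hQ, f ≫ a, b, by rw [← Preadditive.comp_sub, h, Category.assoc]⟩
  comp_right := by
    rintro X Y Z f f' g ⟨Q, hQ, a, b, h⟩
    exact ⟨Q, hQ, a, b ≫ g, by rw [← Preadditive.sub_comp, h, Category.assoc]⟩
  equivalence := by
    intro X Y
    have hrefl : ∀ f : X ⟶ Y, stableRel E f f := fun f =>
      ⟨Classical.choose (HasZeroObject.zero (C := C)), fun S _ f =>
        ⟨0, (Classical.choose_spec (HasZeroObject.zero (C := C))).eq_of_src _ _⟩,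
        0, 0, by simp⟩
    refine ⟨hrefl, ?_, ?_⟩
    · rintro f g ⟨Q, hQ, a, b, h⟩
      exact ⟨Q, hQ, -a, b, by rw [Preadditive.neg_comp, ← h, neg_sub]⟩
    · intro f g k hfg hgk
      have := stableRel_add E _ _ _ _ (stableRel_add E _ _ _ _ hfg hgk) (hrefl (-g))
      simpa [add_comm, add_left_comm, add_assoc] using this

/-- The stable category of the exact category `(C, E)`. -/
abbrev StableCategory : Type _ := CategoryTheory.Quotient (stableRel E)

/-- The projection onto the stable category. -/
abbrev toStable : C ⥤ StableCategory E := CategoryTheory.Quotient.functor (stableRel E)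

instance : Preadditive (StableCategory E) :=
  CategoryTheory.Quotient.preadditive _ (fun _ _ => stableRel_add E)

instance : (toStable E).Additive :=
  CategoryTheory.Quotient.functor_additive _ (fun _ _ => stableRel_add E)

instance : HasZeroObject (StableCategory E) := by
  obtain ⟨Z, hZ⟩ := HasZeroObject.zero (C := C)
  exact ⟨_, (toStable E).map_isZero hZ⟩

/-- Happel's triangulated structure on the stable category of a Frobenius exact category.
The translation of `X` is the third term of any conflation `X ⟶ I ⟶ X'` with `I`
projective-injective, naturally in the conflation, and the distinguished triangles
are the triangles isomorphic to a standard one `X ⟶ Y ⟶ Z ⟶ X⟦1⟧`, where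
`Z` is the pushout of `X ⟶ I` along some `u : X ⟶ Y` and `Z ⟶ X'` is the
morphism induced by `I ⟶ X'` and `0 : Y ⟶ X'`. These conditions determine the
structure up to isomorphism. -/
class StableTriangulation where
  hasShift : HasShift (StableCategory E) ℤ
  shift_additive : ∀ n : ℤ, (shiftFunctor (StableCategory E) n).Additive
  pretriangulated : Pretriangulated (StableCategory E)
  isTriangulated : IsTriangulated (StableCategory E)
  shiftIso (S : ShortComplex C) (hS : E S)
    (hp : relProjective E S.X₂) (hi : relInjective E S.X₂) :
    (toStable E).obj S.X₃ ≅ ((toStable E).obj S.X₁)⟦(1 : ℤ)⟧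
  shiftIso_naturality {S S' : ShortComplex C} (φ : S ⟶ S')
    (hS : E S) (hp : relProjective E S.X₂) (hi : relInjective E S.X₂)
    (hS' : E S') (hp' : relProjective E S'.X₂) (hi' : relInjective E S'.X₂) :
    (toStable E).map φ.τ₃ ≫ (shiftIso S' hS' hp' hi').hom =
      (shiftIso S hS hp hi).hom ≫ ((toStable E).map φ.τ₁)⟦(1 : ℤ)⟧'
  distinguished_iff (T : Triangle (StableCategory E)) :
    T ∈ distTriang (StableCategory E) ↔
      ∃ (S : ShortComplex C) (hS : E S) (hp : relProjective E S.X₂)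
        (hi : relInjective E S.X₂) (Y Z : C) (u : S.X₁ ⟶ Y) (v : Y ⟶ Z) (x : S.X₂ ⟶ Z)
        (w : Z ⟶ S.X₃),
        IsPushout S.f u x v ∧ x ≫ w = S.g ∧ v ≫ w = 0 ∧
        Nonempty (T ≅ Triangle.mk ((toStable E).map u) ((toStable E).map v)
          ((toStable E).map w ≫ (shiftIso S hS hp hi).hom))

attribute [reducible] StableTriangulation.hasShift StableTriangulation.pretriangulated

attribute [instance] StableTriangulation.hasShift StableTriangulation.shift_additive
  StableTriangulation.pretriangulated StableTriangulation.isTriangulated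

end StableCategory

end Frobenius

namespace Recoll

section

variable {D : Type*} [Category D] [HasZeroObject D] [HasShift D ℤ] [Preadditive D]
  [∀ n : ℤ, (shiftFunctor D n).Additive] [Pretriangulated D]

/-- Stable t-structures `(U, V)`; the full subcategories are given by
properties of objects. -/
structure IsStableTStructure (U V : ObjectProperty D) : Prop where
  shift_left : ∀ X : D, U (X⟦(1 : ℤ)⟧) ↔ U X
  shift_right : ∀ X : D, V (X⟦(1 : ℤ)⟧) ↔ V X
  hom_eq_zero : ∀ ⦃X Y : D⦄, U X → V Y → ∀ f : X ⟶ Y, f = 0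
  exists_triangle : ∀ X : D, ∃ (A B : D) (_ : U A) (_ : V B)
    (f : A ⟶ X) (g : X ⟶ B) (h : B ⟶ A⟦(1 : ℤ)⟧), Triangle.mk f g h ∈ distTriang D

/-- Triangles of recollements formed by three triangulated full subcategories. -/
structure IsTriangleOfRecollements (U V W : ObjectProperty D)
    [U.IsTriangulated] [V.IsTriangulated] [W.IsTriangulated] : Prop where
  fst : IsStableTStructure U V
  snd : IsStableTStructure V W
  thd : IsStableTStructure W U

variable {D' : Type*} [Category D'] [HasZeroObject D'] [HasShift D' ℤ] [Preadditive D']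
  [∀ n : ℤ, (shiftFunctor D' n).Additive] [Pretriangulated D']
  {D'' : Type*} [Category D''] [HasZeroObject D''] [HasShift D'' ℤ] [Preadditive D'']
  [∀ n : ℤ, (shiftFunctor D'' n).Additive] [Pretriangulated D'']

/-- Recollements `D' ⇄ D ⇄ D''` with prescribed triangle functors
`i_* = i : D' ⥤ D` and `j^* = j : D ⥤ D''`. -/
structure Recollement (i : D' ⥤ D) [i.CommShift ℤ] [i.IsTriangulated]
    (j : D ⥤ D'') [j.CommShift ℤ] [j.IsTriangulated] where
  /-- `i^*` -/
  iStar : D ⥤ D'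
  /-- `i^!` -/
  iShriek : D ⥤ D'
  /-- `j_!` -/
  jShriek : D'' ⥤ D
  /-- `j_*` -/
  jStar : D'' ⥤ D
  iStar_commShift : iStar.CommShift ℤ
  iShriek_commShift : iShriek.CommShift ℤ
  jShriek_commShift : jShriek.CommShift ℤ
  jStar_commShift : jStar.CommShift ℤ
  iStar_isTriangulated : iStar.IsTriangulated
  iShriek_isTriangulated : iShriek.IsTriangulated
  jShriek_isTriangulated : jShriek.IsTriangulated
  jStar_isTriangulated : jStar.IsTriangulated
  i_full : i.Full
  i_faithful : i.Faithful
  jShriek_full : jShriek.Full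
  jShriek_faithful : jShriek.Faithful
  jStar_full : jStar.Full
  jStar_faithful : jStar.Faithful
  adj_iStar : iStar ⊣ i
  adj_iShriek : i ⊣ iShriek
  adj_jShriek : jShriek ⊣ j
  adj_jStar : j ⊣ jStar
  essImage_jShriek : jShriek.essImage = iStar.kernel
  essImage_i : i.essImage = j.kernel
  essImage_jStar : jStar.essImage = iShriek.kernel

end

/-- Two triangulated categories are triangle equivalent. -/
def TriangleEquivalent (C : Type*) [Category C] [HasZeroObject C] [HasShift C ℤ] [Preadditive C]
    [∀ n : ℤ, (shiftFunctor C n).Additive] [Pretriangulated C]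
    (D : Type*) [Category D] [HasZeroObject D] [HasShift D ℤ] [Preadditive D]
    [∀ n : ℤ, (shiftFunctor D n).Additive] [Pretriangulated D] : Prop :=
  ∃ (F : C ⥤ D) (_ : F.CommShift ℤ), F.IsTriangulated ∧ F.IsEquivalence

end Recoll

namespace Gorenstein

/-- Iwanaga-Gorenstein rings: two-sided Noetherian, and of finite injective dimension both
as a left and as a right module over themselves. Right `R`-modules are `Rᵐᵒᵖ`-modules. -/
structure IsIwanagaGorenstein (R : Type u) [Ring R] : Prop where
  left_noetherian : IsNoetherianRing R
  right_noetherian : IsNoetherianRing Rᵐᵒᵖ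
  left_injectiveDimension :
    ∃ n : ℕ, HasInjectiveDimensionLE (ModuleCat.of.{u} R R) n
  right_injectiveDimension :
    ∃ n : ℕ, HasInjectiveDimensionLE (ModuleCat.of.{u} Rᵐᵒᵖ R) n

variable (R : Type u) [Ring R]

/-- Cohen-Macaulay right `R`-modules: finitely presented right modules `X`
with `Ext^i(X, R) = 0` for all `i > 0`. -/
def isCM : ObjectProperty (ModuleCat.{u} Rᵐᵒᵖ) := fun X =>
  Module.FinitePresentation Rᵐᵒᵖ X ∧
    ∀ i : ℕ, 0 < i → Subsingleton (Abelian.Ext.{u} X (ModuleCat.of.{u} Rᵐᵒᵖ R) i)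

/-- Surjective morphisms `α : X ⟶ T` between Cohen-Macaulay right modules. -/
def isMorE : ObjectProperty (Arrow (ModuleCat.{u} Rᵐᵒᵖ)) := fun α =>
  isCM R α.left ∧ isCM R α.right ∧ Function.Surjective α.hom

lemma hasBinaryBiproducts_fullSubcategory {C : Type*} [Category C] [Preadditive C]
    (P : ObjectProperty C)
    (h : ∀ X Y : C, P X → P Y → ∃ b : BinaryBicone X Y,
      P b.pt ∧ b.fst ≫ b.inl + b.snd ≫ b.inr = 𝟙 b.pt) :
    HasBinaryBiproducts P.FullSubcategory where
  has_binary_biproduct X Y := by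
    obtain ⟨b, hb, ht⟩ := h X.obj Y.obj X.property Y.property
    exact hasBinaryBiproduct_of_total
      { pt := ⟨b.pt, hb⟩
        fst := ObjectProperty.homMk b.fst
        snd := ObjectProperty.homMk b.snd
        inl := ObjectProperty.homMk b.inl
        inr := ObjectProperty.homMk b.inr
        inl_fst := by ext; simp
        inl_snd := by ext; simp
        inr_fst := by ext; simp
        inr_snd := by ext; simp }
      (by ext; exact ht)

lemma isCM_of_isZero {X : ModuleCat.{u} Rᵐᵒᵖ} (hX : IsZero X) : isCM R X := by
  have : Subsingleton X := ModuleCat.subsingleton_of_isZero hX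
  refine ⟨inferInstance, fun i _ => ⟨fun a b => ?_⟩⟩
  rw [← Abelian.Ext.mk₀_id_comp a, ← Abelian.Ext.mk₀_id_comp b, hX.eq_of_src (𝟙 X) 0,
    Abelian.Ext.mk₀_zero, Abelian.Ext.zero_comp, Abelian.Ext.zero_comp]

lemma isCM_biprod {X Y : ModuleCat.{u} Rᵐᵒᵖ} (hX : isCM R X) (hY : isCM R Y) :
    isCM R (X ⊞ Y) := by
  have := hX.1
  have := hY.1
  refine ⟨.of_equiv (ModuleCat.biprodIsoProd X Y).toLinearEquiv.symm, fun i hi => ?_⟩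
  have := hX.2 i hi
  have := hY.2 i hi
  refine ⟨fun a b => ?_⟩
  rw [← Abelian.Ext.mk₀_id_comp a, ← Abelian.Ext.mk₀_id_comp b, ← biprod.total,
    Abelian.Ext.mk₀_add, Abelian.Ext.add_comp, Abelian.Ext.add_comp,
    ← Abelian.Ext.mk₀_comp_mk₀_assoc, ← Abelian.Ext.mk₀_comp_mk₀_assoc,
    ← Abelian.Ext.mk₀_comp_mk₀_assoc, ← Abelian.Ext.mk₀_comp_mk₀_assoc]
  congr 2 <;> exact Subsingleton.elim _ _

instance : (isCM R).ContainsZero := ⟨_, isZero_zero _, isCM_of_isZero R (isZero_zero _)⟩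

instance : HasBinaryBiproducts (isCM R).FullSubcategory :=
  hasBinaryBiproducts_fullSubcategory _ fun X Y hX hY =>
    ⟨BinaryBiproduct.bicone X Y, isCM_biprod R hX hY, biprod.total⟩

instance : (isMorE R).ContainsZero where
  exists_zero := by
    have hZ := isZero_zero (ModuleCat.{u} Rᵐᵒᵖ)
    refine ⟨Arrow.mk (𝟙 (0 : ModuleCat.{u} Rᵐᵒᵖ)), ?_, isCM_of_isZero R hZ, isCM_of_isZero R hZ,
      Function.surjective_id⟩
    rw [IsZero.iff_id_eq_zero]
    ext1 <;> exact hZ.eq_of_src _ _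

instance : HasBinaryBiproducts (isMorE R).FullSubcategory :=
  hasBinaryBiproducts_fullSubcategory _ fun α β hα hβ =>
    ⟨{  pt := Arrow.mk (biprod.map α.hom β.hom)
        fst := Arrow.homMk biprod.fst biprod.fst
        snd := Arrow.homMk biprod.snd biprod.snd
        inl := Arrow.homMk biprod.inl biprod.inl
        inr := Arrow.homMk biprod.inr biprod.inr },
      ⟨isCM_biprod R hα.1 hβ.1, isCM_biprod R hα.2.1 hβ.2.1, by
        have := (ModuleCat.epi_iff_surjective _).2 hα.2.2
        have := (ModuleCat.epi_iff_surjective _).2 hβ.2.2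
        exact (ModuleCat.epi_iff_surjective (biprod.map α.hom β.hom)).1 inferInstance⟩,
      by ext1 <;> exact biprod.total⟩

/-- The conflations of `CM R`: the sequences that are short exact in `Mod R`. -/
def cmConflation : ObjectProperty (ShortComplex (isCM R).FullSubcategory) := fun S =>
  (S.map (isCM R).ι).ShortExact

/-- The conflations of `Mor^e(CM R)`: the sequences that are short exact in `Mor(Mod R)`, that is,
short exact at the sources and at the targets. -/
def morEConflation : ObjectProperty (ShortComplex (isMorE R).FullSubcategory) := fun S =>
  (S.map ((isMorE R).ι ⋙ Arrow.leftFunc)).ShortExact ∧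
    (S.map ((isMorE R).ι ⋙ Arrow.rightFunc)).ShortExact

/-- The stable category of `CM R`. -/
abbrev StableCM : Type _ := Frobenius.StableCategory (cmConflation R)

/-- The stable category of `Mor^e(CM R)`. -/
abbrev StableMorE : Type _ := Frobenius.StableCategory (morEConflation R)

/-- The objects of the stable category of `Mor^e(CM R)` corresponding to the `P ⟶ T`
with `P` projective; `ObjectProperty.map` closes under isomorphisms. -/
def mor01 : ObjectProperty (StableMorE R) :=
  ObjectProperty.map (fun α => Module.Projective Rᵐᵒᵖ α.obj.left)
    (Frobenius.toStable (morEConflation R))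

/-- The objects of the stable category of `Mor^e(CM R)` corresponding to the `X ⟶ 0`. -/
def mor10 : ObjectProperty (StableMorE R) :=
  ObjectProperty.map (fun α => IsZero α.obj.right)
    (Frobenius.toStable (morEConflation R))

/-- The objects of the stable category of `Mor^e(CM R)` corresponding to the identities
`T ⟶ T`. -/
def mor11 : ObjectProperty (StableMorE R) :=
  ObjectProperty.map (fun α => ∃ T : ModuleCat.{u} Rᵐᵒᵖ, Nonempty (α.obj ≅ Arrow.mk (𝟙 T)))
    (Frobenius.toStable (morEConflation R))

end Gorenstein

/-! Both exact categories are Frobenius, and the rest is read off from three conflations of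
surjections and three vanishing statements.

For Cohen-Macaulay modules the point is that free modules provide enough relative injectives. Write
X* for the left module of linear forms. It is finitely generated, and a finite set of generators
gives a map X → R^n through which every form on X extends. This extension property makes the
cokernel Cohen-Macaulay. Injectivity means that X is torsionless: finite left injective dimension
and dimension shifting along syzygies give Ext^i(X*, R) = 0 for i > 0, whence an element killed by
all forms is zero (`extVanishing_dual`, `eq_zero_of_forall_dual`, `exists_embedding`). For
surjections X → T, the projectives are exactly the surjections between projective modules, and every
surjection both is covered by and embeds into such an object.

Happel's theorem rests on one normalization: up to isomorphism the standard triangles are the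
triangles of conflations with third map -δ (`isStd_tri`, `exists_tri_of_isStd`). The axioms then
become lifting and extension arguments in the exact category.

Let α : X → T be surjective with kernel K. Let P → X be a free cover with kernel L, and X → Q an
inflation into a free module with cokernel C. The conflations (K → 0) → α → (T = T), (L → 0) → (P →
T) → α, α → (Q → Q/K) → (C = C) give, the last two after a rotation, the decomposition triangles for
the pairs (10, 11), (01, 10), (11, 01). The corresponding Hom groups vanish by explicit
factorizations through projectives. The subcategories 01 and 10 are the kernels of the stable source
and target functors, hence triangulated; the decompositions identify 01 and 11 with the left and
right orthogonals of 10. The recollement is then formal (`exists_recollement`). The source functor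
restricted to 10, and the target functor restricted to 11 and to 01, are the equivalences with the
stable category of Cohen-Macaulay modules. -/

namespace ShiftAux

/-! ### Integer shifts from an autoequivalence, and functors commuting with them -/

lemma exists_int_section {T : ℤ → Type*} (e : ∀ n, T n ≃ T (n + 1)) (t₀ : T 0) :
    ∃ t : ∀ n, T n, t 0 = t₀ ∧ ∀ n, t (n + 1) = e n (t n) := by
  let tp : ∀ n : ℕ, T (Int.ofNat n) := fun n =>
    Nat.rec (motive := fun n => T (Int.ofNat n)) t₀ (fun k x => e (Int.ofNat k) x) n
  let tn : ∀ n : ℕ, T (Int.negSucc n) := fun n =>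
    Nat.rec (motive := fun n => T (Int.negSucc n)) ((e (Int.negSucc 0)).symm t₀)
      (fun k x => (e (Int.negSucc (k + 1))).symm x) n
  refine ⟨fun n => Int.rec tp tn n, rfl, ?_⟩
  -- Adding 1 computes on constructors: `ofNat n` goes to `ofNat (n + 1)`, `negSucc 0` to 0 and
  -- `negSucc (k + 1)` to `negSucc k`. Each case is thus the recursion equation, upwards by `e` or
  -- downwards by its inverse.
  rintro (n | n)
  · rfl
  · cases n with
    | zero => exact ((e (Int.negSucc 0)).apply_symm_apply t₀).symm
    | succ k => exact ((e (Int.negSucc (k + 1))).apply_symm_apply (tn k)).symm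

/-- The `ℤ`-indexed orbits of an endofunctor `S`: sequences of objects together with
isomorphisms identifying `S` of each term with the next one. -/
structure Orbit {A : Type*} [Category A] (S : A ⥤ A) where
  /-- the terms -/
  obj : ℤ → A
  /-- the transition isomorphisms -/
  iso : ∀ m n : ℤ, m + 1 = n → (S.obj (obj m) ≅ obj n)

namespace Orbit

variable {A : Type*} [Category A] {S : A ⥤ A}

/-- Morphisms of orbits. -/
@[ext]
structure Hom (X Y : Orbit S) where
  /-- the components -/
  f : ∀ n, X.obj n ⟶ Y.obj n
  comm : ∀ (m n : ℤ) (h : m + 1 = n),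
    (X.iso m n h).hom ≫ f n = S.map (f m) ≫ (Y.iso m n h).hom

instance : Category (Orbit S) where
  Hom := Hom
  id X := { f := fun _ => 𝟙 _, comm := by simp }
  comp φ ψ :=
    { f := fun n => φ.f n ≫ ψ.f n
      comm := fun m n h => by rw [← Category.assoc, φ.comm]; simp [ψ.comm] }

@[ext]
lemma hom_ext {X Y : Orbit S} (φ ψ : X ⟶ Y) (h : ∀ n, φ.f n = ψ.f n) : φ = ψ :=
  Hom.ext (funext h)

@[simp] lemma id_f (X : Orbit S) (n : ℤ) : Hom.f (𝟙 X) n = 𝟙 _ := rfl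
@[simp] lemma comp_f {X Y Z : Orbit S} (φ : X ⟶ Y) (ψ : Y ⟶ Z) (n : ℤ) :
    Hom.f (φ ≫ ψ) n = φ.f n ≫ ψ.f n := rfl

/-- The identification of terms with equal indices. -/
def cast (X : Orbit S) {m n : ℤ} (h : m = n) : X.obj m ⟶ X.obj n := eqToHom (by rw [h])

@[simp] lemma cast_rfl (X : Orbit S) (n : ℤ) (h : n = n) : X.cast h = 𝟙 _ := rfl

@[simp] lemma cast_cast (X : Orbit S) {m n k : ℤ} (h : m = n) (h' : n = k) :
    X.cast h ≫ X.cast h' = X.cast (h.trans h') := by subst h h'; simp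

lemma cast_naturality {X Y : Orbit S} (φ : X ⟶ Y) {m n : ℤ} (h : m = n) :
    X.cast h ≫ φ.f n = φ.f m ≫ Y.cast h := by subst h; simp

lemma iso_cast (X : Orbit S) {m n m' n' : ℤ} (h : m + 1 = n) (h' : m' + 1 = n') (hm : m = m')
    (hn : n = n') :
    (X.iso m n h).hom ≫ X.cast hn = S.map (X.cast hm) ≫ (X.iso m' n' h').hom := by
  subst hm hn; simp

lemma eqToHom_f {X Y : Orbit S} (h : X = Y) (n : ℤ) :
    Hom.f (eqToHom h) n = eqToHom (by rw [h]) := by subst h; rfl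

/-- Reindexing of orbits. -/
@[simps]
def reindex (k : ℤ) : Orbit S ⥤ Orbit S where
  obj X :=
    { obj := fun n => X.obj (n + k)
      -- Indexing the transition maps by pairs with `m + 1 = n` is what allows reindexing without
      -- transport along `m + 1 + k = m + k + 1`.
      iso := fun m n h => X.iso (m + k) (n + k) (by omega) }
  map φ :=
    { f := fun n => φ.f (n + k)
      comm := fun m n h => φ.comm _ _ _ }

/-- Isomorphisms of orbits from isomorphisms of the terms. -/
@[simps]
def isoMk {X Y : Orbit S} (e : ∀ n, X.obj n ≅ Y.obj n)
    (he : ∀ (m n : ℤ) (h : m + 1 = n),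
      (X.iso m n h).hom ≫ (e n).hom = S.map (e m).hom ≫ (Y.iso m n h).hom) : X ≅ Y where
  hom := ⟨fun n => (e n).hom, he⟩
  inv := ⟨fun n => (e n).inv, fun m n h => by
    rw [← cancel_mono (e n).hom, Category.assoc, Category.assoc, he]
    simp [← S.map_comp_assoc]⟩
  hom_inv_id := by ext n; simp
  inv_hom_id := by ext n; simp

/-- `cast` as an isomorphism. -/
@[simps]
def castIso (X : Orbit S) {m n : ℤ} (h : m = n) : X.obj m ≅ X.obj n where
  hom := X.cast h
  inv := X.cast h.symm

/-- The reindexing functors form a shift. -/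
def shiftMkCore : ShiftMkCore (Orbit S) ℤ where
  F := reindex
  zero := NatIso.ofComponents
    (fun X => isoMk (fun n => X.castIso (add_zero n)) (fun m n h => X.iso_cast _ _ (add_zero m) (add_zero n)))
    (fun φ => by ext n; exact (cast_naturality φ (add_zero n)).symm)
  add a b := NatIso.ofComponents
    (fun X => isoMk (fun n => X.castIso (show n + (a + b) = n + b + a by omega))
      (fun m n h => X.iso_cast _ _ (show m + (a + b) = m + b + a by omega)
        (show n + (a + b) = n + b + a by omega)))
    (fun φ => by
      ext n; exact (cast_naturality φ (show n + (a + b) = n + b + a by omega)).symm)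
  assoc_hom_app a b c X := by
    ext n
    rw [comp_f, comp_f, comp_f, eqToHom_f]
    change X.cast (show n + (a + b + c) = n + c + (a + b) by omega) ≫
        X.cast (show n + c + (a + b) = n + c + b + a by omega) =
      X.cast (show n + (a + b + c) = n + (a + (b + c)) by omega) ≫
        X.cast (show n + (a + (b + c)) = n + (b + c) + a by omega) ≫
        X.cast (show n + (b + c) + a = n + c + b + a by omega)
    simp
  zero_add_hom_app a X := by
    ext n
    rw [comp_f, eqToHom_f]
    change X.cast (show n + (0 + a) = n + a + 0 by omega) =
      X.cast (show n + (0 + a) = n + a by omega) ≫ X.cast (show n + a = n + a + 0 by omega)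
    simp
  add_zero_hom_app a X := by
    ext n
    rw [comp_f, eqToHom_f]
    change X.cast (show n + (a + 0) = n + 0 + a by omega) =
      X.cast (show n + (a + 0) = n + a by omega) ≫ X.cast (show n + a = n + 0 + a by omega)
    simp

instance : HasShift (Orbit S) ℤ := hasShiftMk _ _ shiftMkCore

lemma shift_obj_obj (X : Orbit S) (k n : ℤ) :
    ((shiftFunctor (Orbit S) k).obj X).obj n = X.obj (n + k) := rfl

lemma shift_map_f {X Y : Orbit S} (φ : X ⟶ Y) (k n : ℤ) :
    ((shiftFunctor (Orbit S) k).map φ).f n = φ.f (n + k) := rfl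

variable (S) in
/-- The zeroth term. -/
@[simps]
def eval : Orbit S ⥤ A where
  obj X := X.obj 0
  map φ := φ.f 0

/-- Upwards, compatibility with the transition isomorphisms determines the next component;
downwards, faithfulness of `S` recovers the previous one. -/
lemma f_eq_of_zero [S.Faithful] {X Y : Orbit S} {φ ψ : X ⟶ Y} (h : φ.f 0 = ψ.f 0) (n : ℤ) :
    φ.f n = ψ.f n := by
  induction n using Int.induction_on with
  | zero => exact h
  | succ i hi =>
    rw [← cancel_epi (X.iso i (i + 1) rfl).hom, φ.comm, ψ.comm, hi]
  | pred i hi =>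
    apply S.map_injective
    rw [← cancel_mono (Y.iso (-i - 1) (-i) (by omega)).hom, ← φ.comm, ← ψ.comm, hi]

instance [S.Faithful] : (eval S).Faithful where
  map_injective h := by ext n; exact f_eq_of_zero h n

/-- A component in degree `n` corresponds bijectively to one in degree `n + 1`, by applying `S` and
conjugating with the transition isomorphisms, so a map in degree 0 spreads to all degrees. -/
instance [S.Full] [S.Faithful] : (eval S).Full where
  map_surjective {X Y} g := by
    obtain ⟨t, ht₀, ht⟩ := exists_int_section (T := fun n => X.obj n ⟶ Y.obj n)
      (fun n => ((Functor.FullyFaithful.ofFullyFaithful S).homEquiv).trans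
        ((X.iso n (n + 1) rfl).homCongr (Y.iso n (n + 1) rfl))) g
    refine ⟨⟨t, ?_⟩, ht₀⟩
    rintro m n rfl
    rw [ht]
    simp [Functor.FullyFaithful.homEquiv]

instance [S.IsEquivalence] : (eval S).EssSurj where
  mem_essImage X := by
    -- The orbit through `X`: iterates of `S` in degrees at least 0 and iterates of the
    -- quasi-inverse in negative degrees, glued by counits.
    let o : ℤ → A := fun n => Int.rec
      (fun k => Nat.rec (motive := fun _ => A) X (fun _ Y => S.obj Y) k)
      (fun k => Nat.rec (motive := fun _ => A) (S.inv.obj X) (fun _ Y => S.inv.obj Y) k) n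
    refine ⟨⟨o, ?_⟩, ⟨Iso.refl _⟩⟩
    rintro m n rfl
    match m with
    | .ofNat k => exact Iso.refl _
    | .negSucc 0 => exact S.asEquivalence.counitIso.app X
    | .negSucc (k + 1) => exact S.asEquivalence.counitIso.app (o (Int.negSucc k))

instance [S.IsEquivalence] : (eval S).IsEquivalence where

end Orbit

/-- An autoequivalence generates a shift by the integers. -/
theorem exists_hasShift_of_isEquivalence {A : Type*} [Category A] (S : A ⥤ A)
    [S.IsEquivalence] :
    ∃ (_ : HasShift A ℤ), Nonempty (shiftFunctor A (1 : ℤ) ≅ S) := by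
  -- Powers of `S` compose only up to coherent isomorphism. On orbits the shift is reindexing, where
  -- the coherences concern only equalities of indices; it is carried to `A` along the equivalence
  -- `eval`.
  let F := Orbit.eval S
  let s : ℤ → A ⥤ A := fun a => F.inv ⋙ shiftFunctor (Orbit S) a ⋙ F
  let i : ∀ a, F ⋙ s a ≅ shiftFunctor (Orbit S) a ⋙ F := fun a =>
    Functor.isoWhiskerRight F.asEquivalence.unitIso.symm (shiftFunctor (Orbit S) a ⋙ F)
  obtain ⟨ε, hε⟩ : ∃ ε : ∀ X, (F.inv.obj X).obj 0 ≅ X,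
      ∀ ⦃X Y : A⦄ (f : X ⟶ Y), (F.inv.map f).f 0 ≫ (ε Y).hom = (ε X).hom ≫ f :=
    ⟨fun X => F.asEquivalence.counitIso.app X, fun X Y f =>
      F.asEquivalence.counitIso.hom.naturality f⟩
  -- The shift by 1 evaluates an orbit at index `0 + 1`, which the transition isomorphism identifies
  -- with `S` of the term at 0.
  let e : s 1 ≅ S := NatIso.ofComponents (fun X =>
    (((F.inv.obj X).iso 0 (0 + 1) rfl).symm : (F.inv.obj X).obj (0 + 1) ≅ _) ≪≫
      S.mapIso (ε X)) (fun {X Y} f => by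
      have h₁ := (F.inv.map f).comm 0 (0 + 1) rfl
      have h₃ : (F.inv.map f).f (0 + 1) ≫ ((F.inv.obj Y).iso 0 (0 + 1) rfl).inv =
          ((F.inv.obj X).iso 0 (0 + 1) rfl).inv ≫ S.map ((F.inv.map f).f 0) := by
        rw [Iso.comp_inv_eq, Category.assoc, ← h₁, Iso.inv_hom_id_assoc]
      change (F.inv.map f).f (0 + 1) ≫ ((F.inv.obj Y).iso 0 (0 + 1) rfl).inv ≫
        S.map (ε Y).hom = (((F.inv.obj X).iso 0 (0 + 1) rfl).inv ≫ S.map (ε X).hom) ≫ S.map f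
      rw [reassoc_of% h₃, Category.assoc, ← S.map_comp, ← S.map_comp, hε])
  exact ⟨HasShift.induced F ℤ s i, ⟨e⟩⟩

/-- The commutation isomorphisms of `F` with the shifts, all degrees together. -/
structure CommIso {C D : Type*} [Category C] [Category D] [HasShift C ℤ] [HasShift D ℤ]
    (F : C ⥤ D) where
  /-- the degree -/
  deg : ℤ
  /-- the isomorphism -/
  iso : shiftFunctor C deg ⋙ F ≅ F ⋙ shiftFunctor D deg

namespace CommIso

open Functor.CommShift

variable {C D : Type*} [Category C] [Category D] [HasShift C ℤ] [HasShift D ℤ] {F : C ⥤ D}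

/-- The component of `x` in a given degree. -/
def inDeg (x : CommIso F) (n : ℤ) (h : x.deg = n) :
    shiftFunctor C n ⋙ F ≅ F ⋙ shiftFunctor D n := h ▸ x.iso

lemma ext_inDeg {x y : CommIso F} (n : ℤ) (hx : x.deg = n) (hy : y.deg = n)
    (h : x.inDeg n hx = y.inDeg n hy) : x = y := by
  obtain ⟨a, e⟩ := x
  obtain ⟨b, e'⟩ := y
  obtain rfl : a = n := hx
  obtain rfl : b = a := hy
  obtain rfl : e = e' := h
  rfl

noncomputable instance : Mul (CommIso F) := ⟨fun x y => ⟨x.deg + y.deg, isoAdd x.iso y.iso⟩⟩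

noncomputable instance : One (CommIso F) := ⟨⟨0, isoZero F ℤ⟩⟩

lemma deg_mul (x y : CommIso F) : (x * y).deg = x.deg + y.deg := rfl

lemma deg_one : (1 : CommIso F).deg = 0 := rfl

lemma inDeg_mul (x y : CommIso F) {a b c : ℤ} (ha : x.deg = a) (hb : y.deg = b) (h : a + b = c) :
    (x * y).inDeg c (by rw [deg_mul, ha, hb, h]) = isoAdd' h (x.inDeg a ha) (y.inDeg b hb) := by
  subst ha hb h
  rfl

noncomputable instance : Monoid (CommIso F) where
  mul_assoc x y z := by
    apply ext_inDeg (x.deg + y.deg + z.deg) rfl (by simp [deg_mul, add_assoc])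
    rw [inDeg_mul (x * y) z (deg_mul x y) rfl rfl, inDeg_mul x y rfl rfl rfl,
      inDeg_mul x (y * z) rfl (deg_mul y z) (add_assoc _ _ _).symm, inDeg_mul y z rfl rfl rfl]
    exact isoAdd'_assoc _ _ _ rfl rfl rfl
  one_mul x := by
    apply ext_inDeg x.deg (by simp [deg_mul, deg_one]) rfl
    rw [inDeg_mul 1 x rfl rfl (zero_add _)]
    exact isoZero_isoAdd'_ _
  mul_one x := by
    apply ext_inDeg x.deg (by simp [deg_mul, deg_one]) rfl
    rw [inDeg_mul x 1 rfl rfl (add_zero _)]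
    exact isoAdd'_isoZero _

/-- The equation determines the shift by `a` of each component of `e'`. Since that shift is fully
faithful, the components descend. This supplies inverses in the monoid `CommIso F`. -/
lemma exists_isoAdd'_eq_isoZero {a b : ℤ} (h : b + a = 0)
    (e : shiftFunctor C a ⋙ F ≅ F ⋙ shiftFunctor D a) :
    ∃ e' : shiftFunctor C b ⋙ F ≅ F ⋙ shiftFunctor D b,
      isoAdd' h e' e = isoZero F ℤ := by
  let t : (shiftFunctor C b ⋙ F) ⋙ shiftFunctor D a ≅
      (F ⋙ shiftFunctor D b) ⋙ shiftFunctor D a :=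
    Functor.associator _ _ _ ≪≫ Functor.isoWhiskerLeft _ e.symm ≪≫
      (Functor.associator _ _ _).symm ≪≫
      Functor.isoWhiskerRight (shiftFunctorAdd' C b a 0 h).symm F ≪≫ isoZero F ℤ ≪≫
      Functor.isoWhiskerLeft F (shiftFunctorAdd' D b a 0 h) ≪≫ (Functor.associator _ _ _).symm
  let e' : shiftFunctor C b ⋙ F ≅ F ⋙ shiftFunctor D b :=
    NatIso.ofComponents (fun X => (shiftFunctor D a).preimageIso (t.app X)) (fun {X Y} f => by
      apply (shiftFunctor D a).map_injective
      rw [Functor.map_comp, Functor.map_comp, Functor.preimageIso_hom, Functor.preimageIso_hom,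
        Functor.map_preimage, Functor.map_preimage]
      exact t.hom.naturality f)
  have he' (X : C) : (shiftFunctor D a).map (e'.hom.app X) = e.inv.app (X⟦b⟧) ≫
      F.map ((shiftFunctorAdd' C b a 0 h).inv.app X) ≫ (isoZero F ℤ).hom.app X ≫
      (shiftFunctorAdd' D b a 0 h).hom.app (F.obj X) := by
    have : e'.hom.app X = (shiftFunctor D a).preimage (t.hom.app X) := rfl
    rw [this, Functor.map_preimage]
    simp [t]
  refine ⟨e', ?_⟩
  ext X
  have h₁ := (e.hom_inv_id_app (X⟦b⟧))
  have h₂ := F.congr_map ((shiftFunctorAdd' C b a 0 h).hom_inv_id_app X)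
  rw [F.map_comp] at h₂
  simp only [isoAdd'_hom_app, he', Category.assoc, Iso.hom_inv_id_app, reassoc_of% h₁]
  rw [reassoc_of% h₂]
  simp

lemma exists_left_inv (x : CommIso F) : ∃ y, y * x = 1 := by
  obtain ⟨e', he⟩ := exists_isoAdd'_eq_isoZero (neg_add_cancel x.deg) x.iso
  refine ⟨⟨-x.deg, e'⟩, ext_inDeg 0 (neg_add_cancel x.deg) rfl ?_⟩
  rw [inDeg_mul _ x rfl rfl (neg_add_cancel x.deg)]
  exact he

/-- Commutation isomorphisms form a group. -/
noncomputable instance : Group (CommIso F) where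
  inv x := x.exists_left_inv.choose
  inv_mul_cancel x := x.exists_left_inv.choose_spec

variable (F) in
/-- The degree as a homomorphism. -/
noncomputable def degHom : CommIso F →* Multiplicative ℤ where
  toFun x := Multiplicative.ofAdd x.deg
  map_one' := rfl
  map_mul' _ _ := rfl

lemma deg_zpow (x : CommIso F) (hx : x.deg = 1) (n : ℤ) : (x ^ n).deg = n := by
  have := map_zpow (degHom F) x n
  have h : degHom F x = Multiplicative.ofAdd 1 := congrArg Multiplicative.ofAdd hx
  rw [h, ← ofAdd_zsmul, smul_eq_mul, mul_one] at this
  exact Multiplicative.ofAdd.injective this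

end CommIso

/-- A commutation isomorphism with the shift by `1` extends to all integers. -/
theorem exists_commShift {C D : Type*} [Category C] [Category D] [HasShift C ℤ] [HasShift D ℤ]
    (F : C ⥤ D) (e : shiftFunctor C (1 : ℤ) ⋙ F ≅ F ⋙ shiftFunctor D (1 : ℤ)) :
    ∃ h : F.CommShift ℤ, h.commShiftIso 1 = e := by
  let x : CommIso F := ⟨1, e⟩
  -- In the group `CommIso F` the degree-`n` isomorphism is the `n`-th power of the given one. The
  -- coherence conditions are the laws `x ^ 0 = 1` and `x ^ (a + b) = x ^ a * x ^ b`.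
  refine ⟨{ commShiftIso := fun n => (x ^ n).inDeg n (x.deg_zpow rfl n)
            commShiftIso_zero := ?_
            commShiftIso_add := fun a b => ?_ }, ?_⟩
  · have : ∀ (y : CommIso F) (h : y.deg = 0), y = 1 → y.inDeg 0 h = Functor.CommShift.isoZero F ℤ := by
      rintro y h rfl
      rfl
    exact this _ _ (zpow_zero x)
  · have : ∀ (y : CommIso F) (h : y.deg = a + b), y = x ^ a * x ^ b → y.inDeg (a + b) h =
        Functor.CommShift.isoAdd' rfl ((x ^ a).inDeg a (x.deg_zpow rfl a))
          ((x ^ b).inDeg b (x.deg_zpow rfl b)) := by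
      rintro y h rfl
      exact CommIso.inDeg_mul _ _ _ _ _
    exact this _ _ (zpow_add x a b)
  · have : ∀ (y : CommIso F) (h : y.deg = 1), y = x → y.inDeg 1 h = e := by
      rintro y h rfl
      rfl
    exact this _ _ (zpow_one x)

end ShiftAux

/-! ### Frobenius exact categories and the triangles of their conflations -/

namespace Frobenius

section

variable {C : Type*} [Category C] [Preadditive C] [HasBinaryBiproducts C]

/-- Frobenius exact categories: the closure properties of the class `E` of conflations
from which Happel's triangulation is built. -/
structure IsFrobenius (E : ObjectProperty (ShortComplex C)) : Prop where
  mono_f {S : ShortComplex C} (hS : E S) : Mono S.f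
  epi_g {S : ShortComplex C} (hS : E S) : Epi S.g
  exists_lift {S : ShortComplex C} (hS : E S) {T : C} (t : T ⟶ S.X₂) (ht : t ≫ S.g = 0) :
    ∃ s, s ≫ S.f = t
  exists_desc {S : ShortComplex C} (hS : E S) {T : C} (t : S.X₂ ⟶ T) (ht : S.f ≫ t = 0) :
    ∃ s, S.g ≫ s = t
  -- Pushouts of inflations, encoded as conflations X₁ → X₂ ⊞ Y → Z; the next field is the third
  -- isomorphism theorem for a composite of inflations.
  exists_biprod {S : ShortComplex C} (hS : E S) {Y : C} (u : S.X₁ ⟶ Y) :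
    ∃ (Z : C) (p : S.X₂ ⊞ Y ⟶ Z) (w : biprod.lift S.f u ≫ p = 0),
      E (ShortComplex.mk (biprod.lift S.f u) p w)
  exists_comp {X₁ X₂ X₃ Z₁₂ Z₂₃ : C} {f₁₂ : X₁ ⟶ X₂} {g₁₂ : X₂ ⟶ Z₁₂} {w₁₂ : f₁₂ ≫ g₁₂ = 0}
    {f₂₃ : X₂ ⟶ X₃} {g₂₃ : X₃ ⟶ Z₂₃} {w₂₃ : f₂₃ ≫ g₂₃ = 0}
    (h₁₂ : E (ShortComplex.mk f₁₂ g₁₂ w₁₂)) (h₂₃ : E (ShortComplex.mk f₂₃ g₂₃ w₂₃)) :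
    ∃ (Z₁₃ : C) (g₁₃ : X₃ ⟶ Z₁₃) (w₁₃ : (f₁₂ ≫ f₂₃) ≫ g₁₃ = 0) (m₁ : Z₁₂ ⟶ Z₁₃) (m₃ : Z₁₃ ⟶ Z₂₃)
      (w : m₁ ≫ m₃ = 0), E (ShortComplex.mk (f₁₂ ≫ f₂₃) g₁₃ w₁₃) ∧ E (ShortComplex.mk m₁ m₃ w) ∧
        g₁₂ ≫ m₁ = f₂₃ ≫ g₁₃ ∧ g₁₃ ≫ m₃ = g₂₃
  isPushout_of_isIso {S S' : ShortComplex C} (hS : E S) (hS' : E S') (φ : S ⟶ S')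
    (hφ : IsIso φ.τ₃) : IsPushout S.f φ.τ₁ φ.τ₂ S'.f
  enough_injectives (X : C) : ∃ (I X' : C) (i : X ⟶ I) (p : I ⟶ X') (w : i ≫ p = 0),
    E (ShortComplex.mk i p w) ∧ relProjective E I
  enough_projectives (X : C) : ∃ (P X' : C) (i : X' ⟶ P) (p : P ⟶ X) (w : i ≫ p = 0),
    E (ShortComplex.mk i p w) ∧ relProjective E P
  relInjective_of_relProjective {X : C} (hX : relProjective E X) : relInjective E X

/-- In a preadditive category, uniqueness of a factorization only has to be tested against zero. -/
lemma isPushout_of_exists_desc {X Y Z W : C} {f : X ⟶ Y} {g : X ⟶ Z} {inl : Y ⟶ W} {inr : Z ⟶ W}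
    (comm : f ≫ inl = g ≫ inr)
    (hdesc : ∀ ⦃T : C⦄ (a : Y ⟶ T) (b : Z ⟶ T), f ≫ a = g ≫ b → ∃ t, inl ≫ t = a ∧ inr ≫ t = b)
    (hext : ∀ ⦃T : C⦄ (t : W ⟶ T), inl ≫ t = 0 → inr ≫ t = 0 → t = 0) :
    IsPushout f g inl inr := by
  choose d hd₁ hd₂ using hdesc
  refine ⟨⟨comm⟩, ⟨PushoutCocone.IsColimit.mk comm (fun s => d s.inl s.inr s.condition)
    (fun s => hd₁ _ _ _) (fun s => hd₂ _ _ _) (fun s m h₁ h₂ => ?_)⟩⟩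
  rw [← sub_eq_zero]
  apply hext
  · rw [Preadditive.comp_sub, h₁, hd₁, sub_self]
  · rw [Preadditive.comp_sub, h₂, hd₂, sub_self]

variable [HasZeroObject C] {E : ObjectProperty (ShortComplex C)}

lemma toStable_map_eq_zero_iff {X Y : C} (f : X ⟶ Y) :
    (toStable E).map f = 0 ↔
      ∃ (Q : C) (_ : relProjective E Q) (a : X ⟶ Q) (b : Q ⟶ Y), f = a ≫ b := by
  rw [← Functor.map_zero (toStable E), Quotient.functor_map_eq_iff]
  simp only [stableRel, sub_zero]

lemma toStable_map_eq_iff {X Y : C} (f g : X ⟶ Y) :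
    (toStable E).map f = (toStable E).map g ↔
      ∃ (Q : C) (_ : relProjective E Q) (a : X ⟶ Q) (b : Q ⟶ Y), f - g = a ≫ b := by
  rw [Quotient.functor_map_eq_iff]
  rfl

lemma toStable_map_eq_of_sub_eq {X Y Q : C} (f g : X ⟶ Y) (hQ : relProjective E Q) (a : X ⟶ Q)
    (b : Q ⟶ Y) (h : f - g = a ≫ b) : (toStable E).map f = (toStable E).map g :=
  (toStable_map_eq_iff _ _).2 ⟨Q, hQ, a, b, h⟩

lemma isZero_toStable_obj {Q : C} (hQ : relProjective E Q) : IsZero ((toStable E).obj Q) := by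
  rw [IsZero.iff_id_eq_zero, ← (toStable E).map_id, toStable_map_eq_zero_iff]
  exact ⟨Q, hQ, 𝟙 _, 𝟙 _, by simp⟩

variable (E) in
/-- The isomorphism `X ≅ X ⊞ Q` of the stable category. -/
noncomputable def inlIso (X : C) {Q : C} (hQ : relProjective E Q) :
    (toStable E).obj X ≅ (toStable E).obj (X ⊞ Q) where
  hom := (toStable E).map biprod.inl
  inv := (toStable E).map biprod.fst
  hom_inv_id := by rw [← Functor.map_comp, biprod.inl_fst, CategoryTheory.Functor.map_id]
  inv_hom_id := by
    rw [← Functor.map_comp, ← CategoryTheory.Functor.map_id]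
    refine toStable_map_eq_of_sub_eq _ _ hQ (-biprod.snd) biprod.inr ?_
    rw [← biprod.total, Preadditive.neg_comp]
    abel

variable (E) in
/-- The isomorphism `X ≅ Q ⊞ X` of the stable category. -/
noncomputable def inrIso (X : C) {Q : C} (hQ : relProjective E Q) :
    (toStable E).obj X ≅ (toStable E).obj (Q ⊞ X) where
  hom := (toStable E).map biprod.inr
  inv := (toStable E).map biprod.snd
  hom_inv_id := by rw [← Functor.map_comp, biprod.inr_snd, CategoryTheory.Functor.map_id]
  inv_hom_id := by
    rw [← Functor.map_comp, ← CategoryTheory.Functor.map_id]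
    refine toStable_map_eq_of_sub_eq _ _ hQ (-biprod.fst) biprod.inl ?_
    rw [← biprod.total, Preadditive.neg_comp]
    abel

namespace IsFrobenius

variable (hE : IsFrobenius E)
include hE

omit [HasZeroObject C] in
lemma exists_hom_of_relInjective {S T : ShortComplex C} (hS : E S) (hT : relInjective E T.X₂)
    (a : S.X₁ ⟶ T.X₁) : ∃ φ : S ⟶ T, φ.τ₁ = a := by
  obtain ⟨b, hb⟩ := hT S hS (a ≫ T.f)
  obtain ⟨c, hc⟩ := hE.exists_desc hS (b ≫ T.g) (by rw [reassoc_of% hb, T.zero, comp_zero])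
  exact ⟨⟨a, b, c, hb.symm, hc.symm⟩, rfl⟩

omit [HasZeroObject C] in
lemma exists_hom_of_relProjective {S T : ShortComplex C} (hT : E T) (hS : relProjective E S.X₂)
    (c : S.X₃ ⟶ T.X₃) : ∃ φ : S ⟶ T, φ.τ₃ = c := by
  obtain ⟨b, hb⟩ := hS T hT (S.g ≫ c)
  obtain ⟨a, ha⟩ := hE.exists_lift hT (S.f ≫ b) (by rw [Category.assoc, hb, S.zero_assoc, zero_comp])
  exact ⟨⟨a, b, c, ha, hb⟩, rfl⟩

/-- If the first component factors through a projective-injective `Q`, extend its first half to the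
middle term of `S`. Subtracting the resulting map from `φ.τ₂` leaves something that descends to the
third term, and this factors `φ.τ₃` through `T.X₂`. It makes the suspension well defined on stable
morphisms. -/
lemma map_τ₃_eq_zero {S T : ShortComplex C} (hS : E S) (hT : relProjective E T.X₂)
    (φ : S ⟶ T) (h : (toStable E).map φ.τ₁ = 0) : (toStable E).map φ.τ₃ = 0 := by
  obtain ⟨Q, hQ, a, b, hab⟩ := (toStable_map_eq_zero_iff _).1 h
  obtain ⟨c, hc⟩ := hE.relInjective_of_relProjective hQ S hS a
  obtain ⟨k, hk⟩ := hE.exists_desc hS (φ.τ₂ - c ≫ b ≫ T.f) (by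
    rw [Preadditive.comp_sub, reassoc_of% hc, ← φ.comm₁₂, hab, Category.assoc, sub_self])
  refine (toStable_map_eq_zero_iff _).2 ⟨_, hT, k, T.g, ?_⟩
  have := hE.epi_g hS
  rw [← cancel_epi S.g, ← φ.comm₂₃, reassoc_of% hk, Preadditive.sub_comp]
  simp

/-- The dual argument, lifting instead of extending; it makes the suspension faithful. -/
lemma map_τ₁_eq_zero {S T : ShortComplex C} (hT : E T) (hS : relProjective E S.X₂)
    (φ : S ⟶ T) (h : (toStable E).map φ.τ₃ = 0) : (toStable E).map φ.τ₁ = 0 := by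
  obtain ⟨Q, hQ, a, b, hab⟩ := (toStable_map_eq_zero_iff _).1 h
  obtain ⟨c, hc⟩ := hQ T hT b
  obtain ⟨k, hk⟩ := hE.exists_lift hT (φ.τ₂ - S.g ≫ a ≫ c) (by
    rw [Preadditive.sub_comp, Category.assoc, Category.assoc, hc, φ.comm₂₃, hab, sub_self])
  refine (toStable_map_eq_zero_iff _).2 ⟨_, hS, S.f, k, ?_⟩
  have := hE.mono_f hT
  rw [← cancel_mono T.f, φ.comm₁₂, Category.assoc, hk, Preadditive.comp_sub]
  simp

lemma map_τ₃_eq {S T : ShortComplex C} (hS : E S) (hT : relProjective E T.X₂)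
    (φ ψ : S ⟶ T) (h : (toStable E).map φ.τ₁ = (toStable E).map ψ.τ₁) :
    (toStable E).map φ.τ₃ = (toStable E).map ψ.τ₃ := by
  rw [← sub_eq_zero, ← Functor.map_sub] at h ⊢
  exact hE.map_τ₃_eq_zero hS hT (φ - ψ) h

lemma map_τ₁_eq {S T : ShortComplex C} (hT : E T) (hS : relProjective E S.X₂)
    (φ ψ : S ⟶ T) (h : (toStable E).map φ.τ₃ = (toStable E).map ψ.τ₃) :
    (toStable E).map φ.τ₁ = (toStable E).map ψ.τ₁ := by
  rw [← sub_eq_zero, ← Functor.map_sub] at h ⊢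
  exact hE.map_τ₁_eq_zero hT hS (φ - ψ) h

/-- The middle term of the chosen conflation starting at `X`. -/
noncomputable def inj (X : C) : C := (hE.enough_injectives X).choose

/-- The last term of the chosen conflation starting at `X`. -/
noncomputable def susp (X : C) : C := (hE.enough_injectives X).choose_spec.choose

/-- The inflation of the chosen conflation starting at `X`. -/
noncomputable def i (X : C) : X ⟶ hE.inj X :=
  (hE.enough_injectives X).choose_spec.choose_spec.choose

/-- The deflation of the chosen conflation starting at `X`. -/
noncomputable def p (X : C) : hE.inj X ⟶ hE.susp X :=
  (hE.enough_injectives X).choose_spec.choose_spec.choose_spec.choose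

/-- The chosen conflation starting at `X`. -/
noncomputable abbrev injSeq (X : C) : ShortComplex C :=
  ShortComplex.mk (hE.i X) (hE.p X)
    (hE.enough_injectives X).choose_spec.choose_spec.choose_spec.choose_spec.choose

omit [HasZeroObject C] in
lemma injSeq_mem (X : C) : E (hE.injSeq X) :=
  (hE.enough_injectives X).choose_spec.choose_spec.choose_spec.choose_spec.choose_spec.1

omit [HasZeroObject C] in
lemma relProjective_inj (X : C) : relProjective E (hE.inj X) :=
  (hE.enough_injectives X).choose_spec.choose_spec.choose_spec.choose_spec.choose_spec.2

omit [HasZeroObject C] in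
lemma relInjective_inj (X : C) : relInjective E (hE.inj X) :=
  hE.relInjective_of_relProjective (hE.relProjective_inj X)

end IsFrobenius

variable (E) in
/-- The identification of the translation with the cokernels of inflations into
projective-injective objects. -/
structure ShiftData [HasShift (StableCategory E) ℤ] where
  /-- the isomorphism attached to a conflation with projective-injective middle term -/
  iso (S : ShortComplex C) (hS : E S) (hp : relProjective E S.X₂) (hi : relInjective E S.X₂) :
    (toStable E).obj S.X₃ ≅ ((toStable E).obj S.X₁)⟦(1 : ℤ)⟧
  naturality {S S' : ShortComplex C} (φ : S ⟶ S')
    (hS : E S) (hp : relProjective E S.X₂) (hi : relInjective E S.X₂)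
    (hS' : E S') (hp' : relProjective E S'.X₂) (hi' : relInjective E S'.X₂) :
    (toStable E).map φ.τ₃ ≫ (iso S' hS' hp' hi').hom =
      (iso S hS hp hi).hom ≫ ((toStable E).map φ.τ₁)⟦(1 : ℤ)⟧'

namespace ShiftData

variable [HasShift (StableCategory E) ℤ] (d : ShiftData E)

/-- The standard triangles. -/
def IsStd (T : Triangle (StableCategory E)) : Prop :=
  ∃ (S : ShortComplex C) (hS : E S) (hp : relProjective E S.X₂)
    (hi : relInjective E S.X₂) (Y Z : C) (u : S.X₁ ⟶ Y) (v : Y ⟶ Z) (x : S.X₂ ⟶ Z)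
    (w : Z ⟶ S.X₃),
    IsPushout S.f u x v ∧ x ≫ w = S.g ∧ v ≫ w = 0 ∧
    Nonempty (T ≅ Triangle.mk ((toStable E).map u) ((toStable E).map v)
      ((toStable E).map w ≫ (d.iso S hS hp hi).hom))

variable {d} in
lemma IsStd.of_iso {T T' : Triangle (StableCategory E)} (h : d.IsStd T) (e : T' ≅ T) :
    d.IsStd T' := by
  obtain ⟨S, hS, hp, hi, Y, Z, u, v, x, w, h₁, h₂, h₃, ⟨e'⟩⟩ := h
  exact ⟨S, hS, hp, hi, Y, Z, u, v, x, w, h₁, h₂, h₃, ⟨e ≪≫ e'⟩⟩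

variable (hE : IsFrobenius E)

/-- The connecting morphism of a conflation. -/
noncomputable def δ (S : ShortComplex C) (hS : E S) :
    (toStable E).obj S.X₃ ⟶ ((toStable E).obj S.X₁)⟦(1 : ℤ)⟧ :=
  (toStable E).map (hE.exists_hom_of_relInjective (T := hE.injSeq S.X₁) hS
    (hE.relInjective_inj S.X₁) (𝟙 S.X₁)).choose.τ₃ ≫
    (d.iso (hE.injSeq S.X₁) (hE.injSeq_mem _) (hE.relProjective_inj _)
      (hE.relInjective_inj _)).hom

/-- Any two comparisons with the same first component agree stably on third components, so `δ` can
be computed from an arbitrary morphism to a conflation with projective-injective middle term. -/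
lemma map_τ₃_iso {S T : ShortComplex C} (φ : S ⟶ T) (hS : E S) (hT : E T)
    (hp : relProjective E T.X₂) (hi : relInjective E T.X₂) :
    (toStable E).map φ.τ₃ ≫ (d.iso T hT hp hi).hom =
      d.δ hE S hS ≫ ((toStable E).map φ.τ₁)⟦(1 : ℤ)⟧' := by
  have hψ := (hE.exists_hom_of_relInjective (T := hE.injSeq S.X₁) hS
    (hE.relInjective_inj S.X₁) (𝟙 S.X₁)).choose_spec
  rw [δ]
  set ψ := (hE.exists_hom_of_relInjective (T := hE.injSeq S.X₁) hS
    (hE.relInjective_inj S.X₁) (𝟙 S.X₁)).choose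
  obtain ⟨χ, hχ⟩ := hE.exists_hom_of_relInjective (hE.injSeq_mem S.X₁) hi φ.τ₁
  have h₁ : (toStable E).map φ.τ₃ = (toStable E).map (ψ ≫ χ).τ₃ := by
    refine hE.map_τ₃_eq hS hp _ _ ?_
    rw [ShortComplex.comp_τ₁, hψ, hχ, Category.id_comp]
  rw [h₁, ShortComplex.comp_τ₃, Functor.map_comp, Category.assoc,
    d.naturality χ (hE.injSeq_mem _) (hE.relProjective_inj _) (hE.relInjective_inj _) hT hp hi,
    hχ, Category.assoc]

lemma δ_eq_iso_hom (S : ShortComplex C) (hS : E S) (hp : relProjective E S.X₂)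
    (hi : relInjective E S.X₂) : d.δ hE S hS = (d.iso S hS hp hi).hom := by
  have := d.map_τ₃_iso hE (𝟙 S) hS hS hp hi
  simpa using this.symm

lemma δ_naturality {S S' : ShortComplex C} (φ : S ⟶ S') (hS : E S) (hS' : E S') :
    (toStable E).map φ.τ₃ ≫ d.δ hE S' hS' = d.δ hE S hS ≫ ((toStable E).map φ.τ₁)⟦(1 : ℤ)⟧' := by
  obtain ⟨ψ, hψ⟩ := hE.exists_hom_of_relInjective (T := hE.injSeq S'.X₁) hS'
    (hE.relInjective_inj S'.X₁) (𝟙 S'.X₁)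
  have h₁ := d.map_τ₃_iso hE ψ hS' (hE.injSeq_mem _) (hE.relProjective_inj _)
    (hE.relInjective_inj _)
  have h₂ := d.map_τ₃_iso hE (φ ≫ ψ) hS (hE.injSeq_mem _) (hE.relProjective_inj _)
    (hE.relInjective_inj _)
  rw [hψ, CategoryTheory.Functor.map_id, CategoryTheory.Functor.map_id, Category.comp_id] at h₁
  rw [ShortComplex.comp_τ₁, hψ, Category.comp_id] at h₂
  rw [← h₁, ← Category.assoc, ← Functor.map_comp, ← h₂]
  rfl

/-- The triangle attached to a conflation. -/
noncomputable abbrev tri (S : ShortComplex C) (hS : E S) : Triangle (StableCategory E) :=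
  Triangle.mk ((toStable E).map S.f) ((toStable E).map S.g) (-d.δ hE S hS)

lemma isStd_tri (S : ShortComplex C) (hS : E S) : d.IsStd (d.tri hE S hS) := by
  obtain ⟨ψ, hψ⟩ := hE.exists_hom_of_relInjective (T := hE.injSeq S.X₁) hS
    (hE.relInjective_inj S.X₁) (𝟙 S.X₁)
  have hδ := d.map_τ₃_iso hE ψ hS (hE.injSeq_mem _) (hE.relProjective_inj _)
    (hE.relInjective_inj _)
  rw [hψ, CategoryTheory.Functor.map_id, CategoryTheory.Functor.map_id, Category.comp_id] at hδ
  have hf : S.f ≫ ψ.τ₂ = hE.i S.X₁ := by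
    rw [← ψ.comm₁₂, hψ, Category.id_comp]
  have hg : ψ.τ₂ ≫ hE.p S.X₁ = S.g ≫ ψ.τ₃ := ψ.comm₂₃
  -- As the inflation into the injective extends over `S.f`, its pushout along `S.f` is the
  -- biproduct of `S.X₃` and the injective. The condition that the last map kills `v` forces `-ψ.τ₃`
  -- on the summand `S.X₃`; this is the origin of the sign in `tri`.
  refine ⟨hE.injSeq S.X₁, hE.injSeq_mem _, hE.relProjective_inj _, hE.relInjective_inj _,
    S.X₂, S.X₃ ⊞ hE.inj S.X₁, S.f, biprod.lift S.g ψ.τ₂, biprod.inr,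
    biprod.desc (-ψ.τ₃) (hE.p S.X₁), ?_, by simp, ?_, ⟨?_⟩⟩
  · refine isPushout_of_exists_desc ?_ ?_ ?_
    · ext <;> simp [hf]
    · intro T a b hab
      obtain ⟨k, hk⟩ := hE.exists_desc hS (b - ψ.τ₂ ≫ a) (by
        rw [Preadditive.comp_sub, reassoc_of% hf, ← hab, sub_self])
      exact ⟨biprod.desc k a, by simp, by simp [hk]⟩
    · intro T t h₁ h₂
      have := hE.epi_g hS
      ext
      · rw [comp_zero, ← cancel_epi S.g, comp_zero]
        have : biprod.lift S.g ψ.τ₂ = S.g ≫ biprod.inl + ψ.τ₂ ≫ biprod.inr := by ext <;> simp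
        rw [this, Preadditive.add_comp, Category.assoc, Category.assoc, h₁, comp_zero,
          add_zero] at h₂
        exact h₂
      · rw [h₁, comp_zero]
  · simp [hg]
  · refine Triangle.isoMk _ _ (Iso.refl _) (Iso.refl _)
      (inlIso E S.X₃ (hE.relProjective_inj S.X₁)) ?_ ?_ ?_
    · exact (Category.comp_id _).trans (Category.id_comp _).symm
    · refine Eq.trans ?_ (Category.id_comp _).symm
      refine ((toStable E).map_comp S.g biprod.inl).symm.trans ?_
      refine toStable_map_eq_of_sub_eq _ _ (hE.relProjective_inj S.X₁) (-ψ.τ₂) biprod.inr ?_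
      ext <;> simp
    · change (-d.δ hE S hS) ≫ (𝟙 _)⟦(1 : ℤ)⟧' = (toStable E).map biprod.inl ≫
        (toStable E).map _ ≫ _
      rw [CategoryTheory.Functor.map_id, Category.comp_id, ← Functor.map_comp_assoc, biprod.inl_desc,
        Functor.map_neg, Preadditive.neg_comp, hδ]

include hE in
omit [HasZeroObject C] [HasShift (StableCategory E) ℤ] in
lemma isPushout_of_biprod {S : ShortComplex C} {Y Z : C} {u : S.X₁ ⟶ Y}
    {p : S.X₂ ⊞ Y ⟶ Z} {w : biprod.lift S.f u ≫ p = 0}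
    (h : E (ShortComplex.mk (biprod.lift S.f u) p w)) :
    IsPushout S.f u (-biprod.inl ≫ p) (biprod.inr ≫ p) := by
  have hw : S.f ≫ biprod.inl ≫ p + u ≫ biprod.inr ≫ p = 0 := by
    rw [biprod.lift_eq, Preadditive.add_comp, Category.assoc, Category.assoc] at w
    exact w
  refine isPushout_of_exists_desc ?_ ?_ ?_
  · rw [Preadditive.comp_neg, neg_eq_iff_add_eq_zero, hw]
  · intro T a b hab
    obtain ⟨t, ht⟩ := hE.exists_desc h (biprod.desc (-a) b) (by simp [hab])
    dsimp at ht
    refine ⟨t, ?_, ?_⟩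
    · simp [ht]
    · simp [ht]
  · intro T t h₁ h₂
    have := hE.epi_g h
    rw [← cancel_epi (ShortComplex.mk (biprod.lift S.f u) p w).g, comp_zero]
    dsimp
    ext
    · simpa using h₁
    · simpa using h₂

/-- The pushout square is itself a conflation with middle term `S.X₂ ⊞ Y`, and the summand `S.X₂` is
stably zero. Hence every axiom may be checked on conflation triangles. -/
lemma exists_tri_of_isStd {T : Triangle (StableCategory E)} (hT : d.IsStd T) :
    ∃ (S : ShortComplex C) (hS : E S), Nonempty (T ≅ d.tri hE S hS) := by
  obtain ⟨S, hS, hp, hi, Y, Z, u, v, x, w, sq, hx, hv, ⟨e⟩⟩ := hT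
  obtain ⟨Z', p, w', h⟩ := hE.exists_biprod hS u
  have sq' := isPushout_of_biprod hE h
  let c : Z ≅ Z' := sq.isoIsPushout _ _ sq'
  have hc₁ : x ≫ c.hom = -biprod.inl ≫ p := sq.inl_isoIsPushout_hom _ _ sq'
  have hc₂ : v ≫ c.hom = biprod.inr ≫ p := sq.inr_isoIsPushout_hom _ _ sq'
  obtain ⟨t, ht⟩ := hE.exists_desc h (biprod.fst ≫ S.g) (by simp)
  dsimp at ht
  let φ : ShortComplex.mk (biprod.lift S.f u) p w' ⟶ S :=
    { τ₁ := 𝟙 _, τ₂ := biprod.fst, τ₃ := t }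
  have hδ := d.map_τ₃_iso hE φ h hS hp hi
  have hct : c.hom ≫ t = -w := by
    apply sq.hom_ext
    · rw [reassoc_of% hc₁]; simp [ht, hx]
    · rw [reassoc_of% hc₂]; simp [ht, hv]
  refine ⟨_, h, ⟨e ≪≫ Triangle.isoMk _ _ (Iso.refl _) (inrIso E Y hp)
    ((toStable E).mapIso c) ?_ ?_ ?_⟩⟩
  · refine Eq.trans ?_ (Category.id_comp _).symm
    refine ((toStable E).map_comp u biprod.inr).symm.trans ?_
    refine toStable_map_eq_of_sub_eq _ _ hp (-S.f) biprod.inl ?_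
    dsimp
    ext <;> simp
  · change (toStable E).map v ≫ (toStable E).map c.hom = (toStable E).map biprod.inr ≫
      (toStable E).map p
    rw [← Functor.map_comp, ← Functor.map_comp, hc₂]
  · change ((toStable E).map w ≫ (d.iso S hS hp hi).hom) ≫ (𝟙 _)⟦(1 : ℤ)⟧' =
      (toStable E).map c.hom ≫ (-d.δ hE _ h)
    have : d.δ hE _ h = (toStable E).map t ≫ (d.iso S hS hp hi).hom := by
      rw [hδ]
      change _ = d.δ hE _ h ≫ ((toStable E).map (𝟙 _))⟦(1 : ℤ)⟧'
      rw [CategoryTheory.Functor.map_id, CategoryTheory.Functor.map_id, Category.comp_id]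
    rw [this, CategoryTheory.Functor.map_id, Category.comp_id, Preadditive.comp_neg, ← Category.assoc,
      ← Functor.map_comp, hct, Functor.map_neg, Preadditive.neg_comp, neg_neg]

end ShiftData

end

end Frobenius

/-! ### The pretriangulated structure on the stable category -/

namespace Frobenius

section

variable {D : Type*} [Category D] [HasShift D ℤ] {X Y Z X' Y' Z' : D}
  {f : X ⟶ Y} {g : Y ⟶ Z} {h : Z ⟶ X⟦(1 : ℤ)⟧} {f' : X' ⟶ Y'} {g' : Y' ⟶ Z'}
  {h' : Z' ⟶ X'⟦(1 : ℤ)⟧}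

lemma exists_isos_of_triangle_iso (e : Triangle.mk f g h ≅ Triangle.mk f' g' h') :
    ∃ (e₁ : X ≅ X') (e₂ : Y ≅ Y') (e₃ : Z ≅ Z'), f ≫ e₂.hom = e₁.hom ≫ f' ∧
      g ≫ e₃.hom = e₂.hom ≫ g' ∧ h ≫ e₁.hom⟦(1 : ℤ)⟧' = e₃.hom ≫ h' :=
  ⟨Triangle.π₁.mapIso e, Triangle.π₂.mapIso e, Triangle.π₃.mapIso e,
    e.hom.comm₁, e.hom.comm₂, e.hom.comm₃⟩

lemma nonempty_triangle_iso (e₁ : X ≅ X') (e₂ : Y ≅ Y') (e₃ : Z ≅ Z')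
    (h₁ : f ≫ e₂.hom = e₁.hom ≫ f') (h₂ : g ≫ e₃.hom = e₂.hom ≫ g')
    (h₃ : h ≫ e₁.hom⟦(1 : ℤ)⟧' = e₃.hom ≫ h') :
    Nonempty (Triangle.mk f g h ≅ Triangle.mk f' g' h') :=
  ⟨Triangle.isoMk _ _ e₁ e₂ e₃ h₁ h₂ h₃⟩

end

section

variable {C : Type*} [Category C] [Preadditive C] [HasBinaryBiproducts C] [HasZeroObject C]
  {E : ObjectProperty (ShortComplex C)}

namespace ShiftData

variable [HasShift (StableCategory E) ℤ] (d : ShiftData E) (hE : IsFrobenius E)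

include hE in
lemma isStd_contractible
    (X : StableCategory E) : d.IsStd (contractibleTriangle X) := by
  obtain ⟨X⟩ := X
  -- The pushout of the inflation along the identity is the injective itself, which is stably zero.
  refine ⟨hE.injSeq X, hE.injSeq_mem X, hE.relProjective_inj X, hE.relInjective_inj X,
    X, hE.inj X, 𝟙 X, hE.i X, 𝟙 _, hE.p X, IsPushout.id_vert _, Category.id_comp _,
    (hE.injSeq X).zero, ⟨?_⟩⟩
  have h := isZero_toStable_obj (hE.relProjective_inj X)
  refine Triangle.isoMk _ _ (Iso.refl _) (Iso.refl _) ((isZero_zero _).iso h) ?_ ?_ ?_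
  · change 𝟙 _ ≫ 𝟙 _ = 𝟙 _ ≫ (toStable E).map (𝟙 X)
    rw [CategoryTheory.Functor.map_id]
  · exact h.eq_of_tgt _ _
  · exact (isZero_zero _).eq_of_src _ _

include hE in
lemma exists_isStd {X Y : StableCategory E} (f : X ⟶ Y) :
    ∃ (Z : StableCategory E) (g : Y ⟶ Z) (h : Z ⟶ X⟦(1 : ℤ)⟧), d.IsStd (Triangle.mk f g h) := by
  obtain ⟨X⟩ := X
  obtain ⟨Y⟩ := Y
  obtain ⟨u, rfl⟩ := (toStable E).map_surjective f
  obtain ⟨Z, p, w, h⟩ := hE.exists_biprod (hE.injSeq_mem X) u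
  -- The minus sign compensates for the one on the first leg in `isPushout_of_biprod`.
  obtain ⟨t, ht⟩ := hE.exists_desc h (biprod.fst ≫ (-hE.p X)) (by
    dsimp
    rw [biprod.lift_fst_assoc, Preadditive.comp_neg, (hE.injSeq X).zero, neg_zero])
  dsimp at ht
  refine ⟨_, _, _, hE.injSeq X, hE.injSeq_mem X, hE.relProjective_inj X, hE.relInjective_inj X,
    Y, Z, u, _, _, t, isPushout_of_biprod hE h, ?_, ?_, ⟨Iso.refl _⟩⟩
  · simp [ht]
  · simp [ht]

/-- The square commutes only up to a map through a projective-injective `Q`. The first half of that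
map extends over `S.f`, and subtracting its extension makes the square commute strictly without
changing the stable class of `b`; cokernels then give `c`. -/
lemma exists_hom_tri {S S' : ShortComplex C} (hS : E S) (hS' : E S')
    (a : (toStable E).obj S.X₁ ⟶ (toStable E).obj S'.X₁)
    (b : (toStable E).obj S.X₂ ⟶ (toStable E).obj S'.X₂)
    (comm : (toStable E).map S.f ≫ b = a ≫ (toStable E).map S'.f) :
    ∃ c : (toStable E).obj S.X₃ ⟶ (toStable E).obj S'.X₃,
      (toStable E).map S.g ≫ c = b ≫ (toStable E).map S'.g ∧
        (-d.δ hE S hS) ≫ a⟦(1 : ℤ)⟧' = c ≫ (-d.δ hE S' hS') := by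
  obtain ⟨a, rfl⟩ := (toStable E).map_surjective a
  obtain ⟨b, rfl⟩ := (toStable E).map_surjective b
  rw [← Functor.map_comp, ← Functor.map_comp, toStable_map_eq_iff] at comm
  obtain ⟨Q, hQ, s, t, hst⟩ := comm
  obtain ⟨k, hk⟩ := hE.relInjective_of_relProjective hQ S hS s
  have hb : S.f ≫ (b - k ≫ t) = a ≫ S'.f := by
    rw [Preadditive.comp_sub, reassoc_of% hk, ← hst]
    abel
  obtain ⟨c, hc⟩ := hE.exists_desc hS ((b - k ≫ t) ≫ S'.g) (by
    rw [reassoc_of% hb, S'.zero, comp_zero])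
  have hbb : (toStable E).map (b - k ≫ t) = (toStable E).map b :=
    toStable_map_eq_of_sub_eq _ _ hQ (-k) t (by simp)
  let φ : S ⟶ S' := ⟨a, b - k ≫ t, c, hb.symm, hc.symm⟩
  refine ⟨(toStable E).map c, ?_, ?_⟩
  · rw [← hbb, ← Functor.map_comp, ← Functor.map_comp, hc]
  · rw [Preadditive.neg_comp, Preadditive.comp_neg]
    exact congrArg Neg.neg (d.δ_naturality hE φ hS hS').symm

include hE in
lemma exists_hom_of_isStd {X Y Z X' Y' Z' : StableCategory E}
    {f : X ⟶ Y} {g : Y ⟶ Z} {h : Z ⟶ X⟦(1 : ℤ)⟧} {f' : X' ⟶ Y'} {g' : Y' ⟶ Z'}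
    {h' : Z' ⟶ X'⟦(1 : ℤ)⟧} (hT : d.IsStd (Triangle.mk f g h))
    (hT' : d.IsStd (Triangle.mk f' g' h'))
    (a : X ⟶ X') (b : Y ⟶ Y') (comm : f ≫ b = a ≫ f') :
    ∃ c : Z ⟶ Z', g ≫ c = b ≫ g' ∧ h ≫ a⟦(1 : ℤ)⟧' = c ≫ h' := by
  obtain ⟨S, hS, ⟨e⟩⟩ := d.exists_tri_of_isStd hE hT
  obtain ⟨S', hS', ⟨e'⟩⟩ := d.exists_tri_of_isStd hE hT'
  obtain ⟨e₁, e₂, e₃, h₁, h₂, h₃⟩ := exists_isos_of_triangle_iso e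
  obtain ⟨e₁', e₂', e₃', h₁', h₂', h₃'⟩ := exists_isos_of_triangle_iso e'
  obtain ⟨c, hc₁, hc₂⟩ := d.exists_hom_tri hE hS hS' (e₁.inv ≫ a ≫ e₁'.hom)
    (e₂.inv ≫ b ≫ e₂'.hom) (by
      rw [← cancel_epi e₁.hom]
      simp only [Category.assoc, Iso.hom_inv_id_assoc]
      rw [← reassoc_of% h₁, Iso.hom_inv_id_assoc, reassoc_of% comm, h₁'])
  have h₂'' : (toStable E).map S'.g ≫ e₃'.inv = e₂'.inv ≫ g' := by
    rw [Iso.comp_inv_eq, Category.assoc, h₂', Iso.inv_hom_id_assoc]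
  have h₃'' : (-d.δ hE S' hS') ≫ e₁'.inv⟦(1 : ℤ)⟧' = e₃'.inv ≫ h' := by
    rw [← cancel_epi e₃'.hom, Iso.hom_inv_id_assoc, ← reassoc_of% h₃', ← Functor.map_comp,
      Iso.hom_inv_id, CategoryTheory.Functor.map_id, Category.comp_id]
  refine ⟨e₃.hom ≫ c ≫ e₃'.inv, ?_, ?_⟩
  · rw [reassoc_of% h₂, reassoc_of% hc₁, h₂'']
    simp
  · rw [Category.assoc, Category.assoc, ← h₃'', ← reassoc_of% hc₂, ← reassoc_of% h₃]
    simp only [← Functor.map_comp, Category.assoc, Iso.hom_inv_id, Category.comp_id,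
      Iso.hom_inv_id_assoc]

variable [∀ n : ℤ, (shiftFunctor (StableCategory E) n).Additive]

/-- The cokernel X' of the composite S.X₁ → S.X₂ → I has two readings: it is the pushout of S.X₂ → I
along `S.g`, hence the cone of `S.g`, and it is a translation of S.X₁ because `I` is
projective-injective. -/
lemma isStd_rotate_tri {S : ShortComplex C} (hS : E S) : d.IsStd (d.tri hE S hS).rotate := by
  obtain ⟨X', q, wq, z, w, hzw, h₁, h₂, hz, hw⟩ :=
    hE.exists_comp (w₁₂ := S.zero) (w₂₃ := (hE.injSeq S.X₂).zero) hS (hE.injSeq_mem S.X₂)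
  have e₁ := hE.epi_g hS
  have e₂ := hE.epi_g h₁
  let φ : S ⟶ ShortComplex.mk (S.f ≫ hE.i S.X₂) q wq := ⟨𝟙 _, hE.i S.X₂, z, by simp, hz.symm⟩
  let ψ : ShortComplex.mk (S.f ≫ hE.i S.X₂) q wq ⟶ hE.injSeq S.X₂ :=
    ⟨S.f, 𝟙 _, w, by simp, by simp [hw]⟩
  have hp := hE.relProjective_inj S.X₂
  have hi := hE.relInjective_inj S.X₂
  have hφ := d.map_τ₃_iso hE φ hS h₁ hp hi
  have hψ := d.naturality ψ h₁ hp hi (hE.injSeq_mem S.X₂) hp hi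
  refine ⟨hE.injSeq S.X₂, hE.injSeq_mem _, hp, hi, S.X₃, X', S.g, z, q, w, ?_, hw, hzw, ⟨?_⟩⟩
  · refine isPushout_of_exists_desc hz.symm ?_ ?_
    · intro T a b hab
      obtain ⟨t, ht⟩ := hE.exists_desc h₁ a (by
        dsimp at hab ⊢
        rw [Category.assoc, hab, S.zero_assoc, zero_comp])
      dsimp at ht
      refine ⟨t, ht, ?_⟩
      rw [← cancel_epi S.g, ← hab, reassoc_of% hz, ht]
    · intro T t ht _
      rw [← cancel_epi (ShortComplex.mk (S.f ≫ hE.i S.X₂) q wq).g]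
      simpa using ht
  · refine Triangle.isoMk _ _ (Iso.refl _) (Iso.refl _) (-(d.iso _ h₁ hp hi).symm) ?_ ?_ ?_
    · exact (Category.comp_id _).trans (Category.id_comp _).symm
    · change (-d.δ hE S hS) ≫ (-(d.iso _ h₁ hp hi).inv) = 𝟙 _ ≫ (toStable E).map z
      rw [Preadditive.neg_comp_neg, Iso.comp_inv_eq, Category.id_comp]
      refine Eq.trans ?_ hφ.symm
      change _ = d.δ hE S hS ≫ ((toStable E).map (𝟙 _))⟦(1 : ℤ)⟧'
      rw [CategoryTheory.Functor.map_id, CategoryTheory.Functor.map_id, Category.comp_id]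
    · change (-((toStable E).map S.f)⟦(1 : ℤ)⟧') ≫ (𝟙 _)⟦(1 : ℤ)⟧' =
        (-(d.iso _ h₁ hp hi).inv) ≫ (toStable E).map w ≫ _
      rw [CategoryTheory.Functor.map_id, Category.comp_id, Preadditive.neg_comp, neg_inj,
        Iso.eq_inv_comp]
      exact hψ.symm

include hE in
lemma isStd_rotate {T : Triangle (StableCategory E)} (hT : d.IsStd T) : d.IsStd T.rotate := by
  obtain ⟨S, hS, ⟨e⟩⟩ := d.exists_tri_of_isStd hE hT
  exact (d.isStd_rotate_tri hE hS).of_iso ((rotate _).mapIso e)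

include hE in
-- Realize the rotated triangle by a conflation `S` and choose X' → P → S.X₃ with `P` projective.
-- Lifting the identity of S.X₃ exhibits S.X₂ as a pushout of `P`, so X' → S.X₁ → S.X₂ starts a
-- standard triangle. Both `X` and X' have translation S.X₃, hence are isomorphic by full
-- faithfulness of the shift.
lemma isStd_of_rotate {X Y Z : StableCategory E} {f : X ⟶ Y} {g : Y ⟶ Z} {h : Z ⟶ X⟦(1 : ℤ)⟧}
    (hT : d.IsStd (Triangle.mk g h (-f⟦(1 : ℤ)⟧'))) : d.IsStd (Triangle.mk f g h) := by
  obtain ⟨S, hS, ⟨e⟩⟩ := d.exists_tri_of_isStd hE hT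
  obtain ⟨P, X', j, q, hjq, hX', hP⟩ := hE.enough_projectives S.X₃
  obtain ⟨φ, hφ⟩ := hE.exists_hom_of_relProjective (S := ShortComplex.mk j q hjq) hS hP (𝟙 _)
  have hP' := hE.relInjective_of_relProjective hP
  have sq := hE.isPushout_of_isIso hX' hS φ (by rw [hφ]; infer_instance)
  have hδ := d.δ_naturality hE φ hX' hS
  rw [hφ, d.δ_eq_iso_hom hE _ hX' hP hP', CategoryTheory.Functor.map_id] at hδ
  obtain ⟨e₁, e₂, e₃, h₁, h₂, h₃⟩ := exists_isos_of_triangle_iso e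
  let e₀ : X ≅ (toStable E).obj X' :=
    (shiftFunctor (StableCategory E) (1 : ℤ)).preimageIso (e₃ ≪≫ d.iso _ hX' hP hP')
  have he₀ : e₀.hom⟦(1 : ℤ)⟧' = e₃.hom ≫ (d.iso _ hX' hP hP').hom :=
    (shiftFunctor (StableCategory E) (1 : ℤ)).map_preimage _
  refine ⟨ShortComplex.mk j q hjq, hX', hP, hP', S.X₁, S.X₂, φ.τ₁, S.f, φ.τ₂, S.g, sq, ?_, S.zero,
    nonempty_triangle_iso e₀ e₁ e₂ ?_ h₁ ?_⟩
  · rw [φ.comm₂₃, hφ]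
    exact Category.comp_id _
  · apply (shiftFunctor (StableCategory E) (1 : ℤ)).map_injective
    rw [Functor.map_comp, Functor.map_comp, he₀, Category.assoc]
    refine Eq.trans ?_ (congrArg (fun t => e₃.hom ≫ t) hδ)
    rw [Preadditive.neg_comp, Preadditive.comp_neg, neg_inj] at h₃
    rw [h₃]
    exact congrArg (fun t => e₃.hom ≫ t) (Category.id_comp _).symm
  · rw [he₀, reassoc_of% h₂]

/-- Happel's pretriangulated structure. -/
@[reducible]
noncomputable def pretriangulated : Pretriangulated (StableCategory E) where
  distinguishedTriangles := {T | d.IsStd T}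
  isomorphic_distinguished _ hT _ e := hT.of_iso e
  contractible_distinguished := d.isStd_contractible hE
  distinguished_cocone_triangle := d.exists_isStd hE
  rotate_distinguished_triangle _ := ⟨d.isStd_rotate hE, fun h => d.isStd_of_rotate hE h⟩
  complete_distinguished_triangle_morphism _ _ hT hT' a b comm :=
    d.exists_hom_of_isStd hE hT hT' a b comm

end ShiftData

end

end Frobenius

/-! ### The octahedral axiom, the suspension, and Happel's theorem -/

namespace Frobenius

section

variable {C : Type*} [Category C] [Preadditive C] [HasBinaryBiproducts C] [HasZeroObject C]
  {E : ObjectProperty (ShortComplex C)}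

instance : HasBinaryBiproducts (StableCategory E) where
  has_binary_biproduct X Y := hasBinaryBiproduct_of_total
    ((toStable E).mapBinaryBicone (BinaryBiproduct.bicone X.as Y.as)) (by
      have := (toStable E).congr_map (biprod.total (X := X.as) (Y := Y.as))
      rw [Functor.map_add, Functor.map_comp, Functor.map_comp,
        CategoryTheory.Functor.map_id] at this
      exact this)

lemma additive_of_isEquivalence (F : StableCategory E ⥤ StableCategory E) [F.IsEquivalence] :
    F.Additive :=
  Functor.additive_of_preserves_binary_products F

namespace ShiftData

variable [HasShift (StableCategory E) ℤ] (d : ShiftData E) (hE : IsFrobenius E)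
  [∀ n : ℤ, (shiftFunctor (StableCategory E) n).Additive]

/-- Adding projective-injective summands to the targets turns two composable morphisms into
inflations. The third isomorphism theorem gives the conflation of the three cokernels, and
naturality of `δ` gives the remaining commutativities. -/
lemma isTriangulated :
    letI := d.pretriangulated hE
    IsTriangulated (StableCategory E) := by
  letI := d.pretriangulated hE
  apply IsTriangulated.mk'
  intro X₁ X₂ X₃ u₁₂ u₂₃
  obtain ⟨X₁⟩ := X₁
  obtain ⟨X₂⟩ := X₂
  obtain ⟨X₃⟩ := X₃
  obtain ⟨u₁₂, rfl⟩ := (toStable E).map_surjective u₁₂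
  obtain ⟨u₂₃, rfl⟩ := (toStable E).map_surjective u₂₃
  obtain ⟨Z₁₂, p₁₂, w₁₂, h₁₂⟩ := hE.exists_biprod (hE.injSeq_mem X₁) u₁₂
  obtain ⟨Z₂₃, p₂₃, w₂₃, h₂₃⟩ := hE.exists_biprod (hE.injSeq_mem (hE.inj X₁ ⊞ X₂))
    (biprod.snd ≫ u₂₃)
  obtain ⟨Z₁₃, p₁₃, w₁₃, m₁, m₃, hm, h₁₃, h, hm₁, hm₃⟩ := hE.exists_comp h₁₂ h₂₃
  let S₁₂ := ShortComplex.mk _ _ w₁₂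
  let S₂₃ := ShortComplex.mk _ _ w₂₃
  let S₁₃ := ShortComplex.mk _ _ w₁₃
  let S := ShortComplex.mk _ _ hm
  let φ : S₁₂ ⟶ S₁₃ := ⟨𝟙 _, S₂₃.f, m₁, Category.id_comp _, hm₁.symm⟩
  let ψ : S₁₃ ⟶ S₂₃ := ⟨S₁₂.f, 𝟙 _, m₃, (Category.comp_id _).symm, (Category.id_comp _).trans hm₃.symm⟩
  let χ : S₂₃ ⟶ S := ⟨S₁₂.g, S₁₃.g, 𝟙 _, hm₁, hm₃.trans (Category.comp_id _).symm⟩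
  have hφ := d.δ_naturality hE φ h₁₂ h₁₃
  have hψ := d.δ_naturality hE ψ h₁₃ h₂₃
  have hχ := d.δ_naturality hE χ h₂₃ h
  have hφ' : (toStable E).map m₁ ≫ (-d.δ hE S₁₃ h₁₃) = -d.δ hE S₁₂ h₁₂ := by
    rw [Preadditive.comp_neg, neg_inj]
    refine hφ.trans ?_
    change d.δ hE S₁₂ h₁₂ ≫ ((toStable E).map (𝟙 X₁))⟦(1 : ℤ)⟧' = _
    rw [CategoryTheory.Functor.map_id, CategoryTheory.Functor.map_id, Category.comp_id]
  have hψ' : (-d.δ hE S₁₃ h₁₃) ≫ ((toStable E).map S₁₂.f)⟦(1 : ℤ)⟧' =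
      (toStable E).map m₃ ≫ (-d.δ hE S₂₃ h₂₃) := by
    rw [Preadditive.comp_neg, Preadditive.neg_comp, neg_inj]
    exact hψ.symm
  have hχ' : -d.δ hE S h = (-d.δ hE S₂₃ h₂₃) ≫ ((toStable E).map S₁₂.g)⟦(1 : ℤ)⟧' := by
    rw [Preadditive.neg_comp, neg_inj]
    refine Eq.trans ?_ hχ
    change _ = (toStable E).map (𝟙 Z₂₃) ≫ _
    rw [CategoryTheory.Functor.map_id]
    exact (Category.id_comp _).symm
  have hS := d.isStd_tri hE S h
  rw [tri, hχ'] at hS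
  refine ⟨_, _, _, _, _, _, (toStable E).map S₁₂.f, (toStable E).map S₂₃.f, Iso.refl _,
    inrIso E X₂ (hE.relProjective_inj X₁),
    inrIso E X₃ (hE.relProjective_inj (hE.inj X₁ ⊞ X₂)), ?_, ?_, _, _, d.isStd_tri hE S₁₂ h₁₂,
    _, _, d.isStd_tri hE S₂₃ h₂₃, _, _, (by
      rw [← Functor.map_comp]
      exact d.isStd_tri hE S₁₃ h₁₃), ⟨⟨(toStable E).map m₁, (toStable E).map m₃, ?_, hφ', ?_, hψ', hS⟩⟩⟩
  · refine Eq.trans ?_ (Category.id_comp _).symm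
    refine ((toStable E).map_comp u₁₂ biprod.inr).symm.trans ?_
    refine toStable_map_eq_of_sub_eq _ _ (hE.relProjective_inj X₁) (-hE.i X₁) biprod.inl ?_
    change u₁₂ ≫ biprod.inr - biprod.lift (hE.i X₁) u₁₂ = _
    ext <;> simp
  · refine ((toStable E).map_comp u₂₃ biprod.inr).symm.trans
      (Eq.trans ?_ ((toStable E).map_comp biprod.inr S₂₃.f))
    refine toStable_map_eq_of_sub_eq _ _ (hE.relProjective_inj (hE.inj X₁ ⊞ X₂))
      (-(biprod.inr ≫ hE.i _)) biprod.inl ?_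
    change u₂₃ ≫ biprod.inr - biprod.inr ≫ biprod.lift (hE.i _) (biprod.snd ≫ u₂₃) = _
    ext <;> simp
  · refine ((toStable E).map_comp _ _).symm.trans (Eq.trans ?_ ((toStable E).map_comp _ _))
    exact (toStable E).congr_map hm₁
  · refine ((toStable E).map_comp _ _).symm.trans ?_
    exact (toStable E).congr_map hm₃

end ShiftData

namespace IsFrobenius

variable (hE : IsFrobenius E)

/-- The suspension, before passing to the stable category at the source. -/
noncomputable def suspBase : C ⥤ StableCategory E where
  obj X := (toStable E).obj (hE.susp X)
  map {X Y} f := (toStable E).map (hE.exists_hom_of_relInjective (S := hE.injSeq X)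
    (T := hE.injSeq Y) (hE.injSeq_mem X) (hE.relInjective_inj Y) f).choose.τ₃
  map_id X := by
    rw [← CategoryTheory.Functor.map_id]
    refine hE.map_τ₃_eq (hE.injSeq_mem X) (hE.relProjective_inj X) _ (𝟙 (hE.injSeq X)) ?_
    rw [(hE.exists_hom_of_relInjective (S := hE.injSeq X)
      (T := hE.injSeq X) (hE.injSeq_mem X) (hE.relInjective_inj X) (𝟙 X)).choose_spec]
    rfl
  map_comp {X Y Z} f g := by
    rw [← Functor.map_comp]
    refine hE.map_τ₃_eq (hE.injSeq_mem X) (hE.relProjective_inj Z) _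
      ((hE.exists_hom_of_relInjective (S := hE.injSeq X)
      (T := hE.injSeq Y) (hE.injSeq_mem X) (hE.relInjective_inj Y) f).choose ≫
      (hE.exists_hom_of_relInjective (S := hE.injSeq Y)
      (T := hE.injSeq Z) (hE.injSeq_mem Y) (hE.relInjective_inj Z) g).choose) ?_
    rw [(hE.exists_hom_of_relInjective (S := hE.injSeq X)
      (T := hE.injSeq Z) (hE.injSeq_mem X) (hE.relInjective_inj Z) (f ≫ g)).choose_spec,
      ShortComplex.comp_τ₁, (hE.exists_hom_of_relInjective (S := hE.injSeq X)
      (T := hE.injSeq Y) (hE.injSeq_mem X) (hE.relInjective_inj Y) f).choose_spec,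
      (hE.exists_hom_of_relInjective (S := hE.injSeq Y)
      (T := hE.injSeq Z) (hE.injSeq_mem Y) (hE.relInjective_inj Z) g).choose_spec]

/-- The chosen extension is irrelevant: any morphism of the chosen conflations with the right stable
first component computes the suspension. -/
lemma suspBase_map {X Y : C} (φ : hE.injSeq X ⟶ hE.injSeq Y) (f : X ⟶ Y)
    (h : (toStable E).map φ.τ₁ = (toStable E).map f) :
    hE.suspBase.map f = (toStable E).map φ.τ₃ := by
  refine hE.map_τ₃_eq (hE.injSeq_mem X) (hE.relProjective_inj Y) _ φ ?_
  rw [(hE.exists_hom_of_relInjective (S := hE.injSeq X)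
      (T := hE.injSeq Y) (hE.injSeq_mem X) (hE.relInjective_inj Y) f).choose_spec, h]

lemma exists_injSeq_hom {X Y : C} (f : X ⟶ Y) : ∃ φ : hE.injSeq X ⟶ hE.injSeq Y, φ.τ₁ = f :=
  hE.exists_hom_of_relInjective (S := hE.injSeq X) (T := hE.injSeq Y) (hE.injSeq_mem X)
    (hE.relInjective_inj Y) f

/-- The suspension functor of the stable category. -/
noncomputable def suspension : StableCategory E ⥤ StableCategory E :=
  CategoryTheory.Quotient.lift _ hE.suspBase (fun X Y f g h => by
    obtain ⟨φ, rfl⟩ := hE.exists_injSeq_hom g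
    rw [hE.suspBase_map φ φ.τ₁ rfl, hE.suspBase_map φ f]
    exact (CategoryTheory.Quotient.sound _ h).symm)

lemma suspension_map {X Y : C} (φ : hE.injSeq X ⟶ hE.injSeq Y) :
    hE.suspension.map ((toStable E).map φ.τ₁) = (toStable E).map φ.τ₃ :=
  hE.suspBase_map φ φ.τ₁ rfl

instance : hE.suspension.Faithful where
  map_injective {X Y f g} h := by
    obtain ⟨X⟩ := X
    obtain ⟨Y⟩ := Y
    obtain ⟨f, rfl⟩ := (toStable E).map_surjective f
    obtain ⟨g, rfl⟩ := (toStable E).map_surjective g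
    obtain ⟨φ, rfl⟩ := hE.exists_injSeq_hom f
    obtain ⟨ψ, rfl⟩ := hE.exists_injSeq_hom g
    refine hE.map_τ₁_eq (hE.injSeq_mem Y) (hE.relProjective_inj X) φ ψ ?_
    exact (hE.suspension_map φ).symm.trans (h.trans (hE.suspension_map ψ))

instance : hE.suspension.Full where
  map_surjective {X Y} f := by
    obtain ⟨X⟩ := X
    obtain ⟨Y⟩ := Y
    obtain ⟨f, rfl⟩ := (toStable E).map_surjective (X := hE.susp X) (Y := hE.susp Y) f
    obtain ⟨φ, rfl⟩ := hE.exists_hom_of_relProjective (S := hE.injSeq X) (T := hE.injSeq Y)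
      (hE.injSeq_mem Y) (hE.relProjective_inj X) f
    exact ⟨(toStable E).map φ.τ₁, hE.suspension_map φ⟩

/-- Schanuel's argument: compare the two conflations in both directions over the identity of the
first term. The composites have identity first component, so their third components are stably
identities. -/
lemma exists_suspIso (S : ShortComplex C) (hS : E S) (hp : relProjective E S.X₂) :
    ∃ e : (toStable E).obj S.X₃ ≅ (toStable E).obj (hE.susp S.X₁),
      ∃ φ : S ⟶ hE.injSeq S.X₁, φ.τ₁ = 𝟙 _ ∧ e.hom = (toStable E).map φ.τ₃ := by
  obtain ⟨φ, hφ⟩ := hE.exists_hom_of_relInjective (T := hE.injSeq S.X₁) hS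
    (hE.relInjective_inj S.X₁) (𝟙 _)
  obtain ⟨ψ, hψ⟩ := hE.exists_hom_of_relInjective (S := hE.injSeq S.X₁) (T := S)
    (hE.injSeq_mem _) (hE.relInjective_of_relProjective hp) (𝟙 _)
  refine ⟨⟨(toStable E).map φ.τ₃, (toStable E).map ψ.τ₃, ?_, ?_⟩, φ, hφ, rfl⟩
  · rw [← Functor.map_comp, ← CategoryTheory.Functor.map_id]
    refine hE.map_τ₃_eq hS hp (φ ≫ ψ) (𝟙 S) ?_
    rw [ShortComplex.comp_τ₁, hφ, hψ]
    exact (toStable E).congr_map (Category.comp_id _)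
  · rw [← Functor.map_comp, ← CategoryTheory.Functor.map_id]
    refine hE.map_τ₃_eq (hE.injSeq_mem _) (hE.relProjective_inj _) (ψ ≫ φ)
      (𝟙 (hE.injSeq S.X₁)) ?_
    rw [ShortComplex.comp_τ₁, hφ, hψ]
    exact (toStable E).congr_map (Category.comp_id _)

instance : hE.suspension.EssSurj where
  mem_essImage X := by
    obtain ⟨X⟩ := X
    obtain ⟨P, X', j, q, w, h, hP⟩ := hE.enough_projectives X
    obtain ⟨e, _⟩ := hE.exists_suspIso _ h hP
    exact ⟨(toStable E).obj X', ⟨e.symm⟩⟩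

instance : hE.suspension.IsEquivalence where

lemma exists_shiftData [HasShift (StableCategory E) ℤ]
    (θ : shiftFunctor (StableCategory E) (1 : ℤ) ≅ hE.suspension) : Nonempty (ShiftData E) := by
  choose e φ hφ₁ hφ₂ using fun S hS hp => hE.exists_suspIso S hS hp
  refine ⟨⟨fun S hS hp _ => e S hS hp ≪≫ (θ.app ((toStable E).obj S.X₁)).symm, ?_⟩⟩
  intro S S' α hS hp hi hS' hp' hi'
  obtain ⟨β, hβ⟩ := hE.exists_injSeq_hom α.τ₁
  have h : (toStable E).map α.τ₃ ≫ (toStable E).map (φ S' hS' hp').τ₃ =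
      (toStable E).map (φ S hS hp).τ₃ ≫ (toStable E).map β.τ₃ := by
    rw [← Functor.map_comp, ← Functor.map_comp]
    refine hE.map_τ₃_eq hS (hE.relProjective_inj _) (α ≫ φ S' hS' hp') (φ S hS hp ≫ β) ?_
    rw [ShortComplex.comp_τ₁, ShortComplex.comp_τ₁, hφ₁, hφ₁, hβ]
    exact (toStable E).congr_map ((Category.comp_id _).trans (Category.id_comp _).symm)
  have hβ' : hE.suspension.map ((toStable E).map α.τ₁) = (toStable E).map β.τ₃ := by
    rw [← hβ]
    exact hE.suspension_map β
  let t (X : C) : (toStable E).obj (hE.susp X) ⟶ ((toStable E).obj X)⟦(1 : ℤ)⟧ :=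
    θ.inv.app ((toStable E).obj X)
  have hθ : (toStable E).map β.τ₃ ≫ t S'.X₁ = t S.X₁ ≫ ((toStable E).map α.τ₁)⟦(1 : ℤ)⟧' := by
    rw [← hβ']
    exact θ.inv.naturality ((toStable E).map α.τ₁)
  change (toStable E).map α.τ₃ ≫ (e S' hS' hp').hom ≫ t S'.X₁ =
    ((e S hS hp).hom ≫ t S.X₁) ≫ ((toStable E).map α.τ₁)⟦(1 : ℤ)⟧'
  rw [Category.assoc, ← hθ, hφ₂, hφ₂, ← Category.assoc]
  exact (congrArg (· ≫ t S'.X₁) h).trans (Category.assoc _ _ _)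

include hE in
/-- **Happel's theorem**: the stable category of a Frobenius category is triangulated. -/
theorem nonempty_stableTriangulation : Nonempty (StableTriangulation E) := by
  obtain ⟨_, ⟨θ⟩⟩ := ShiftAux.exists_hasShift_of_isEquivalence hE.suspension
  obtain ⟨d⟩ := hE.exists_shiftData θ
  -- Each shift is an equivalence, so it preserves binary products and additivity is automatic.
  have hadd : ∀ n : ℤ, (shiftFunctor (StableCategory E) n).Additive := fun n =>
    additive_of_isEquivalence _
  exact ⟨{
    hasShift := inferInstance
    shift_additive := hadd
    pretriangulated := d.pretriangulated hE
    isTriangulated := d.isTriangulated hE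
    shiftIso := d.iso
    shiftIso_naturality := d.naturality
    distinguished_iff := fun _ => Iff.rfl }⟩

end IsFrobenius

end

end Frobenius

/-! ### Ext vanishing, duality with R, and embeddings into free modules -/

namespace Gorenstein

section ExtVanishing

open Abelian

universe w v u'

variable {A : Type u'} [Category.{v} A] [Abelian A] [HasExt.{w} A]

/-- The objects without higher extensions by `M`. -/
def extVanishing (M : A) : ObjectProperty A := fun X =>
  ∀ i : ℕ, 0 < i → Subsingleton (Ext.{w} X M i)

variable {S : ShortComplex A} (hS : S.ShortExact) (M : A)

include hS

lemma exists_extension_of_subsingleton_ext (h₃ : Subsingleton (Ext.{w} S.X₃ M 1))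
    (f : S.X₁ ⟶ M) : ∃ g : S.X₂ ⟶ M, S.f ≫ g = f := by
  obtain ⟨x, hx⟩ := Ext.contravariant_sequence_exact₁ hS M (Ext.mk₀ f) (add_zero 1)
    (Subsingleton.elim _ _)
  obtain ⟨g, rfl⟩ := Ext.addEquiv₀.symm.surjective x
  refine ⟨g, ?_⟩
  apply Ext.addEquiv₀.symm.injective
  exact Eq.trans (by simp) hx

lemma subsingleton_ext_X₁ {i : ℕ} (h₂ : Subsingleton (Ext.{w} S.X₂ M i))
    (h₃ : Subsingleton (Ext.{w} S.X₃ M (i + 1))) : Subsingleton (Ext.{w} S.X₁ M i) := by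
  refine subsingleton_of_forall_eq 0 fun x => ?_
  obtain ⟨y, rfl⟩ := Ext.contravariant_sequence_exact₁ hS M x (add_comm 1 i)
    (Subsingleton.elim _ _)
  rw [Subsingleton.elim y 0, Ext.comp_zero]

lemma extVanishing_X₁ (h₂ : extVanishing.{w} M S.X₂) (h₃ : extVanishing.{w} M S.X₃) :
    extVanishing.{w} M S.X₁ := fun i hi =>
  subsingleton_ext_X₁ hS M (h₂ i hi) (h₃ (i + 1) (Nat.succ_pos i))

/-- Above degree 1 the group is squeezed between two vanishing ones. In degree 1 every class is the
pullback of the extension class along some X₁ → M, and it vanishes because that map extends to X₂.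
-/
lemma extVanishing_X₃ (h₁ : extVanishing.{w} M S.X₁) (h₂ : extVanishing.{w} M S.X₂)
    (h : ∀ f : S.X₁ ⟶ M, ∃ g : S.X₂ ⟶ M, S.f ≫ g = f) : extVanishing.{w} M S.X₃ := by
  intro i hi
  refine subsingleton_of_forall_eq 0 fun x => ?_
  have := h₂ i hi
  obtain ⟨j, rfl⟩ := Nat.exists_eq_add_of_le hi
  obtain ⟨y, rfl⟩ := Ext.contravariant_sequence_exact₃ hS M x (Subsingleton.elim _ _)
    (show 1 + j = _ by omega)
  rcases Nat.eq_zero_or_pos j with rfl | hj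
  · obtain ⟨f, rfl⟩ := Ext.addEquiv₀.symm.surjective y
    obtain ⟨g, rfl⟩ := h f
    have : Ext.addEquiv₀.symm (S.f ≫ g) = (Ext.mk₀ S.f).comp (Ext.mk₀ g) (zero_add 0) := by simp
    rw [this, ← Ext.comp_assoc _ _ _ (add_zero 1) (zero_add 0) (by omega),
      ShortComplex.ShortExact.extClass_comp, Ext.zero_comp]
  · have := h₁ j hj
    rw [Subsingleton.elim y 0, Ext.comp_zero]

omit hS in
lemma extVanishing_of_projective (P : A) [Projective P] : extVanishing.{w} M P := by
  intro i hi
  obtain ⟨j, rfl⟩ := Nat.exists_eq_succ_of_ne_zero hi.ne'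
  exact subsingleton_of_forall_eq 0 fun x => Ext.eq_zero_of_projective x

end ExtVanishing

section Dual

variable {R : Type u} [Ring R]

/-- `R` is isomorphic, as a right module, to the regular module of `Rᵐᵒᵖ`. -/
def opEquiv (R : Type u) [Ring R] : Rᵐᵒᵖ ≃ₗ[Rᵐᵒᵖ] R where
  toFun := MulOpposite.unop
  invFun := MulOpposite.op
  map_add' _ _ := rfl
  map_smul' _ _ := rfl
  left_inv _ := rfl
  right_inv _ := rfl

instance : Module.Free Rᵐᵒᵖ R := .of_equiv (opEquiv R)

instance : Module.Finite Rᵐᵒᵖ R := .equiv (opEquiv R)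

/-- Every linear form on `R^n` is determined by its values on the standard basis. -/
lemma linearMap_eq_sum {n : ℕ} (f : (Fin n → R) →ₗ[Rᵐᵒᵖ] R) :
    f = ∑ i, f (Pi.single i 1) • (LinearMap.proj i : (Fin n → R) →ₗ[Rᵐᵒᵖ] R) := by
  refine LinearMap.pi_ext' fun i => LinearMap.ext fun r => ?_
  have h : (Pi.single i r : Fin n → R) = MulOpposite.op r • Pi.single i 1 := by
    rw [← Pi.single_smul, op_smul_eq_mul, one_mul]
  simp only [LinearMap.comp_apply, LinearMap.single_apply, LinearMap.sum_apply,
    LinearMap.smul_apply, LinearMap.proj_apply, smul_eq_mul]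
  rw [h, map_smul, op_smul_eq_mul, Finset.sum_eq_single i]
  · simp
  · intro j _ hj
    simp [Pi.single_eq_of_ne hj]
  · simp

/-- The left dual of `R^n` is `R^n`. -/
def dualEquiv (R : Type u) [Ring R] (n : ℕ) : ((Fin n → R) →ₗ[Rᵐᵒᵖ] R) ≃ₗ[R] (Fin n → R) where
  toFun f i := f (Pi.single i 1)
  map_add' _ _ := rfl
  map_smul' _ _ := rfl
  invFun a := ∑ i, a i • LinearMap.proj i
  left_inv f := (linearMap_eq_sum f).symm
  right_inv a := by
    ext i
    simp only [LinearMap.sum_apply, LinearMap.smul_apply, LinearMap.proj_apply, smul_eq_mul]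
    rw [Finset.sum_eq_single i]
    · simp
    · intro j _ hj
      simp [Pi.single_eq_of_ne hj]
    · simp

/-- Every linear form on the dual of `R^n` is the evaluation at some element. -/
lemma exists_eq_eval {n : ℕ} (φ : ((Fin n → R) →ₗ[Rᵐᵒᵖ] R) →ₗ[R] R) :
    ∃ q : Fin n → R, ∀ f, φ f = f q := by
  refine ⟨fun i => φ (LinearMap.proj i), fun f => ?_⟩
  conv_lhs => rw [linearMap_eq_sum f]
  conv_rhs => rw [linearMap_eq_sum f]
  simp

/-- Restriction of linear forms. -/
def dualMap {X Y : Type u} [AddCommGroup X] [Module Rᵐᵒᵖ X] [AddCommGroup Y] [Module Rᵐᵒᵖ Y]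
    (f : X →ₗ[Rᵐᵒᵖ] Y) : (Y →ₗ[Rᵐᵒᵖ] R) →ₗ[R] (X →ₗ[Rᵐᵒᵖ] R) where
  toFun g := g ∘ₗ f
  map_add' _ _ := rfl
  map_smul' _ _ := rfl

lemma exists_comp_eq {A : Type*} [Ring A] {M N P : Type*} [AddCommGroup M] [Module A M]
    [AddCommGroup N] [Module A N] [AddCommGroup P] [Module A P] (f : M →ₗ[A] N) (g : M →ₗ[A] P)
    (hf : Function.Surjective f) (h : ∀ x, f x = 0 → g x = 0) : ∃ t : N →ₗ[A] P, t ∘ₗ f = g := by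
  refine ⟨(LinearMap.ker f).liftQ g h ∘ₗ (f.quotKerEquivOfSurjective hf).symm.toLinearMap, ?_⟩
  ext x
  have : (f.quotKerEquivOfSurjective hf).symm (f x) = Submodule.Quotient.mk x := by
    rw [LinearEquiv.symm_apply_eq]
    rfl
  simp only [LinearMap.comp_apply, LinearEquiv.coe_coe, this]
  exact Submodule.liftQ_apply _ _ _

/-- Short exactness of a sequence of modules given by linear maps. -/
lemma shortExact_ofHom {A : Type*} [Ring A] {X Y Z : Type u} [AddCommGroup X] [Module A X]
    [AddCommGroup Y] [Module A Y] [AddCommGroup Z] [Module A Z] {f : X →ₗ[A] Y} {g : Y →ₗ[A] Z}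
    (hf : Function.Injective f) (hfg : Function.Exact f g) (hg : Function.Surjective g) :
    (ShortComplex.mk (ModuleCat.ofHom f) (ModuleCat.ofHom g) (by
      ext x; exact hfg.apply_apply_eq_zero x)).ShortExact :=
  ModuleCat.shortComplex_shortExact _ hfg hf hg

variable {X Y : ModuleCat.{u} Rᵐᵒᵖ}

lemma isCM_of_finite [IsNoetherianRing Rᵐᵒᵖ] (h : Module.Finite Rᵐᵒᵖ X)
    (h' : extVanishing.{u} (ModuleCat.of Rᵐᵒᵖ R) X) : isCM R X :=
  ⟨Module.finitePresentation_of_finite _ _, h'⟩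

lemma isCM_of_projective [IsNoetherianRing Rᵐᵒᵖ] (h : Module.Finite Rᵐᵒᵖ X)
    (h' : Module.Projective Rᵐᵒᵖ X) : isCM R X := by
  exact isCM_of_finite h (extVanishing_of_projective _ _)

/-- Finiteness of the kernel is the Noetherian hypothesis; its higher Ext groups vanish by dimension
shifting. -/
lemma exists_syzygy [IsNoetherianRing Rᵐᵒᵖ] (hX : isCM R X) :
    ∃ (n : ℕ) (K : ModuleCat.{u} Rᵐᵒᵖ) (i : K →ₗ[Rᵐᵒᵖ] (Fin n → R)) (p : (Fin n → R) →ₗ[Rᵐᵒᵖ] X),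
      isCM R K ∧ Function.Injective i ∧ Function.Exact i p ∧ Function.Surjective p := by
  have := hX.1
  obtain ⟨n, p, hp⟩ := Module.Finite.exists_fin' Rᵐᵒᵖ X
  let q : (Fin n → R) →ₗ[Rᵐᵒᵖ] X := p ∘ₗ (LinearEquiv.piCongrRight fun _ => (opEquiv R).symm).toLinearMap
  have hq : Function.Surjective q := hp.comp (LinearEquiv.surjective _)
  have hS := shortExact_ofHom (LinearMap.ker q).injective_subtype
    (LinearMap.exact_subtype_ker_map q) hq
  refine ⟨n, ModuleCat.of _ (LinearMap.ker q), (LinearMap.ker q).subtype, q, ?_,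
    (LinearMap.ker q).injective_subtype, LinearMap.exact_subtype_ker_map q, hq⟩
  exact isCM_of_finite inferInstance (extVanishing_X₁ hS _
    (isCM_of_projective (X := ModuleCat.of Rᵐᵒᵖ (Fin n → R)) inferInstance inferInstance).2 hX.2)

lemma dualMap_surjective {X Y Z : Type u} [AddCommGroup X] [Module Rᵐᵒᵖ X]
    [AddCommGroup Y] [Module Rᵐᵒᵖ Y] [AddCommGroup Z] [Module Rᵐᵒᵖ Z]
    {f : X →ₗ[Rᵐᵒᵖ] Y} {g : Y →ₗ[Rᵐᵒᵖ] Z} (hf : Function.Injective f)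
    (hfg : Function.Exact f g) (hg : Function.Surjective g) (hZ : isCM R (ModuleCat.of Rᵐᵒᵖ Z)) :
    Function.Surjective (dualMap f) := by
  intro h
  obtain ⟨k, hk⟩ := exists_extension_of_subsingleton_ext (shortExact_ofHom hf hfg hg)
    (ModuleCat.of Rᵐᵒᵖ R) (hZ.2 1 one_pos) (ModuleCat.ofHom h)
  exact ⟨k.hom, congrArg ModuleCat.Hom.hom hk⟩

lemma exact_dualMap {X Y Z : Type u} [AddCommGroup X] [Module Rᵐᵒᵖ X]
    [AddCommGroup Y] [Module Rᵐᵒᵖ Y] [AddCommGroup Z] [Module Rᵐᵒᵖ Z]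
    {f : X →ₗ[Rᵐᵒᵖ] Y} {g : Y →ₗ[Rᵐᵒᵖ] Z}
    (hfg : Function.Exact f g) (hg : Function.Surjective g) :
    Function.Exact (dualMap g) (dualMap f) := by
  intro h
  constructor
  · intro hh
    refine exists_comp_eq g h hg fun y hy => ?_
    obtain ⟨x, rfl⟩ := (hfg y).1 hy
    exact LinearMap.congr_fun hh x
  · rintro ⟨k, rfl⟩
    ext x
    change k (g (f x)) = 0
    rw [hfg.apply_apply_eq_zero, map_zero]

lemma dualMap_injective {Y Z : Type u}
    [AddCommGroup Y] [Module Rᵐᵒᵖ Y] [AddCommGroup Z] [Module Rᵐᵒᵖ Z]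
    {g : Y →ₗ[Rᵐᵒᵖ] Z} (hg : Function.Surjective g) : Function.Injective (dualMap g) := by
  intro h k hhk
  ext z
  obtain ⟨y, rfl⟩ := hg z
  exact LinearMap.congr_fun hhk y

/-- Dualizing a free cover of `X` with kernel K gives an exact sequence X* → (R^k)* → K*, because
Ext¹(X, R) = 0. So Ext^i(X*, R) vanishes once Ext^(i+1)(K*, R) does; after `m` syzygies the degree
exceeds the left injective dimension. -/
lemma extVanishing_dual [IsNoetherianRing Rᵐᵒᵖ] {n : ℕ}
    (hn : HasInjectiveDimensionLE (ModuleCat.of.{u} R R) n) (m : ℕ) {X : ModuleCat.{u} Rᵐᵒᵖ}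
    (hX : isCM R X) {i : ℕ} (hi : 0 < i) (him : n < i + m) :
    Subsingleton (Abelian.Ext.{u} (ModuleCat.of.{u} R (X →ₗ[Rᵐᵒᵖ] R)) (ModuleCat.of.{u} R R) i) := by
  induction m generalizing X i with
  | zero => exact HasInjectiveDimensionLT.subsingleton _ (n + 1) i (by omega) _
  | succ m ih =>
    obtain ⟨k, K, f, g, hK, hf, hfg, hg⟩ := exists_syzygy hX
    have hS := shortExact_ofHom (dualMap_injective hg) (exact_dualMap hfg hg)
      (dualMap_surjective hf hfg hg hX)
    have : Module.Projective R ((Fin k → R) →ₗ[Rᵐᵒᵖ] R) := .of_equiv (dualEquiv R k).symm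
    exact subsingleton_ext_X₁ hS _ (extVanishing_of_projective _ _ i hi)
      (ih hK (Nat.succ_pos i) (by omega))

/-- Cohen-Macaulay modules are torsionless. -/
lemma eq_zero_of_forall_dual (hR : IsIwanagaGorenstein R) {X : ModuleCat.{u} Rᵐᵒᵖ}
    (hX : isCM R X) (x : X) (hx : ∀ f : X →ₗ[Rᵐᵒᵖ] R, f x = 0) : x = 0 := by
  have := hR.right_noetherian
  obtain ⟨n, hn⟩ := hR.left_injectiveDimension
  obtain ⟨k₀, K, i₀, p₀, hK, hi₀, he₀, hp₀⟩ := exists_syzygy hX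
  obtain ⟨k₁, K', i₁, p₁, hK', hi₁, he₁, hp₁⟩ := exists_syzygy hK
  obtain ⟨p, rfl⟩ := hp₀ x
  let ev : ((Fin k₀ → R) →ₗ[Rᵐᵒᵖ] R) →ₗ[R] R :=
    { toFun := fun f => f p, map_add' := fun _ _ => rfl, map_smul' := fun _ _ => rfl }
  -- Evaluation at `p` kills the forms coming from `X`, since `x` is killed by all of them; hence it
  -- factors through K*.
  obtain ⟨φ, hφ⟩ := exists_comp_eq (dualMap i₀) ev (dualMap_surjective hi₀ he₀ hp₀ hX) (by
    intro f hf
    obtain ⟨g, rfl⟩ := (exact_dualMap he₀ hp₀ f).1 hf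
    exact hx g)
  -- K* embeds into the dual of R^k₁ with cokernel the dual of K', so Ext¹ vanishing extends `φ`
  -- there. By `exists_eq_eval` the extension is evaluation at some `q`.
  obtain ⟨ψ, hψ⟩ := exists_extension_of_subsingleton_ext
    (shortExact_ofHom (dualMap_injective hp₁) (exact_dualMap he₁ hp₁)
      (dualMap_surjective hi₁ he₁ hp₁ hK)) (ModuleCat.of.{u} R R)
    (extVanishing_dual hn n hK' one_pos (by omega)) (ModuleCat.ofHom φ)
  obtain ⟨q, hq⟩ := exists_eq_eval ψ.hom
  -- Compare coordinates: both evaluations agree on the coordinate forms of R^k₀. Thus `p` comes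
  -- from the syzygy and maps to 0 in `X`.
  have h : p = i₀ (p₁ q) := by
    ext j
    have h₁ := LinearMap.congr_fun hφ (LinearMap.proj j)
    have h₂ := LinearMap.congr_fun (congrArg ModuleCat.Hom.hom hψ)
      (dualMap i₀ (LinearMap.proj j))
    have h₃ := hq (dualMap p₁ (dualMap i₀ (LinearMap.proj j)))
    exact h₁.symm.trans (h₂.symm.trans h₃)
  rw [h, he₀.apply_apply_eq_zero]

/-- Cohen-Macaulay modules embed into free modules such that every linear form extends. -/
lemma exists_embedding (hR : IsIwanagaGorenstein R) {X : ModuleCat.{u} Rᵐᵒᵖ} (hX : isCM R X) :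
    ∃ (n : ℕ) (f : X →ₗ[Rᵐᵒᵖ] (Fin n → R)), Function.Injective f ∧
      Function.Surjective (dualMap f) := by
  have := hR.right_noetherian
  have := hR.left_noetherian
  obtain ⟨k, K, i, p, hK, hi, he, hp⟩ := exists_syzygy hX
  -- X* embeds into the dual of R^k, which is R^k as a left module, and `R` is left Noetherian.
  have : Module.Finite R (X →ₗ[Rᵐᵒᵖ] R) :=
    Module.Finite.of_injective ((dualEquiv R k).toLinearMap ∘ₗ dualMap p)
      ((dualEquiv R k).injective.comp (dualMap_injective hp))
  obtain ⟨n, s, hs⟩ := Module.Finite.exists_fin (R := R) (M := X →ₗ[Rᵐᵒᵖ] R)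
  -- The coordinate forms restrict to the generators `s` of X*, so the image of restriction is
  -- everything.
  have hsurj : Function.Surjective (dualMap (LinearMap.pi s)) := by
    rw [← LinearMap.range_eq_top, eq_top_iff, ← hs, Submodule.span_le]
    rintro _ ⟨j, rfl⟩
    exact ⟨LinearMap.proj j, LinearMap.proj_pi _ _⟩
  refine ⟨n, LinearMap.pi s, ?_, hsurj⟩
  rw [injective_iff_map_eq_zero]
  intro x hx
  refine eq_zero_of_forall_dual hR hX x fun f => ?_
  obtain ⟨g, rfl⟩ := hsurj f
  change g (LinearMap.pi s x) = 0
  rw [hx, map_zero]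

end Dual

end Gorenstein

/-! ### Cohen-Macaulay modules form a Frobenius category -/

namespace Gorenstein

open Frobenius

section CM

variable {R : Type u} [Ring R]

variable (R) in
/-- The category of Cohen-Macaulay modules. -/
abbrev CM : Type _ := (isCM R).FullSubcategory

/-- The linear map underlying a morphism of Cohen-Macaulay modules. -/
abbrev lin {X Y : CM R} (f : X ⟶ Y) : X.obj →ₗ[Rᵐᵒᵖ] Y.obj := f.hom.hom

/-- The morphism of Cohen-Macaulay modules given by a linear map. -/
def cmHom {X Y : CM R} (f : X.obj →ₗ[Rᵐᵒᵖ] Y.obj) : X ⟶ Y :=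
  ObjectProperty.homMk (ModuleCat.ofHom f)

lemma cm_hom_ext {X Y : CM R} {f g : X ⟶ Y} (h : ∀ x, lin f x = lin g x) : f = g :=
  ObjectProperty.hom_ext _ (ModuleCat.hom_ext (LinearMap.ext h))

lemma lin_comp_apply {X Y Z : CM R} (f : X ⟶ Y) (g : Y ⟶ Z) (x : X.obj) :
    lin (f ≫ g) x = lin g (lin f x) := rfl

lemma lin_eq_of_eq {X Y : CM R} {f g : X ⟶ Y} (h : f = g) (x : X.obj) : lin f x = lin g x := by
  rw [h]

lemma cmConflation_iff (S : ShortComplex (CM R)) : cmConflation R S ↔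
    Function.Injective (lin S.f) ∧ Function.Exact (lin S.f) (lin S.g) ∧
      Function.Surjective (lin S.g) := by
  constructor
  · intro h
    exact ⟨h.moduleCat_injective_f,
      (ShortComplex.ShortExact.moduleCat_exact_iff_function_exact _).1 h.exact,
      h.moduleCat_surjective_g⟩
  · rintro ⟨h₁, h₂, h₃⟩
    exact ModuleCat.shortComplex_shortExact _ h₂ h₁ h₃

/-- The inflations of `CM R`. -/
def IsInflation {X Y : CM R} (f : X ⟶ Y) : Prop :=
  Function.Injective (lin f) ∧ Function.Surjective (dualMap (lin f))

lemma IsInflation.comp {X Y Z : CM R} {f : X ⟶ Y} {g : Y ⟶ Z} (hf : IsInflation f)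
    (hg : IsInflation g) : IsInflation (f ≫ g) :=
  ⟨hg.1.comp hf.1, hf.2.comp hg.2⟩

lemma IsInflation.of_comp {X Y Z : CM R} {f : X ⟶ Y} {g : Y ⟶ Z} (h : IsInflation (f ≫ g)) :
    IsInflation f :=
  ⟨Function.Injective.of_comp h.1, Function.Surjective.of_comp (g := dualMap (lin g)) h.2⟩

lemma isInflation_of_cmConflation {S : ShortComplex (CM R)} (hS : cmConflation R S) :
    IsInflation S.f := by
  obtain ⟨h₁, h₂, h₃⟩ := (cmConflation_iff S).1 hS
  exact ⟨h₁, dualMap_surjective h₁ h₂ h₃ S.X₃.property⟩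

/-- Extendability of linear forms is exactly what makes Ext¹ of the cokernel into `R` vanish, so
inflations can be recognized without mentioning cokernels. -/
lemma exists_cmConflation [IsNoetherianRing Rᵐᵒᵖ] {X Y : CM R} {f : X ⟶ Y} (hf : IsInflation f) :
    ∃ (Z : CM R) (p : Y ⟶ Z) (w : f ≫ p = 0), cmConflation R (ShortComplex.mk f p w) := by
  have hfin := Y.property.1
  have hS := shortExact_ofHom hf.1 (LinearMap.exact_map_mkQ_range (lin f))
    (LinearMap.range (lin f)).mkQ_surjective
  have hZ : isCM R (ModuleCat.of Rᵐᵒᵖ (Y.obj ⧸ LinearMap.range (lin f))) :=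
    isCM_of_finite inferInstance (extVanishing_X₃ hS _ X.property.2 Y.property.2 (fun h => by
      obtain ⟨k, hk⟩ := hf.2 h.hom
      exact ⟨ModuleCat.ofHom k, ModuleCat.hom_ext hk⟩))
  refine ⟨⟨_, hZ⟩, cmHom (X := Y) (Y := ⟨_, hZ⟩) (LinearMap.range (lin f)).mkQ, ?_, ?_⟩
  · refine cm_hom_ext fun x => ?_
    exact (LinearMap.exact_map_mkQ_range (lin f)).apply_apply_eq_zero x
  · rw [cmConflation_iff]
    exact ⟨hf.1, LinearMap.exact_map_mkQ_range (lin f), (LinearMap.range (lin f)).mkQ_surjective⟩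

lemma mono_of_injective {X Y : CM R} {f : X ⟶ Y} (h : Function.Injective (lin f)) : Mono f :=
  ⟨fun _ _ hab => cm_hom_ext fun x => h (lin_eq_of_eq hab x)⟩

lemma epi_of_surjective {X Y : CM R} {f : X ⟶ Y} (h : Function.Surjective (lin f)) : Epi f :=
  ⟨fun a b hab => cm_hom_ext fun y => by
    obtain ⟨x, rfl⟩ := h y
    exact lin_eq_of_eq hab x⟩

lemma cm_exists_desc {S : ShortComplex (CM R)} (hS : cmConflation R S) {T : CM R} (t : S.X₂ ⟶ T)
    (ht : S.f ≫ t = 0) : ∃ s, S.g ≫ s = t := by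
  obtain ⟨h₁, h₂, h₃⟩ := (cmConflation_iff S).1 hS
  obtain ⟨s, hs⟩ := exists_comp_eq (lin S.g) (lin t) h₃ (fun x hx => by
    obtain ⟨y, rfl⟩ := (h₂ x).1 hx
    exact lin_eq_of_eq ht y)
  exact ⟨cmHom s, cm_hom_ext fun x => LinearMap.congr_fun hs x⟩

lemma cm_exists_lift {S : ShortComplex (CM R)} (hS : cmConflation R S) {T : CM R} (t : T ⟶ S.X₂)
    (ht : t ≫ S.g = 0) : ∃ s, s ≫ S.f = t := by
  obtain ⟨h₁, h₂, h₃⟩ := (cmConflation_iff S).1 hS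
  let e := LinearEquiv.ofInjective (lin S.f) h₁
  refine ⟨cmHom (e.symm.toLinearMap ∘ₗ (lin t).codRestrict _ fun x =>
    (h₂ _).1 (lin_eq_of_eq ht x)), cm_hom_ext fun x => ?_⟩
  exact congrArg Subtype.val (e.apply_symm_apply ((lin t).codRestrict _ (fun x =>
    (h₂ _).1 (lin_eq_of_eq ht x)) x))

/-- The third isomorphism theorem, by a diagram chase. -/
lemma cmConflation_of_comp {X₁ X₂ X₃ Z₁₂ Z₂₃ Z₁₃ : CM R} {f₁₂ : X₁ ⟶ X₂} {g₁₂ : X₂ ⟶ Z₁₂}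
    {w₁₂ : f₁₂ ≫ g₁₂ = 0} {f₂₃ : X₂ ⟶ X₃} {g₂₃ : X₃ ⟶ Z₂₃} {w₂₃ : f₂₃ ≫ g₂₃ = 0}
    {g₁₃ : X₃ ⟶ Z₁₃} {w₁₃ : (f₁₂ ≫ f₂₃) ≫ g₁₃ = 0} {m₁ : Z₁₂ ⟶ Z₁₃} {m₃ : Z₁₃ ⟶ Z₂₃}
    (w : m₁ ≫ m₃ = 0)
    (h₁₂ : cmConflation R (ShortComplex.mk f₁₂ g₁₂ w₁₂))
    (h₂₃ : cmConflation R (ShortComplex.mk f₂₃ g₂₃ w₂₃))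
    (h₁₃ : cmConflation R (ShortComplex.mk (f₁₂ ≫ f₂₃) g₁₃ w₁₃))
    (hm₁ : g₁₂ ≫ m₁ = f₂₃ ≫ g₁₃) (hm₃ : g₁₃ ≫ m₃ = g₂₃) :
    cmConflation R (ShortComplex.mk m₁ m₃ w) := by
  obtain ⟨-, a₂, a₃⟩ := (cmConflation_iff _).1 h₁₂
  obtain ⟨b₁, b₂, b₃⟩ := (cmConflation_iff _).1 h₂₃
  obtain ⟨-, c₂, c₃⟩ := (cmConflation_iff _).1 h₁₃
  have hm₁' := fun x => lin_eq_of_eq hm₁ x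
  have hm₄ := fun x => lin_eq_of_eq hm₃ x
  simp only [lin_comp_apply] at hm₁' hm₄
  refine (cmConflation_iff _).2 ⟨?_, fun z => ⟨fun hz => ?_, ?_⟩, fun z => ?_⟩
  · refine (injective_iff_map_eq_zero _).2 fun z hz => ?_
    obtain ⟨x, rfl⟩ := a₃ z
    obtain ⟨y, hy⟩ := (c₂ (lin f₂₃ x)).1 ((hm₁' x).symm.trans hz)
    exact (a₂ x).2 ⟨y, b₁ hy⟩
  · obtain ⟨x, rfl⟩ := c₃ z
    obtain ⟨y, rfl⟩ := (b₂ x).1 ((hm₄ x).symm.trans hz)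
    exact ⟨lin g₁₂ y, hm₁' y⟩
  · rintro ⟨y, rfl⟩
    exact lin_eq_of_eq w y
  · obtain ⟨x, rfl⟩ := b₃ z
    exact ⟨lin g₁₃ x, hm₄ x⟩

/-- A morphism of conflations that is an isomorphism on the third terms
is cocartesian on the first ones. -/
lemma cm_exists_pushout_desc {S S' : ShortComplex (CM R)} (hS : cmConflation R S)
    (hS' : cmConflation R S') (φ : S ⟶ S') (hφ : IsIso φ.τ₃) {T : CM R} (a : S.X₂ ⟶ T)
    (b : S'.X₁ ⟶ T) (hab : S.f ≫ a = φ.τ₁ ≫ b) : ∃ t, φ.τ₂ ≫ t = a ∧ S'.f ≫ t = b := by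
  obtain ⟨-, h₂, h₃⟩ := (cmConflation_iff S).1 hS
  obtain ⟨h₁', h₂', -⟩ := (cmConflation_iff S').1 hS'
  have c₁₂ := fun x => lin_eq_of_eq φ.comm₁₂ x
  have c₂₃ := fun x => lin_eq_of_eq φ.comm₂₃ x
  have hinv := fun x => lin_eq_of_eq (IsIso.inv_hom_id φ.τ₃) x
  have hinv' := fun x => lin_eq_of_eq (IsIso.hom_inv_id φ.τ₃) x
  simp only [lin_comp_apply] at c₁₂ c₂₃ hinv hinv'
  -- The map S.X₂ × S'.X₁ → S'.X₂ is surjective because third terms are identified, and its kernel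
  -- consists of the pairs (S.f x, -φ.τ₁ x), on which the given pair of maps vanishes by `hab`.
  obtain ⟨t, ht⟩ := exists_comp_eq ((lin φ.τ₂).coprod (lin S'.f)) ((lin a).coprod (lin b))
    (fun x' => by
      obtain ⟨x, hx⟩ := h₃ (lin (inv φ.τ₃) (lin S'.g x'))
      obtain ⟨y, hy⟩ := (h₂' (x' - lin φ.τ₂ x)).1 (by
        rw [map_sub, c₂₃, hx, hinv]
        exact sub_self _)
      exact ⟨(x, y), by simp [hy]⟩)
    (by
      rintro ⟨x, y⟩ hxy
      simp only [LinearMap.coprod_apply] at hxy ⊢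
      obtain ⟨x, rfl⟩ := (h₂ x).1 (by
        have h := congrArg (lin S'.g) hxy
        rw [map_add, c₂₃, h₂'.apply_apply_eq_zero, add_zero, map_zero] at h
        have := congrArg (lin (inv φ.τ₃)) h
        rw [hinv', map_zero] at this
        exact this)
      rw [← c₁₂, ← map_add] at hxy
      have hy : y = -lin φ.τ₁ x := by
        rw [eq_neg_iff_add_eq_zero, add_comm]
        exact h₁' (hxy.trans (map_zero _).symm)
      have := lin_eq_of_eq hab x
      simp only [lin_comp_apply] at this
      rw [hy, map_neg, this, add_neg_cancel])
  refine ⟨cmHom t, cm_hom_ext fun x => ?_, cm_hom_ext fun y => ?_⟩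
  · have := LinearMap.congr_fun ht (x, 0)
    simp only [LinearMap.comp_apply, LinearMap.coprod_apply, map_zero, add_zero] at this
    exact this
  · have := LinearMap.congr_fun ht (0, y)
    simp only [LinearMap.comp_apply, LinearMap.coprod_apply, map_zero, zero_add] at this
    exact this

lemma cm_eq_zero_of_pushout {S S' : ShortComplex (CM R)} (hS : cmConflation R S)
    (hS' : cmConflation R S') (φ : S ⟶ S') (hφ : IsIso φ.τ₃) {T : CM R} (t : S'.X₂ ⟶ T)
    (h₁ : φ.τ₂ ≫ t = 0) (h₂ : S'.f ≫ t = 0) : t = 0 := by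
  obtain ⟨s, rfl⟩ := cm_exists_desc hS' t h₂
  have : Epi S.g := epi_of_surjective ((cmConflation_iff S).1 hS).2.2
  rw [φ.comm₂₃_assoc] at h₁
  have : s = 0 := by
    rw [← cancel_epi φ.τ₃, ← cancel_epi S.g, h₁]
    simp
  rw [this, comp_zero]

variable (R) in
/-- The Cohen-Macaulay module `R^n`. -/
def free [IsNoetherianRing Rᵐᵒᵖ] (n : ℕ) : CM R :=
  ⟨ModuleCat.of Rᵐᵒᵖ (Fin n → R), isCM_of_projective
    (X := ModuleCat.of Rᵐᵒᵖ (Fin n → R)) inferInstance inferInstance⟩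

lemma exists_free_conflation [IsNoetherianRing Rᵐᵒᵖ] (X : CM R) :
    ∃ (n : ℕ) (K : CM R) (i : K ⟶ free R n) (p : free R n ⟶ X) (w : i ≫ p = 0),
      cmConflation R (ShortComplex.mk i p w) := by
  obtain ⟨n, K, i, p, hK, hi, he, hp⟩ := exists_syzygy X.property
  exact ⟨n, ⟨K, hK⟩, cmHom (X := ⟨K, hK⟩) (Y := free R n) i, cmHom (X := free R n) p,
    cm_hom_ext fun x => he.apply_apply_eq_zero x, (cmConflation_iff _).2 ⟨hi, he, hp⟩⟩

lemma exists_retract_free [IsNoetherianRing Rᵐᵒᵖ] {X : CM R} (hX : Module.Projective Rᵐᵒᵖ X.obj) :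
    ∃ (n : ℕ) (s : X ⟶ free R n) (p : free R n ⟶ X), s ≫ p = 𝟙 X := by
  obtain ⟨n, K, i, p, w, h⟩ := exists_free_conflation X
  obtain ⟨s, hs⟩ := Module.projective_lifting_property (lin p) LinearMap.id
    ((cmConflation_iff _).1 h).2.2
  exact ⟨n, cmHom s, p, cm_hom_ext fun x => LinearMap.congr_fun hs x⟩

lemma relProjective_cmConflation_of_projective {X : CM R}
    (hX : Module.Projective Rᵐᵒᵖ X.obj) : relProjective (cmConflation R) X := by
  intro S hS f
  obtain ⟨s, hs⟩ := Module.projective_lifting_property (lin S.g) (lin f)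
    ((cmConflation_iff _).1 hS).2.2
  exact ⟨cmHom s, cm_hom_ext fun x => LinearMap.congr_fun hs x⟩

instance [IsNoetherianRing Rᵐᵒᵖ] (n : ℕ) : Module.Projective Rᵐᵒᵖ (free R n).obj :=
  inferInstanceAs (Module.Projective Rᵐᵒᵖ (Fin n → R))

lemma projective_of_relProjective [IsNoetherianRing Rᵐᵒᵖ] {X : CM R}
    (hX : relProjective (cmConflation R) X) : Module.Projective Rᵐᵒᵖ X.obj := by
  obtain ⟨n, K, i, p, w, h⟩ := exists_free_conflation X
  obtain ⟨s, hs⟩ := hX _ h (𝟙 X)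
  exact Module.Projective.of_split (lin s) (lin p) (LinearMap.ext (lin_eq_of_eq hs))

/-- A finitely generated projective is a retract of some R^n, and maps into R^n extend coordinate by
coordinate. -/
lemma exists_extension_of_isInflation [IsNoetherianRing Rᵐᵒᵖ] {X Y P : CM R} {f : X ⟶ Y}
    (hf : IsInflation f) (hP : Module.Projective Rᵐᵒᵖ P.obj) (g : X ⟶ P) :
    ∃ h : Y ⟶ P, f ≫ h = g := by
  obtain ⟨n, s, p, hsp⟩ := exists_retract_free hP
  choose k hk using fun j : Fin n => hf.2 (LinearMap.proj j ∘ₗ (lin (g ≫ s) : X.obj →ₗ[Rᵐᵒᵖ] (Fin n → R)))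
  refine ⟨cmHom (Y := free R n) (LinearMap.pi k) ≫ p, ?_⟩
  rw [← Category.comp_id g, ← hsp, ← Category.assoc, ← Category.assoc]
  congr 1
  refine cm_hom_ext fun x => ?_
  funext j
  exact LinearMap.congr_fun (hk j) x

lemma exists_inflation_free (hR : IsIwanagaGorenstein R) [IsNoetherianRing Rᵐᵒᵖ] (X : CM R) :
    ∃ (n : ℕ) (f : X ⟶ free R n), IsInflation f := by
  obtain ⟨n, f, h₁, h₂⟩ := exists_embedding hR X.property
  exact ⟨n, cmHom (Y := free R n) f, h₁, h₂⟩

/-- The category of Cohen-Macaulay modules is a Frobenius category. -/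
theorem isFrobenius_cmConflation (hR : IsIwanagaGorenstein R) : IsFrobenius (cmConflation R) := by
  have := hR.right_noetherian
  exact {
    mono_f := fun hS => mono_of_injective ((cmConflation_iff _).1 hS).1
    epi_g := fun hS => epi_of_surjective ((cmConflation_iff _).1 hS).2.2
    exists_lift := fun hS _ t ht => cm_exists_lift hS t ht
    exists_desc := fun hS _ t ht => cm_exists_desc hS t ht
    exists_biprod := fun {S} hS Y u => by
      apply exists_cmConflation
      apply IsInflation.of_comp (g := biprod.fst)
      rw [biprod.lift_fst]
      exact isInflation_of_cmConflation hS
    exists_comp := fun {X₁ X₂ X₃ Z₁₂ Z₂₃ f₁₂ g₁₂ w₁₂ f₂₃ g₂₃ w₂₃} h₁₂ h₂₃ => by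
      obtain ⟨Z₁₃, g₁₃, w₁₃, h₁₃⟩ := exists_cmConflation
        ((isInflation_of_cmConflation h₁₂).comp (isInflation_of_cmConflation h₂₃))
      obtain ⟨m₁, hm₁⟩ := cm_exists_desc h₁₂ (f₂₃ ≫ g₁₃) ((Category.assoc _ _ _).symm.trans w₁₃)
      obtain ⟨m₃, hm₃⟩ := cm_exists_desc h₁₃ g₂₃ (by
        change (f₁₂ ≫ f₂₃) ≫ g₂₃ = 0
        rw [Category.assoc, w₂₃, comp_zero])
      dsimp only at hm₁ hm₃
      have : Epi g₁₂ := epi_of_surjective ((cmConflation_iff _).1 h₁₂).2.2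
      have w : m₁ ≫ m₃ = 0 := by
        rw [← cancel_epi g₁₂, reassoc_of% hm₁, hm₃, w₂₃, comp_zero]
      exact ⟨Z₁₃, g₁₃, w₁₃, m₁, m₃, w, h₁₃, cmConflation_of_comp w h₁₂ h₂₃ h₁₃ hm₁ hm₃, hm₁, hm₃⟩
    isPushout_of_isIso := fun hS hS' φ hφ => isPushout_of_exists_desc φ.comm₁₂.symm
      (fun _ a b hab => cm_exists_pushout_desc hS hS' φ hφ a b hab)
      (fun _ t h₁ h₂ => cm_eq_zero_of_pushout hS hS' φ hφ t h₁ h₂)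
    enough_injectives := fun X => by
      obtain ⟨n, f, hf⟩ := exists_inflation_free hR X
      obtain ⟨Z, p, w, h⟩ := exists_cmConflation hf
      exact ⟨_, Z, f, p, w, h, relProjective_cmConflation_of_projective inferInstance⟩
    enough_projectives := fun X => by
      obtain ⟨n, K, i, p, w, h⟩ := exists_free_conflation X
      exact ⟨_, K, i, p, w, h, relProjective_cmConflation_of_projective inferInstance⟩
    relInjective_of_relProjective := fun hX S hS f =>
      exists_extension_of_isInflation (isInflation_of_cmConflation hS)
        (projective_of_relProjective hX) f }

end CM

end Gorenstein

namespace Frobenius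

lemma relProjective_biprod {C : Type*} [Category C] [Preadditive C] [HasBinaryBiproducts C]
    {E : ObjectProperty (ShortComplex C)} {P Q : C} (hP : relProjective E P)
    (hQ : relProjective E Q) : relProjective E (P ⊞ Q) := by
  intro S hS f
  obtain ⟨g, hg⟩ := hP S hS (biprod.inl ≫ f)
  obtain ⟨g', hg'⟩ := hQ S hS (biprod.inr ≫ f)
  exact ⟨biprod.desc g g', by ext <;> simp [hg, hg']⟩

end Frobenius

/-! ### Surjections of Cohen-Macaulay modules form a Frobenius category -/

namespace Gorenstein

open Frobenius

section MorE

variable {R : Type u} [Ring R]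

variable (R) in
/-- The category of surjective maps of Cohen-Macaulay modules. -/
abbrev MorE : Type _ := (isMorE R).FullSubcategory

variable (R) in
/-- The source functor. -/
def lf : MorE R ⥤ CM R :=
  ObjectProperty.lift _ ((isMorE R).ι ⋙ Arrow.leftFunc) fun α => α.property.1

variable (R) in
/-- The target functor. -/
def rf : MorE R ⥤ CM R :=
  ObjectProperty.lift _ ((isMorE R).ι ⋙ Arrow.rightFunc) fun α => α.property.2.1

instance : (lf R).Additive where
  map_add := rfl

instance : (rf R).Additive where
  map_add := rfl

/-- The surjective map that an object of `MorE R` consists of. -/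
def arr (α : MorE R) : (lf R).obj α ⟶ (rf R).obj α := ObjectProperty.homMk α.obj.hom

lemma arr_surjective (α : MorE R) : Function.Surjective (lin (arr α)) := α.property.2.2

lemma arr_naturality {α β : MorE R} (f : α ⟶ β) :
    (lf R).map f ≫ arr β = arr α ≫ (rf R).map f :=
  ObjectProperty.hom_ext _ f.hom.w

/-- Constructor for objects of `MorE R`. -/
abbrev mkMorE {X T : CM R} (f : X ⟶ T) (hf : Function.Surjective (lin f)) : MorE R :=
  ⟨Arrow.mk f.hom, X.property, T.property, hf⟩

/-- Constructor for morphisms of `MorE R`. -/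
def morHom {α β : MorE R} (a : (lf R).obj α ⟶ (lf R).obj β) (b : (rf R).obj α ⟶ (rf R).obj β)
    (w : a ≫ arr β = arr α ≫ b) : α ⟶ β :=
  ObjectProperty.homMk (Arrow.homMk a.hom b.hom ((isCM R).ι.congr_map w))

@[simp]
lemma lf_map_morHom {α β : MorE R} (a : (lf R).obj α ⟶ (lf R).obj β)
    (b : (rf R).obj α ⟶ (rf R).obj β) (w : a ≫ arr β = arr α ≫ b) :
    (lf R).map (morHom a b w) = a := rfl

@[simp]
lemma rf_map_morHom {α β : MorE R} (a : (lf R).obj α ⟶ (lf R).obj β)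
    (b : (rf R).obj α ⟶ (rf R).obj β) (w : a ≫ arr β = arr α ≫ b) :
    (rf R).map (morHom a b w) = b := rfl

lemma mor_hom_ext {α β : MorE R} {f g : α ⟶ β} (h₁ : (lf R).map f = (lf R).map g)
    (h₂ : (rf R).map f = (rf R).map g) : f = g := by
  apply ObjectProperty.hom_ext
  exact Arrow.hom_ext _ _ ((isCM R).ι.congr_map h₁)
    ((isCM R).ι.congr_map h₂)

lemma morEConflation_iff (S : ShortComplex (MorE R)) : morEConflation R S ↔
    cmConflation R (S.map (lf R)) ∧ cmConflation R (S.map (rf R)) := Iff.rfl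

lemma cmConflation_map_lf {S : ShortComplex (MorE R)} (hS : morEConflation R S) :
    cmConflation R (S.map (lf R)) := hS.1

lemma cmConflation_map_rf {S : ShortComplex (MorE R)} (hS : morEConflation R S) :
    cmConflation R (S.map (rf R)) := hS.2

lemma mor_exists_desc {S : ShortComplex (MorE R)} (hS : morEConflation R S) {T : MorE R}
    (t : S.X₂ ⟶ T) (ht : S.f ≫ t = 0) : ∃ s, S.g ≫ s = t := by
  obtain ⟨h₁, h₂⟩ := (morEConflation_iff S).1 hS
  obtain ⟨a, ha⟩ := cm_exists_desc h₁ ((lf R).map t) (by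
    refine ((lf R).map_comp _ _).symm.trans ?_
    rw [ht, Functor.map_zero]
    rfl)
  obtain ⟨b, hb⟩ := cm_exists_desc h₂ ((rf R).map t) (by
    refine ((rf R).map_comp _ _).symm.trans ?_
    rw [ht, Functor.map_zero]
    rfl)
  change (lf R).obj S.X₃ ⟶ _ at a
  change (rf R).obj S.X₃ ⟶ _ at b
  change (lf R).map S.g ≫ a = _ at ha
  change (rf R).map S.g ≫ b = _ at hb
  have : Epi ((lf R).map S.g) := epi_of_surjective ((cmConflation_iff _).1 h₁).2.2
  refine ⟨morHom a b ?_, mor_hom_ext ?_ ?_⟩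
  · rw [← cancel_epi ((lf R).map S.g), reassoc_of% ha, arr_naturality,
      reassoc_of% (arr_naturality S.g), hb]
  · rw [Functor.map_comp, lf_map_morHom, ha]
  · rw [Functor.map_comp, rf_map_morHom, hb]

lemma mor_exists_lift {S : ShortComplex (MorE R)} (hS : morEConflation R S) {T : MorE R}
    (t : T ⟶ S.X₂) (ht : t ≫ S.g = 0) : ∃ s, s ≫ S.f = t := by
  obtain ⟨h₁, h₂⟩ := (morEConflation_iff S).1 hS
  obtain ⟨a, ha⟩ := cm_exists_lift h₁ ((lf R).map t) (by
    refine ((lf R).map_comp _ _).symm.trans ?_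
    rw [ht, Functor.map_zero]
    rfl)
  obtain ⟨b, hb⟩ := cm_exists_lift h₂ ((rf R).map t) (by
    refine ((rf R).map_comp _ _).symm.trans ?_
    rw [ht, Functor.map_zero]
    rfl)
  change _ ⟶ (lf R).obj S.X₁ at a
  change _ ⟶ (rf R).obj S.X₁ at b
  change a ≫ (lf R).map S.f = _ at ha
  change b ≫ (rf R).map S.f = _ at hb
  have : Mono ((rf R).map S.f) := mono_of_injective ((cmConflation_iff _).1 h₂).1
  refine ⟨morHom a b ?_, mor_hom_ext ?_ ?_⟩
  · rw [← cancel_mono ((rf R).map S.f), Category.assoc, ← arr_naturality, reassoc_of% ha,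
      arr_naturality, Category.assoc, hb]
  · rw [Functor.map_comp, lf_map_morHom, ha]
  · rw [Functor.map_comp, rf_map_morHom, hb]

lemma mor_epi_g {S : ShortComplex (MorE R)} (hS : morEConflation R S) : Epi S.g := by
  have : Epi ((lf R).map S.g) := epi_of_surjective ((cmConflation_iff _).1 (cmConflation_map_lf hS)).2.2
  have : Epi ((rf R).map S.g) := epi_of_surjective ((cmConflation_iff _).1 (cmConflation_map_rf hS)).2.2
  refine ⟨fun a b h => mor_hom_ext ?_ ?_⟩
  · rw [← cancel_epi ((lf R).map S.g), ← Functor.map_comp, h, Functor.map_comp]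
  · rw [← cancel_epi ((rf R).map S.g), ← Functor.map_comp, h, Functor.map_comp]

lemma mor_mono_f {S : ShortComplex (MorE R)} (hS : morEConflation R S) : Mono S.f := by
  have : Mono ((lf R).map S.f) := mono_of_injective ((cmConflation_iff _).1 (cmConflation_map_lf hS)).1
  have : Mono ((rf R).map S.f) := mono_of_injective ((cmConflation_iff _).1 (cmConflation_map_rf hS)).1
  refine ⟨fun a b h => mor_hom_ext ?_ ?_⟩
  · rw [← cancel_mono ((lf R).map S.f), ← Functor.map_comp, h, Functor.map_comp]
  · rw [← cancel_mono ((rf R).map S.f), ← Functor.map_comp, h, Functor.map_comp]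

/-- Take cokernels at the sources and at the targets; the induced map is surjective because its
composite with the source projection is. -/
lemma exists_morEConflation [IsNoetherianRing Rᵐᵒᵖ] {α β : MorE R} {f : α ⟶ β}
    (h₁ : IsInflation ((lf R).map f)) (h₂ : IsInflation ((rf R).map f)) :
    ∃ (γ : MorE R) (p : β ⟶ γ) (w : f ≫ p = 0), morEConflation R (ShortComplex.mk f p w) := by
  obtain ⟨Z₁, p₁, w₁, c₁⟩ := exists_cmConflation h₁
  obtain ⟨Z₂, p₂, w₂, c₂⟩ := exists_cmConflation h₂
  obtain ⟨z, hz⟩ := cm_exists_desc c₁ (arr β ≫ p₂) (by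
    change (lf R).map f ≫ _ = 0
    rw [reassoc_of% (arr_naturality f), w₂, comp_zero])
  dsimp at z hz
  have hz' : Function.Surjective (lin z) := by
    have : Function.Surjective (lin (arr β ≫ p₂)) :=
      ((cmConflation_iff _).1 c₂).2.2.comp (arr_surjective β)
    rw [← hz] at this
    exact Function.Surjective.of_comp (g := lin p₁) this
  exact ⟨mkMorE z hz', morHom (β := mkMorE z hz') p₁ p₂ hz, mor_hom_ext w₁ w₂, c₁, c₂⟩

lemma exists_cmConflation_of_surjective [IsNoetherianRing Rᵐᵒᵖ] {X Y : CM R} (p : X ⟶ Y)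
    (hp : Function.Surjective (lin p)) :
    ∃ (K : CM R) (i : K ⟶ X) (w : i ≫ p = 0), cmConflation R (ShortComplex.mk i p w) := by
  have := X.property.1
  have hS := shortExact_ofHom (LinearMap.ker (lin p)).injective_subtype
    (LinearMap.exact_subtype_ker_map (lin p)) hp
  have hK : isCM R (ModuleCat.of Rᵐᵒᵖ (LinearMap.ker (lin p))) :=
    isCM_of_finite inferInstance (extVanishing_X₁ hS _ X.property.2 Y.property.2)
  exact ⟨⟨_, hK⟩, cmHom (X := ⟨_, hK⟩) (LinearMap.ker (lin p)).subtype,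
    cm_hom_ext fun x => (LinearMap.exact_subtype_ker_map (lin p)).apply_apply_eq_zero x,
    (cmConflation_iff _).2 ⟨(LinearMap.ker (lin p)).injective_subtype,
      LinearMap.exact_subtype_ker_map (lin p), hp⟩⟩

/-- Lift at the target first. The lift at the source must then have prescribed images in S.X₃ and in
the target of S.X₂. Such pairs come from the source of S.X₂, because the arrow of S.X₁ is
surjective, and projectivity of the source of α provides the lift. -/
lemma relProjective_morEConflation_of_projective {α : MorE R}
    (h₁ : Module.Projective Rᵐᵒᵖ ((lf R).obj α).obj)
    (h₂ : Module.Projective Rᵐᵒᵖ ((rf R).obj α).obj) : relProjective (morEConflation R) α := by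
  intro S hS f
  obtain ⟨c₁, c₂⟩ := (morEConflation_iff S).1 hS
  obtain ⟨-, e₂, c₃⟩ := (cmConflation_iff _).1 c₁
  obtain ⟨-, d₂, -⟩ := (cmConflation_iff _).1 c₂
  obtain ⟨b, hb⟩ := relProjective_cmConflation_of_projective h₂ _ c₂ ((rf R).map f)
  change _ ⟶ (rf R).obj S.X₂ at b
  change b ≫ (rf R).map S.g = _ at hb
  let h := (lin ((lf R).map S.g)).prod (lin (arr S.X₂))
  have hf := fun x => lin_eq_of_eq (arr_naturality f) x
  have hg := fun x => lin_eq_of_eq (arr_naturality S.g) x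
  have hi := fun x => lin_eq_of_eq (arr_naturality S.f) x
  have hb' := fun x => lin_eq_of_eq hb x
  simp only [lin_comp_apply] at hf hg hb' hi
  have hmem : ∀ x, (lin ((lf R).map f)).prod (lin (arr α ≫ b)) x ∈ LinearMap.range h := by
    intro x
    obtain ⟨y, hy⟩ := c₃ (lin ((lf R).map f) x)
    change ((lf R).obj S.X₂).obj at y
    change lin ((lf R).map S.g) y = _ at hy
    obtain ⟨t, ht⟩ := (d₂ (lin (arr α ≫ b) x - lin (arr S.X₂) y)).1 (by
      change lin ((rf R).map S.g) _ = 0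
      rw [map_sub, ← hg, hy, hf, lin_comp_apply, hb']
      exact sub_self _)
    obtain ⟨t, rfl⟩ := arr_surjective S.X₁ t
    change lin ((rf R).map S.f) (lin (arr S.X₁) t) = _ at ht
    refine ⟨y + lin ((lf R).map S.f) t, Prod.ext ?_ ?_⟩
    · change lin ((lf R).map S.g) (y + lin ((lf R).map S.f) t) = _
      rw [map_add, hy]
      exact (congrArg _ (e₂.apply_apply_eq_zero t)).trans (add_zero _)
    · change lin (arr S.X₂) (y + lin ((lf R).map S.f) t) = _
      rw [map_add, hi, ht]
      exact add_sub_cancel _ _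
  obtain ⟨a, ha⟩ := Module.projective_lifting_property h.rangeRestrict
    (LinearMap.codRestrict _ _ hmem) h.surjective_rangeRestrict
  have ha' := fun x => congrArg Subtype.val (LinearMap.congr_fun ha x)
  refine ⟨morHom (cmHom a) b (cm_hom_ext fun x => congrArg Prod.snd (ha' x)), mor_hom_ext ?_ ?_⟩
  · exact cm_hom_ext fun x => congrArg Prod.fst (ha' x)
  · rw [Functor.map_comp, rf_map_morHom, hb]

lemma projective_of_retract {X Y : CM R} (s : X ⟶ Y) (p : Y ⟶ X) (h : s ≫ p = 𝟙 X)
    (hY : Module.Projective Rᵐᵒᵖ Y.obj) : Module.Projective Rᵐᵒᵖ X.obj :=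
  Module.Projective.of_split (lin s) (lin p) (LinearMap.ext (lin_eq_of_eq h))

instance projective_biprod [IsNoetherianRing Rᵐᵒᵖ] (P Q : CM R) [hP : Module.Projective Rᵐᵒᵖ P.obj]
    [hQ : Module.Projective Rᵐᵒᵖ Q.obj] : Module.Projective Rᵐᵒᵖ (P ⊞ Q).obj :=
  projective_of_relProjective (relProjective_biprod (relProjective_cmConflation_of_projective hP)
    (relProjective_cmConflation_of_projective hQ))

lemma surjective_of_section {X Y : CM R} {s : X ⟶ Y} {p : Y ⟶ X} (h : s ≫ p = 𝟙 X) :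
    Function.Surjective (lin p) := fun x => ⟨lin s x, lin_eq_of_eq h x⟩

/-- Covering the source of α alone need not leave a surjection as kernel. The extra summand R^m
covers the kernel of the arrow and repairs this. -/
lemma exists_projective_morEConflation [IsNoetherianRing Rᵐᵒᵖ] (α : MorE R) :
    ∃ (β γ : MorE R) (i : γ ⟶ β) (p : β ⟶ α) (w : i ≫ p = 0),
      morEConflation R (ShortComplex.mk i p w) ∧
      Module.Projective Rᵐᵒᵖ ((lf R).obj β).obj ∧ Module.Projective Rᵐᵒᵖ ((rf R).obj β).obj := by
  obtain ⟨K, i, w, hK⟩ := exists_cmConflation_of_surjective (arr α) (arr_surjective α)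
  obtain ⟨n, _, _, p, _, hp⟩ := exists_free_conflation ((lf R).obj α)
  obtain ⟨m, _, _, q, _, hq⟩ := exists_free_conflation K
  replace hp : Function.Surjective (lin p) := ((cmConflation_iff _).1 hp).2.2
  replace hq : Function.Surjective (lin q) := ((cmConflation_iff _).1 hq).2.2
  let β : MorE R := mkMorE (biprod.fst : free R n ⊞ free R m ⟶ free R n)
    (surjective_of_section biprod.inl_fst)
  let π : β ⟶ α := morHom (α := β) (biprod.desc p (q ≫ i)) (p ≫ arr α) (by
    change biprod.desc p (q ≫ i) ≫ arr α = biprod.fst ≫ p ≫ arr α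
    apply biprod.hom_ext'
    · simp
    · simp [w])
  have hπ₁ : Function.Surjective (lin ((lf R).map π)) := by
    have : Function.Surjective (lin (biprod.inl ≫ biprod.desc p (q ≫ i))) := by
      rw [biprod.inl_desc]; exact hp
    exact Function.Surjective.of_comp (g := lin (biprod.inl : free R n ⟶ free R n ⊞ free R m)) this
  have hπ₂ : Function.Surjective (lin ((rf R).map π)) := (arr_surjective α).comp hp
  obtain ⟨K₁, k₁, w₁, h₁⟩ := exists_cmConflation_of_surjective _ hπ₁
  obtain ⟨K₂, k₂, w₂, h₂⟩ := exists_cmConflation_of_surjective _ hπ₂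
  obtain ⟨k, hk⟩ := cm_exists_lift h₂ (k₁ ≫ arr β) (by
    change (k₁ ≫ arr β) ≫ (rf R).map π = 0
    rw [Category.assoc, ← arr_naturality, reassoc_of% w₁, zero_comp])
  dsimp at hk
  -- For `x` in the kernel at the target, p(x) lies in the kernel of the arrow, hence equals i(q(y))
  -- for some `y`. The pair (x, -y) is a preimage.
  have hk' : Function.Surjective (lin k) := by
    intro x
    have hx : lin (arr α) (lin p (lin k₂ x)) = 0 := lin_eq_of_eq w₂ x
    obtain ⟨y, hy⟩ := (((cmConflation_iff _).1 hK).2.1 _).1 hx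
    obtain ⟨y, rfl⟩ := hq y
    change lin i (lin q y) = lin p (lin k₂ x) at hy
    have hz : lin ((lf R).map π) (lin (biprod.inl : free R n ⟶ free R n ⊞ free R m) (lin k₂ x) -
        lin (biprod.inr : free R m ⟶ free R n ⊞ free R m) y) = 0 := by
      have e₁ := lin_eq_of_eq (biprod.inl_desc p (q ≫ i)) (lin k₂ x)
      have e₂ := lin_eq_of_eq (biprod.inr_desc p (q ≫ i)) y
      simp only [lin_comp_apply] at e₁ e₂
      rw [hy] at e₂
      refine (map_sub _ _ _).trans ?_
      exact sub_eq_zero.2 (e₁.trans e₂.symm)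
    obtain ⟨t, ht⟩ := (((cmConflation_iff _).1 h₁).2.1 _).1 hz
    refine ⟨t, ((cmConflation_iff _).1 h₂).1 ?_⟩
    have e₁ := lin_eq_of_eq (biprod.inl_fst (X := free R n) (Y := free R m)) (lin k₂ x)
    have e₂ := lin_eq_of_eq (biprod.inr_fst (X := free R n) (Y := free R m)) y
    simp only [lin_comp_apply] at e₁ e₂
    refine (lin_eq_of_eq hk t).trans ?_
    rw [lin_comp_apply]
    refine (congrArg _ ht).trans ?_
    change lin (biprod.fst : free R n ⊞ free R m ⟶ free R n) _ = lin k₂ x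
    exact (map_sub _ _ _).trans ((congrArg₂ (· - ·) e₁ e₂).trans (sub_zero _))
  exact ⟨β, mkMorE k hk', morHom (α := mkMorE k hk') k₁ k₂ hk.symm, π, mor_hom_ext w₁ w₂,
    ⟨h₁, h₂⟩, projective_biprod _ _, inferInstanceAs (Module.Projective Rᵐᵒᵖ (free R n).obj)⟩

lemma relProjective_morEConflation_iff [IsNoetherianRing Rᵐᵒᵖ] (α : MorE R) :
    relProjective (morEConflation R) α ↔ Module.Projective Rᵐᵒᵖ ((lf R).obj α).obj ∧
      Module.Projective Rᵐᵒᵖ ((rf R).obj α).obj := by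
  refine ⟨fun h => ?_, fun h => relProjective_morEConflation_of_projective h.1 h.2⟩
  obtain ⟨β, γ, i, p, w, hc, h₁, h₂⟩ := exists_projective_morEConflation α
  obtain ⟨s, hs⟩ := h _ hc (𝟙 α)
  dsimp at s hs
  constructor
  · exact projective_of_retract ((lf R).map s) ((lf R).map p) (by
      rw [← Functor.map_comp, hs, CategoryTheory.Functor.map_id]) h₁
  · exact projective_of_retract ((rf R).map s) ((rf R).map p) (by
      rw [← Functor.map_comp, hs, CategoryTheory.Functor.map_id]) h₂

/-- Extend at sources and targets separately. The failure to commute is absorbed by a section of the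
arrow of α, which exists as its target is projective; the correction vanishes on S.X₁. -/
lemma mor_exists_extension [IsNoetherianRing Rᵐᵒᵖ] {S : ShortComplex (MorE R)}
    (hS : morEConflation R S) {α : MorE R} (h₁ : Module.Projective Rᵐᵒᵖ ((lf R).obj α).obj)
    (h₂ : Module.Projective Rᵐᵒᵖ ((rf R).obj α).obj) (f : S.X₁ ⟶ α) :
    ∃ g : S.X₂ ⟶ α, S.f ≫ g = f := by
  obtain ⟨b, hb⟩ := exists_extension_of_isInflation (isInflation_of_cmConflation (cmConflation_map_rf hS)) h₂
    ((rf R).map f)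
  obtain ⟨a, ha⟩ := exists_extension_of_isInflation (isInflation_of_cmConflation (cmConflation_map_lf hS)) h₁
    ((lf R).map f)
  obtain ⟨s, hs⟩ := Module.projective_lifting_property (lin (arr α)) LinearMap.id (arr_surjective α)
  let s' : (rf R).obj α ⟶ (lf R).obj α := cmHom s
  have hs' : s' ≫ arr α = 𝟙 _ := cm_hom_ext fun x => LinearMap.congr_fun hs x
  change (rf R).obj S.X₂ ⟶ _ at b
  change (lf R).obj S.X₂ ⟶ _ at a
  change (rf R).map S.f ≫ b = _ at hb
  change (lf R).map S.f ≫ a = _ at ha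
  refine ⟨morHom (a + (arr S.X₂ ≫ b - a ≫ arr α) ≫ s') b ?_, mor_hom_ext ?_ ?_⟩
  · rw [Preadditive.add_comp, Category.assoc, hs', Category.comp_id]
    exact add_sub_cancel _ _
  · rw [Functor.map_comp, lf_map_morHom, Preadditive.comp_add, ha, ← Category.assoc,
      Preadditive.comp_sub, reassoc_of% (arr_naturality S.f), hb, reassoc_of% ha,
      arr_naturality f]
    simp
  · rw [Functor.map_comp, rf_map_morHom, hb]

/-- The category of surjective maps of Cohen-Macaulay modules is a Frobenius category. -/
theorem isFrobenius_morEConflation (hR : IsIwanagaGorenstein R) :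
    IsFrobenius (morEConflation R) := by
  have := hR.right_noetherian
  exact {
    mono_f := mor_mono_f
    epi_g := mor_epi_g
    exists_lift := fun hS _ t ht => mor_exists_lift hS t ht
    exists_desc := fun hS _ t ht => mor_exists_desc hS t ht
    exists_biprod := fun {S} hS Y u => by
      apply exists_morEConflation
      · apply IsInflation.of_comp (g := (lf R).map biprod.fst)
        rw [← Functor.map_comp, biprod.lift_fst]
        exact isInflation_of_cmConflation (cmConflation_map_lf hS)
      · apply IsInflation.of_comp (g := (rf R).map biprod.fst)
        rw [← Functor.map_comp, biprod.lift_fst]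
        exact isInflation_of_cmConflation (cmConflation_map_rf hS)
    exists_comp := fun {X₁ X₂ X₃ Z₁₂ Z₂₃ f₁₂ g₁₂ w₁₂ f₂₃ g₂₃ w₂₃} h₁₂ h₂₃ => by
      obtain ⟨Z₁₃, g₁₃, w₁₃, h₁₃⟩ := exists_morEConflation (f := f₁₂ ≫ f₂₃)
        ((isInflation_of_cmConflation (cmConflation_map_lf h₁₂)).comp (isInflation_of_cmConflation (cmConflation_map_lf h₂₃)))
        ((isInflation_of_cmConflation (cmConflation_map_rf h₁₂)).comp (isInflation_of_cmConflation (cmConflation_map_rf h₂₃)))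
      obtain ⟨m₁, hm₁⟩ := mor_exists_desc h₁₂ (f₂₃ ≫ g₁₃) ((Category.assoc _ _ _).symm.trans w₁₃)
      obtain ⟨m₃, hm₃⟩ := mor_exists_desc h₁₃ g₂₃ (by
        change (f₁₂ ≫ f₂₃) ≫ g₂₃ = 0
        rw [Category.assoc, w₂₃, comp_zero])
      dsimp only at hm₁ hm₃
      have : Epi g₁₂ := mor_epi_g h₁₂
      have w : m₁ ≫ m₃ = 0 := by
        rw [← cancel_epi g₁₂, reassoc_of% hm₁, hm₃, w₂₃, comp_zero]
      refine ⟨Z₁₃, g₁₃, w₁₃, m₁, m₃, w, h₁₃, ⟨?_, ?_⟩, hm₁, hm₃⟩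
      · exact cmConflation_of_comp ((ShortComplex.mk m₁ m₃ w).map (lf R)).zero (cmConflation_map_lf h₁₂) (cmConflation_map_lf h₂₃) (cmConflation_map_lf h₁₃)
          (congrArg (lf R).map hm₁) (congrArg (lf R).map hm₃)
      · exact cmConflation_of_comp ((ShortComplex.mk m₁ m₃ w).map (rf R)).zero (cmConflation_map_rf h₁₂) (cmConflation_map_rf h₂₃) (cmConflation_map_rf h₁₃)
          (congrArg (rf R).map hm₁) (congrArg (rf R).map hm₃)
    isPushout_of_isIso := fun {S S'} hS hS' φ hφ => by
      let φ₁ := (lf R).mapShortComplex.map φ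
      let φ₂ := (rf R).mapShortComplex.map φ
      have hφ₁ : IsIso φ₁.τ₃ := inferInstanceAs (IsIso ((lf R).map φ.τ₃))
      have hφ₂ : IsIso φ₂.τ₃ := inferInstanceAs (IsIso ((rf R).map φ.τ₃))
      refine isPushout_of_exists_desc φ.comm₁₂.symm (fun T a b hab => ?_)
        (fun T t h₁ h₂ => ?_)
      · obtain ⟨t₁, ha₁, hb₁⟩ := cm_exists_pushout_desc (cmConflation_map_lf hS) (cmConflation_map_lf hS') φ₁ hφ₁ ((lf R).map a)
          ((lf R).map b) (congrArg (lf R).map hab)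
        obtain ⟨t₂, ha₂, hb₂⟩ := cm_exists_pushout_desc (cmConflation_map_rf hS) (cmConflation_map_rf hS') φ₂ hφ₂ ((rf R).map a)
          ((rf R).map b) (congrArg (rf R).map hab)
        change (lf R).obj S'.X₂ ⟶ _ at t₁
        change (rf R).obj S'.X₂ ⟶ _ at t₂
        change (lf R).map φ.τ₂ ≫ t₁ = _ at ha₁
        change (rf R).map φ.τ₂ ≫ t₂ = _ at ha₂
        change (lf R).map S'.f ≫ t₁ = _ at hb₁
        change (rf R).map S'.f ≫ t₂ = _ at hb₂
        -- The two componentwise factorizations are compatible by uniqueness in the pushout at the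
        -- sources.
        have ht : t₁ ≫ arr T = arr S'.X₂ ≫ t₂ := by
          rw [← sub_eq_zero]
          refine cm_eq_zero_of_pushout (cmConflation_map_lf hS) (cmConflation_map_lf hS') φ₁ hφ₁ _ ?_ ?_
          · change (lf R).map φ.τ₂ ≫ _ = 0
            rw [Preadditive.comp_sub, reassoc_of% ha₁, reassoc_of% (arr_naturality φ.τ₂), ha₂,
              arr_naturality, sub_self]
          · change (lf R).map S'.f ≫ _ = 0
            rw [Preadditive.comp_sub, reassoc_of% hb₁, reassoc_of% (arr_naturality S'.f), hb₂,
              arr_naturality, sub_self]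
        exact ⟨morHom t₁ t₂ ht, mor_hom_ext ha₁ ha₂, mor_hom_ext hb₁ hb₂⟩
      · refine mor_hom_ext ?_ ?_
        · refine (cm_eq_zero_of_pushout (cmConflation_map_lf hS) (cmConflation_map_lf hS') φ₁ hφ₁ ((lf R).map t) ?_ ?_).trans
            ((lf R).map_zero _ _).symm
          · exact congrArg (lf R).map h₁
          · exact congrArg (lf R).map h₂
        · refine (cm_eq_zero_of_pushout (cmConflation_map_rf hS) (cmConflation_map_rf hS') φ₂ hφ₂ ((rf R).map t) ?_ ?_).trans
            ((rf R).map_zero _ _).symm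
          · exact congrArg (rf R).map h₁
          · exact congrArg (rf R).map h₂
    enough_injectives := fun α => by
      obtain ⟨n, f, hf⟩ := exists_inflation_free hR ((lf R).obj α)
      obtain ⟨m, g, hg⟩ := exists_inflation_free hR ((rf R).obj α)
      -- The summand R^n makes the map injective on the source; the summand R^m carries the
      -- composite with the embedding of the target, so that the square commutes.
      let β : MorE R := mkMorE (biprod.snd : free R n ⊞ free R m ⟶ free R m)
        (surjective_of_section biprod.inr_snd)
      let i : α ⟶ β := morHom (β := β) (biprod.lift f (arr α ≫ g)) g (biprod.lift_snd _ _)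
      obtain ⟨γ, p, w, h⟩ := exists_morEConflation (f := i)
        (IsInflation.of_comp (g := biprod.fst) (by
          change IsInflation (biprod.lift f (arr α ≫ g) ≫ biprod.fst)
          rw [biprod.lift_fst]; exact hf)) hg
      exact ⟨β, γ, i, p, w, h, relProjective_morEConflation_of_projective (projective_biprod _ _)
        (inferInstanceAs (Module.Projective Rᵐᵒᵖ (free R m).obj))⟩
    enough_projectives := fun α => by
      obtain ⟨β, γ, i, p, w, hc, h₁, h₂⟩ := exists_projective_morEConflation α
      exact ⟨β, γ, i, p, w, hc, relProjective_morEConflation_of_projective h₁ h₂⟩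
    relInjective_of_relProjective := fun hX S hS f =>
      mor_exists_extension hS ((relProjective_morEConflation_iff _).1 hX).1
        ((relProjective_morEConflation_iff _).1 hX).2 f }

end MorE

end Gorenstein

/-! ### Orthogonal decompositions, adjoints and recollements -/

namespace Recoll

section Adjoints

variable {C D : Type*} [Category C] [Category D]

lemma isRightAdjoint_of_bijective (F : C ⥤ D)
    (h : ∀ X : D, ∃ (A : C) (u : X ⟶ F.obj A),
      ∀ Y : C, Function.Bijective fun f : A ⟶ Y => u ≫ F.map f) : F.IsRightAdjoint := by
  choose A u hu using h
  exact (Adjunction.adjunctionOfEquivLeft (G := F) (F_obj := A)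
    (fun X Y => Equiv.ofBijective _ (hu X Y))
    (fun X Y Y' g f => by simp)).isRightAdjoint

lemma isLeftAdjoint_of_bijective (F : C ⥤ D)
    (h : ∀ X : D, ∃ (A : C) (u : F.obj A ⟶ X),
      ∀ Y : C, Function.Bijective fun f : Y ⟶ A => F.map f ≫ u) : F.IsLeftAdjoint := by
  choose A u hu using h
  exact (Adjunction.adjunctionOfEquivRight (F := F) (G_obj := A)
    (fun Y X => (Equiv.ofBijective _ (hu X Y)).symm)
    (fun Y' Y X f g => by
      rw [Equiv.symm_apply_eq]
      have := (Equiv.ofBijective _ (hu X Y)).apply_symm_apply g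
      simp only [Equiv.ofBijective_apply] at this ⊢
      rw [Functor.map_comp, Category.assoc, this])).isLeftAdjoint

end Adjoints

section

variable {D : Type*} [Category D] [HasZeroObject D] [HasShift D ℤ] [Preadditive D]
  [∀ n : ℤ, (shiftFunctor D n).Additive] [Pretriangulated D]

/-- Every object is an extension of an object of `V` by an object of `U`. -/
def HasTriangles (U V : ObjectProperty D) : Prop :=
  ∀ X : D, ∃ (A B : D) (_ : U A) (_ : V B)
    (f : A ⟶ X) (g : X ⟶ B) (h : B ⟶ A⟦(1 : ℤ)⟧), Triangle.mk f g h ∈ distTriang D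

lemma isZero_of_leftOrthogonal {V : ObjectProperty D} {X : D} (h : V X)
    (h' : V.leftOrthogonal X) : IsZero X :=
  (IsZero.iff_id_eq_zero X).2 (h' _ h)

/-- Decompose an object of the left orthogonal of `V`. The `V`-part is again left orthogonal to `V`,
hence orthogonal to itself and zero, so the object is its own `U`-part. -/
lemma eq_leftOrthogonal {U V : ObjectProperty D} [U.IsClosedUnderIsomorphisms]
    [V.IsStableUnderShift ℤ] (h₀ : ∀ ⦃X Y : D⦄, U X → V Y → ∀ f : X ⟶ Y, f = 0)
    (h : HasTriangles U V) : U = V.leftOrthogonal := by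
  ext X
  refine ⟨fun hX Y f hY => h₀ hX hY f, fun hX => ?_⟩
  obtain ⟨A, B, hA, hB, f, g, k, hT⟩ := h X
  have hA' : V.leftOrthogonal A := fun Y f hY => h₀ hA hY f
  have hB' : V.leftOrthogonal B := ObjectProperty.ext_of_isTriangulatedClosed₃ _ _ hT hA' hX
  have : IsIso f := (Triangle.isZero₃_iff_isIso₁ _ hT).1 (isZero_of_leftOrthogonal hB hB')
  exact U.prop_of_iso (asIso f) hA

lemma eq_rightOrthogonal {U V : ObjectProperty D} [V.IsClosedUnderIsomorphisms]
    [U.IsStableUnderShift ℤ] (h₀ : ∀ ⦃X Y : D⦄, U X → V Y → ∀ f : X ⟶ Y, f = 0)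
    (h : HasTriangles U V) : V = U.rightOrthogonal := by
  ext X
  refine ⟨fun hX Y f hY => h₀ hY hX f, fun hX => ?_⟩
  obtain ⟨A, B, hA, hB, f, g, k, hT⟩ := h X
  have hB' : U.rightOrthogonal B := fun Y f hY => h₀ hY hB f
  have hA' : U.rightOrthogonal A := ObjectProperty.ext_of_isTriangulatedClosed₁ _ _ hT hX hB'
  have : IsIso g := (Triangle.isZero₁_iff_isIso₂ _ hT).1
    ((IsZero.iff_id_eq_zero A).2 (hA' _ hA))
  exact V.prop_of_iso (asIso g).symm hB

lemma isStableTStructure {U V : ObjectProperty D} [U.IsClosedUnderIsomorphisms]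
    [V.IsClosedUnderIsomorphisms] [U.IsStableUnderShift ℤ] [V.IsStableUnderShift ℤ]
    (h₀ : ∀ ⦃X Y : D⦄, U X → V Y → ∀ f : X ⟶ Y, f = 0)
    (h : HasTriangles U V) : IsStableTStructure U V where
  shift_left X := U.prop_shift_iff_of_isStableUnderShift X 1
  shift_right X := V.prop_shift_iff_of_isStableUnderShift X 1
  hom_eq_zero := h₀
  exists_triangle := h

section Inclusion

variable {V : ObjectProperty D} [V.IsTriangulated]

/-- The `V`-part of the decomposition is the reflection. Existence of factorizations uses that the
other part has no maps to `V`, uniqueness that its translation has none. -/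
lemma isRightAdjoint_ι (h : HasTriangles V.leftOrthogonal V) : V.ι.IsRightAdjoint := by
  refine isRightAdjoint_of_bijective _ fun X => ?_
  obtain ⟨A, B, hA, hB, f, g, k, hT⟩ := h X
  refine ⟨⟨B, hB⟩, g, fun Y => ⟨fun a b hab => ?_, fun a => ?_⟩⟩
  · replace hab : g ≫ (a.hom - b.hom) = 0 := by
      rw [Preadditive.comp_sub, sub_eq_zero]
      exact hab
    obtain ⟨c, hc⟩ := Triangle.yoneda_exact₃ _ hT _ hab
    have hc' : c = 0 := (V.leftOrthogonal.le_shift (1 : ℤ) A hA) c Y.property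
    apply ObjectProperty.hom_ext
    rw [← sub_eq_zero, hc, hc', comp_zero]
    rfl
  · obtain ⟨b, hb⟩ := Triangle.yoneda_exact₂ _ hT a (hA _ Y.property)
    exact ⟨ObjectProperty.homMk b, hb.symm⟩

lemma isLeftAdjoint_ι (h : HasTriangles V V.rightOrthogonal) : V.ι.IsLeftAdjoint := by
  refine isLeftAdjoint_of_bijective _ fun X => ?_
  obtain ⟨A, B, hA, hB, f, g, k, hT⟩ := h X
  refine ⟨⟨A, hA⟩, f, fun Y => ⟨fun a b hab => ?_, fun a => ?_⟩⟩
  · replace hab : (a.hom - b.hom) ≫ f = 0 := by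
      rw [Preadditive.sub_comp, sub_eq_zero]
      exact hab
    obtain ⟨c, hc⟩ := Triangle.coyoneda_exact₂ _ (inv_rot_of_distTriang _ hT) _ hab
    have hc' : c = 0 := (V.rightOrthogonal.le_shift (-1 : ℤ) B hB) c Y.property
    apply ObjectProperty.hom_ext
    rw [← sub_eq_zero, hc, hc', zero_comp]
    rfl
  · obtain ⟨b, hb⟩ := Triangle.coyoneda_exact₂ _ hT a (hB _ Y.property)
    exact ⟨ObjectProperty.homMk b, hb.symm⟩

lemma kernel_leftAdjoint_ι {F : D ⥤ V.FullSubcategory} (adj : F ⊣ V.ι) :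
    F.kernel = V.leftOrthogonal := by
  ext X
  constructor
  · intro hX Y f hY
    obtain ⟨g, rfl⟩ := (adj.homEquiv X ⟨Y, hY⟩).surjective f
    have : g = 0 := IsZero.eq_of_src hX _ _
    rw [this, Adjunction.homEquiv_unit, Functor.map_zero, comp_zero]
  · intro hX
    refine (IsZero.iff_id_eq_zero (F.obj X)).2 ((adj.homEquiv X (F.obj X)).injective ?_)
    exact (hX _ (F.obj X).property).trans (hX _ (F.obj X).property).symm

lemma kernel_rightAdjoint_ι {F : D ⥤ V.FullSubcategory} (adj : V.ι ⊣ F) :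
    F.kernel = V.rightOrthogonal := by
  ext X
  constructor
  · intro hX Y f hY
    obtain ⟨g, rfl⟩ := (adj.homEquiv ⟨Y, hY⟩ X).symm.surjective f
    have : g = 0 := IsZero.eq_of_tgt hX _ _
    rw [this, Adjunction.homEquiv_counit, Functor.map_zero, zero_comp]
  · intro hX
    refine (IsZero.iff_id_eq_zero (F.obj X)).2 ((adj.homEquiv (F.obj X) X).symm.injective ?_)
    exact (hX _ (F.obj X).property).trans (hX _ (F.obj X).property).symm

lemma essImage_ι [V.IsClosedUnderIsomorphisms] : V.ι.essImage = V := by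
  ext X
  constructor
  · rintro ⟨Y, ⟨e⟩⟩
    exact V.prop_of_iso e Y.property
  · intro hX
    exact ⟨⟨X, hX⟩, ⟨Iso.refl _⟩⟩

end Inclusion

section Quotient

variable [IsTriangulated D] {V : ObjectProperty D} [V.IsTriangulated]

lemma isZero_Q_obj {X : D} (hX : V X) : IsZero (V.trW.Q.obj X) := by
  have h := Localization.inverts V.trW.Q V.trW _
    (ObjectProperty.trW.mk V (contractible_distinguished₁ X) hX)
  have h' : IsZero (V.trW.Q.obj 0) := Functor.map_isZero _ (isZero_zero D)
  exact h'.of_iso (@asIso _ _ _ _ _ h).symm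

/-- The map from the left orthogonal part to the object becomes invertible in the quotient, and maps
out of a left orthogonal object are the same before and after localization. -/
lemma isRightAdjoint_Q (h : HasTriangles V.leftOrthogonal V) : V.trW.Q.IsRightAdjoint := by
  refine isRightAdjoint_of_bijective _ fun Z => ?_
  obtain ⟨A, B, hA, hB, f, g, k, hT⟩ := h (V.trW.Q.objPreimage Z)
  have hf : IsIso (V.trW.Q.map f) := Localization.inverts V.trW.Q V.trW f
    (ObjectProperty.trW.mk V hT hB)
  let e : V.trW.Q.obj A ≅ Z := asIso (V.trW.Q.map f) ≪≫ V.trW.Q.objObjPreimageIso Z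
  refine ⟨A, e.inv, fun Y => ?_⟩
  have h₁ : Function.Bijective fun a : V.trW.Q.obj A ⟶ V.trW.Q.obj Y => e.inv ≫ a :=
    ⟨fun a b hab => (cancel_epi e.inv).1 hab, fun a => ⟨e.hom ≫ a, by simp⟩⟩
  exact h₁.comp (hA.map_bijective_of_isTriangulated V.trW.Q Y)

lemma isLeftAdjoint_Q (h : HasTriangles V V.rightOrthogonal) : V.trW.Q.IsLeftAdjoint := by
  refine isLeftAdjoint_of_bijective _ fun Z => ?_
  obtain ⟨A, B, hA, hB, f, g, k, hT⟩ := h (V.trW.Q.objPreimage Z)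
  have hg : IsIso (V.trW.Q.map g) := Localization.inverts V.trW.Q V.trW g
    (ObjectProperty.trW.mk' V hT hA)
  let e : V.trW.Q.obj B ≅ Z := (asIso (V.trW.Q.map g)).symm ≪≫ V.trW.Q.objObjPreimageIso Z
  refine ⟨B, e.hom, fun Y => ?_⟩
  have h₁ : Function.Bijective fun a : V.trW.Q.obj Y ⟶ V.trW.Q.obj B => a ≫ e.hom :=
    ⟨fun a b hab => (cancel_mono e.hom).1 hab, fun a => ⟨a ≫ e.inv, by simp⟩⟩
  exact h₁.comp (hB.map_bijective_of_isTriangulated V.trW.Q Y)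

lemma leftOrthogonal_leftAdjoint_Q {F : V.trW.Localization ⥤ D} (adj : F ⊣ V.trW.Q)
    (Z : V.trW.Localization) : V.leftOrthogonal (F.obj Z) := by
  intro Y f hY
  apply (adj.homEquiv Z Y).injective
  exact (isZero_Q_obj hY).eq_of_tgt _ _

lemma rightOrthogonal_rightAdjoint_Q {F : V.trW.Localization ⥤ D} (adj : V.trW.Q ⊣ F)
    (Z : V.trW.Localization) : V.rightOrthogonal (F.obj Z) := by
  intro Y f hY
  apply (adj.homEquiv Y Z).symm.injective
  exact (isZero_Q_obj hY).eq_of_src _ _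

/-- By Yoneda: maps out of `F.obj Z` are computed both by the adjunction and by the quotient
functor. Invertibility of the unit makes the left adjoint fully faithful. -/
lemma isIso_unit_Q {F : V.trW.Localization ⥤ D} (adj : F ⊣ V.trW.Q) : IsIso adj.unit := by
  have : ∀ Z, IsIso (adj.unit.app Z) := by
    intro Z
    refine isIso_of_coyoneda_map_bijective _ fun T => ?_
    let e := V.trW.Q.objObjPreimageIso T
    have h₁ := (leftOrthogonal_leftAdjoint_Q adj Z).map_bijective_of_isTriangulated V.trW.Q
      (V.trW.Q.objPreimage T)
    have h₂ := (adj.homEquiv Z (V.trW.Q.objPreimage T)).bijective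
    have h₃ : Function.Bijective fun x : V.trW.Q.obj (F.obj Z) ⟶ V.trW.Q.obj (V.trW.Q.objPreimage T) =>
        adj.unit.app Z ≫ x := by
      refine (Function.Bijective.of_comp_iff _ h₁).1 ?_
      refine Eq.mp (congrArg Function.Bijective (funext fun f => ?_)) h₂
      exact adj.homEquiv_unit Z _ f
    refine ⟨fun a b hab => ?_, fun a => ?_⟩
    · rw [← cancel_mono e.inv]
      apply h₃.1
      change adj.unit.app Z ≫ a ≫ e.inv = adj.unit.app Z ≫ b ≫ e.inv
      rw [← Category.assoc, ← Category.assoc]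
      exact congrArg (· ≫ e.inv) hab
    · obtain ⟨b, hb⟩ := h₃.2 (a ≫ e.inv)
      refine ⟨b ≫ e.hom, ?_⟩
      change adj.unit.app Z ≫ b = a ≫ e.inv at hb
      change adj.unit.app Z ≫ b ≫ e.hom = a
      rw [reassoc_of% hb, e.inv_hom_id, Category.comp_id]
  exact NatIso.isIso_of_isIso_app _

lemma isIso_counit_Q {F : V.trW.Localization ⥤ D} (adj : V.trW.Q ⊣ F) : IsIso adj.counit := by
  have : ∀ Z, IsIso (adj.counit.app Z) := by
    intro Z
    refine isIso_of_yoneda_map_bijective _ fun T => ?_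
    let e := V.trW.Q.objObjPreimageIso T
    have h₁ := (rightOrthogonal_rightAdjoint_Q adj Z).map_bijective_of_isTriangulated V.trW.Q
      (V.trW.Q.objPreimage T)
    have h₂ := (adj.homEquiv (V.trW.Q.objPreimage T) Z).symm.bijective
    have h₃ : Function.Bijective fun x : V.trW.Q.obj (V.trW.Q.objPreimage T) ⟶ V.trW.Q.obj (F.obj Z) =>
        x ≫ adj.counit.app Z := by
      refine (Function.Bijective.of_comp_iff _ h₁).1 ?_
      refine Eq.mp (congrArg Function.Bijective (funext fun f => ?_)) h₂
      exact adj.homEquiv_counit _ Z f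
    refine ⟨fun a b hab => ?_, fun a => ?_⟩
    · rw [← cancel_epi e.hom]
      apply h₃.1
      change (e.hom ≫ a) ≫ adj.counit.app Z = (e.hom ≫ b) ≫ adj.counit.app Z
      rw [Category.assoc, Category.assoc]
      exact congrArg (e.hom ≫ ·) hab
    · obtain ⟨b, hb⟩ := h₃.2 (e.hom ≫ a)
      refine ⟨e.inv ≫ b, ?_⟩
      change b ≫ adj.counit.app Z = e.hom ≫ a at hb
      change (e.inv ≫ b) ≫ adj.counit.app Z = a
      rw [Category.assoc, hb, e.inv_hom_id_assoc]
  exact NatIso.isIso_of_isIso_app _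

lemma essImage_leftAdjoint_Q {F : V.trW.Localization ⥤ D} (adj : F ⊣ V.trW.Q) :
    F.essImage = V.leftOrthogonal := by
  ext X
  constructor
  · rintro ⟨Z, ⟨e⟩⟩
    exact V.leftOrthogonal.prop_of_iso e (leftOrthogonal_leftAdjoint_Q adj Z)
  · intro hX
    have : IsIso (adj.counit.app X) := by
      refine isIso_of_coyoneda_map_bijective _ fun T => ?_
      have h₁ := hX.map_bijective_of_isTriangulated V.trW.Q T
      have h₂ := (adj.homEquiv (V.trW.Q.obj X) T).symm.bijective.comp h₁
      refine Eq.mp (congrArg Function.Bijective (funext fun f => ?_)) h₂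
      simp [Adjunction.homEquiv_counit]
    exact ⟨_, ⟨asIso (adj.counit.app X)⟩⟩

lemma essImage_rightAdjoint_Q {F : V.trW.Localization ⥤ D} (adj : V.trW.Q ⊣ F) :
    F.essImage = V.rightOrthogonal := by
  ext X
  constructor
  · rintro ⟨Z, ⟨e⟩⟩
    exact V.rightOrthogonal.prop_of_iso e (rightOrthogonal_rightAdjoint_Q adj Z)
  · intro hX
    have : IsIso (adj.unit.app X) := by
      refine isIso_of_yoneda_map_bijective _ fun T => ?_
      have h₁ := hX.map_bijective_of_isTriangulated V.trW.Q T
      have h₂ := (adj.homEquiv T (V.trW.Q.obj X)).bijective.comp h₁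
      refine Eq.mp (congrArg Function.Bijective (funext fun f => ?_)) h₂
      simp [Adjunction.homEquiv_unit]
    exact ⟨_, ⟨(asIso (adj.unit.app X)).symm⟩⟩

/-- If the quotient kills `X`, it kills the left orthogonal part too, whose endomorphisms it
preserves; that part is therefore zero and `X` is its own `V`-part. -/
lemma kernel_Q [V.IsClosedUnderIsomorphisms] (h : HasTriangles V.leftOrthogonal V) :
    V.trW.Q.kernel = V := by
  ext X
  refine ⟨fun hX => ?_, isZero_Q_obj⟩
  obtain ⟨A, B, hA, hB, f, g, k, hT⟩ := h X
  have hf : f = 0 := by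
    apply (hA.map_bijective_of_isTriangulated V.trW.Q X).1
    exact IsZero.eq_of_tgt hX _ _
  have hA' : IsZero A := by
    rw [IsZero.iff_id_eq_zero]
    apply (hA.map_bijective_of_isTriangulated V.trW.Q A).1
    have : IsIso (V.trW.Q.map f) := Localization.inverts V.trW.Q V.trW f
      (ObjectProperty.trW.mk V hT hB)
    exact (IsZero.of_iso hX (asIso (V.trW.Q.map f))).eq_of_tgt _ _
  have : IsIso g := (Triangle.isZero₁_iff_isIso₂ _ hT).1 hA'
  exact V.prop_of_iso (asIso g).symm hB

/-- A triangulated subcategory with both orthogonal decompositions gives a recollement. -/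
theorem exists_recollement [V.IsClosedUnderIsomorphisms] (hl : HasTriangles V.leftOrthogonal V)
    (hr : HasTriangles V V.rightOrthogonal) :
    ∃ r : Recollement V.ι V.trW.Q,
      r.jShriek.essImage = V.leftOrthogonal ∧ r.jStar.essImage = V.rightOrthogonal := by
  have := isRightAdjoint_ι hl
  have := isLeftAdjoint_ι hr
  have := isRightAdjoint_Q hl
  have := isLeftAdjoint_Q hr
  let a₁ := Adjunction.ofIsRightAdjoint V.ι
  let a₂ := Adjunction.ofIsLeftAdjoint V.ι
  let a₃ := Adjunction.ofIsRightAdjoint V.trW.Q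
  let a₄ := Adjunction.ofIsLeftAdjoint V.trW.Q
  letI := a₁.leftAdjointCommShift ℤ
  letI := a₂.rightAdjointCommShift ℤ
  letI := a₃.leftAdjointCommShift ℤ
  letI := a₄.rightAdjointCommShift ℤ
  have := a₁.commShift_of_rightAdjoint ℤ
  have := a₂.commShift_of_leftAdjoint ℤ
  have := a₃.commShift_of_rightAdjoint ℤ
  have := a₄.commShift_of_leftAdjoint ℤ
  have := isIso_unit_Q a₃
  have := isIso_counit_Q a₄
  exact ⟨{
    iStar := V.ι.leftAdjoint
    iShriek := V.ι.rightAdjoint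
    jShriek := V.trW.Q.leftAdjoint
    jStar := V.trW.Q.rightAdjoint
    iStar_commShift := inferInstance
    iShriek_commShift := inferInstance
    jShriek_commShift := inferInstance
    jStar_commShift := inferInstance
    iStar_isTriangulated := a₁.isTriangulated_leftAdjoint
    iShriek_isTriangulated := a₂.isTriangulated_rightAdjoint
    jShriek_isTriangulated := a₃.isTriangulated_leftAdjoint
    jStar_isTriangulated := a₄.isTriangulated_rightAdjoint
    i_full := inferInstance
    i_faithful := inferInstance
    jShriek_full := a₃.fullyFaithfulLOfIsIsoUnit.full
    jShriek_faithful := a₃.fullyFaithfulLOfIsIsoUnit.faithful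
    jStar_full := a₄.fullyFaithfulROfIsIsoCounit.full
    jStar_faithful := a₄.fullyFaithfulROfIsIsoCounit.faithful
    adj_iStar := a₁
    adj_iShriek := a₂
    adj_jShriek := a₃
    adj_jStar := a₄
    essImage_jShriek := (essImage_leftAdjoint_Q a₃).trans (kernel_leftAdjoint_ι a₁).symm
    essImage_i := essImage_ι.trans (kernel_Q hl).symm
    essImage_jStar := (essImage_rightAdjoint_Q a₄).trans (kernel_rightAdjoint_ι a₂).symm },
    essImage_leftAdjoint_Q a₃, essImage_rightAdjoint_Q a₄⟩

end Quotient

end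

end Recoll

/-! ### Triangle functors induced by exact functors -/

namespace Frobenius

section

variable {C : Type*} [Category C] [Preadditive C] [HasBinaryBiproducts C] [HasZeroObject C]
  {E : ObjectProperty (ShortComplex C)} (hE : IsFrobenius E) [StableTriangulation E]

variable (E) in
/-- The identification of the translation that is part of a triangulation. -/
def shiftData : ShiftData E where
  iso := StableTriangulation.shiftIso
  naturality := StableTriangulation.shiftIso_naturality

lemma distinguished_iff_isStd (T : Triangle (StableCategory E)) :
    T ∈ distTriang (StableCategory E) ↔ (shiftData E).IsStd T :=
  StableTriangulation.distinguished_iff T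

lemma tri_distinguished (S : ShortComplex C) (hS : E S) :
    (shiftData E).tri hE S hS ∈ distTriang (StableCategory E) :=
  (distinguished_iff_isStd _).2 ((shiftData E).isStd_tri hE S hS)

end

section Functor

variable {C : Type*} [Category C] [Preadditive C] [HasBinaryBiproducts C] [HasZeroObject C]
  {E : ObjectProperty (ShortComplex C)}
  {C' : Type*} [Category C'] [Preadditive C'] [HasBinaryBiproducts C'] [HasZeroObject C']
  {E' : ObjectProperty (ShortComplex C')} (F : C ⥤ C') [F.Additive]
  (hFp : ∀ P : C, relProjective E P → relProjective E' (F.obj P))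

/-- The functor between stable categories induced by a functor that preserves projectives. -/
def stableFunctor : StableCategory E ⥤ StableCategory E' :=
  CategoryTheory.Quotient.lift _ (F ⋙ toStable E') (by
    rintro X Y f g ⟨Q, hQ, a, b, h⟩
    refine toStable_map_eq_of_sub_eq _ _ (hFp Q hQ) (F.map a) (F.map b) ?_
    rw [← Functor.map_sub, h, Functor.map_comp])

lemma stableFunctor_map {X Y : C} (f : X ⟶ Y) :
    (stableFunctor F hFp).map ((toStable E).map f) = (toStable E').map (F.map f) := rfl

instance : (stableFunctor F hFp).Additive where
  map_add {X Y f g} := by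
    obtain ⟨X⟩ := X
    obtain ⟨Y⟩ := Y
    obtain ⟨f, rfl⟩ := (toStable E).map_surjective f
    obtain ⟨g, rfl⟩ := (toStable E).map_surjective g
    refine ((stableFunctor F hFp).congr_map ((toStable E).map_add (f := f) (g := g)).symm).trans ?_
    refine (stableFunctor_map F hFp (f + g)).trans ?_
    rw [Functor.map_add, Functor.map_add]
    rfl

variable [StableTriangulation E] [StableTriangulation E'] (hE : IsFrobenius E)
  (hE' : IsFrobenius E') (hF : ∀ S : ShortComplex C, E S → E' (S.map F))

/-- The induced functor commutes with the translation. -/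
noncomputable def stableFunctorShiftIso :
    shiftFunctor (StableCategory E) (1 : ℤ) ⋙ stableFunctor F hFp ≅
      stableFunctor F hFp ⋙ shiftFunctor (StableCategory E') (1 : ℤ) :=
  NatIso.ofComponents (fun X => (stableFunctor F hFp).mapIso
      ((shiftData E).iso (hE.injSeq X.as) (hE.injSeq_mem X.as) (hE.relProjective_inj X.as)
        (hE.relInjective_inj X.as)).symm ≪≫
      (shiftData E').iso ((hE.injSeq X.as).map F) (hF _ (hE.injSeq_mem X.as))
        (hFp _ (hE.relProjective_inj X.as))
        (hE'.relInjective_of_relProjective (hFp _ (hE.relProjective_inj X.as)))) (by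
    intro X Y f
    obtain ⟨X⟩ := X
    obtain ⟨Y⟩ := Y
    obtain ⟨f, rfl⟩ := (toStable E).map_surjective f
    obtain ⟨φ, rfl⟩ := hE.exists_injSeq_hom f
    have h₁ := (shiftData E).naturality φ (hE.injSeq_mem X) (hE.relProjective_inj X)
      (hE.relInjective_inj X) (hE.injSeq_mem Y) (hE.relProjective_inj Y) (hE.relInjective_inj Y)
    have h₂ := (shiftData E').naturality (F.mapShortComplex.map φ) (hF _ (hE.injSeq_mem X))
      (hFp _ (hE.relProjective_inj X))
      (hE'.relInjective_of_relProjective (hFp _ (hE.relProjective_inj X)))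
      (hF _ (hE.injSeq_mem Y)) (hFp _ (hE.relProjective_inj Y))
      (hE'.relInjective_of_relProjective (hFp _ (hE.relProjective_inj Y)))
    rw [← Iso.inv_comp_eq, ← Category.assoc, ← Iso.eq_comp_inv] at h₁
    have h₁' := (stableFunctor F hFp).congr_map h₁
    rw [Functor.map_comp, Functor.map_comp] at h₁'
    change (stableFunctor F hFp).map (((toStable E).map φ.τ₁)⟦(1 : ℤ)⟧') ≫
      (stableFunctor F hFp).map _ ≫ _ = ((stableFunctor F hFp).map _ ≫ _) ≫ _
    refine (Category.assoc _ _ _).symm.trans ?_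
    refine (congrArg (· ≫ _) h₁'.symm).trans ?_
    refine (Category.assoc _ _ _).trans (Eq.trans ?_ (Category.assoc _ _ _).symm)
    exact congrArg (_ ≫ ·) h₂)

lemma map_δ_comp (S : ShortComplex C) (hS : E S) :
    (stableFunctor F hFp).map ((shiftData E).δ hE S hS) ≫
      (stableFunctorShiftIso F hFp hE hE' hF).hom.app ((toStable E).obj S.X₁) =
    (shiftData E').δ hE' (S.map F) (hF S hS) := by
  obtain ⟨φ, hφ⟩ := hE.exists_hom_of_relInjective (T := hE.injSeq S.X₁) hS
    (hE.relInjective_inj S.X₁) (𝟙 S.X₁)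
  have h₁ := (shiftData E).map_τ₃_iso hE φ hS (hE.injSeq_mem _) (hE.relProjective_inj _)
    (hE.relInjective_inj _)
  obtain ⟨ψ, h₃, h₄⟩ : ∃ ψ : S.map F ⟶ (hE.injSeq S.X₁).map F,
      ψ.τ₁ = 𝟙 _ ∧ ψ.τ₃ = F.map φ.τ₃ :=
    ⟨F.mapShortComplex.map φ, (F.congr_map hφ).trans (F.map_id _), rfl⟩
  have h₂ := (shiftData E').map_τ₃_iso hE' ψ (hF S hS)
    (hF _ (hE.injSeq_mem S.X₁)) (hFp _ (hE.relProjective_inj S.X₁))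
    (hE'.relInjective_of_relProjective (hFp _ (hE.relProjective_inj S.X₁)))
  rw [hφ, CategoryTheory.Functor.map_id, CategoryTheory.Functor.map_id, Category.comp_id] at h₁
  have h₅ : ((toStable E').map ψ.τ₁)⟦(1 : ℤ)⟧' = 𝟙 _ :=
    ((shiftFunctor (StableCategory E') (1 : ℤ)).congr_map (((toStable E').congr_map h₃).trans
      ((toStable E').map_id _))).trans ((shiftFunctor (StableCategory E') (1 : ℤ)).map_id _)
  refine Eq.trans ?_ (h₂.trans ((congrArg (_ ≫ ·) h₅).trans (Category.comp_id _)))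
  rw [← h₁, Functor.map_comp]
  refine (Category.assoc _ _ _).trans
    (Eq.trans ?_ (congrArg (fun t => (toStable E').map t ≫ _) h₄.symm))
  refine congrArg ((stableFunctor F hFp).map _ ≫ ·) ?_
  exact ((stableFunctor F hFp).mapIso ((shiftData E).iso (hE.injSeq S.X₁) (hE.injSeq_mem S.X₁)
    (hE.relProjective_inj S.X₁) (hE.relInjective_inj S.X₁))).hom_inv_id_assoc _

include hE' hF hE in
/-- An exact functor of Frobenius categories that preserves projectives induces a triangle
functor. -/
theorem exists_isTriangulated_stableFunctor :
    ∃ (_ : (stableFunctor F hFp).CommShift ℤ), (stableFunctor F hFp).IsTriangulated := by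
  obtain ⟨h, he⟩ := ShiftAux.exists_commShift _ (stableFunctorShiftIso F hFp hE hE' hF)
  refine ⟨h, ⟨fun T hT => ?_⟩⟩
  -- Every distinguished triangle comes from a conflation, and `F` sends its triangle to that of the
  -- image conflation, connecting maps matching by `map_δ_comp`.
  obtain ⟨S, hS, ⟨e⟩⟩ := (shiftData E).exists_tri_of_isStd hE ((distinguished_iff_isStd T).1 hT)
  refine isomorphic_distinguished _ (tri_distinguished hE' (S.map F) (hF S hS)) _
    ((stableFunctor F hFp).mapTriangle.mapIso e ≪≫ ?_)
  refine Triangle.isoMk _ _ (Iso.refl _) (Iso.refl _) (Iso.refl _) ?_ ?_ ?_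
  · exact (Category.comp_id _).trans (Category.id_comp _).symm
  · exact (Category.comp_id _).trans (Category.id_comp _).symm
  · refine Eq.trans ?_ (Category.id_comp _).symm
    refine (congrArg (_ ≫ ·) (CategoryTheory.Functor.map_id _ _)).trans
      ((Category.comp_id _).trans ?_)
    change (stableFunctor F hFp).map (-(shiftData E).δ hE S hS) ≫
      (h.commShiftIso 1).hom.app ((toStable E).obj S.X₁) = -(shiftData E').δ hE' (S.map F) (hF S hS)
    rw [he, Functor.map_neg, Preadditive.neg_comp, map_δ_comp]
    rfl

end Functor

end Frobenius

/-! ### Triangulated kernels and equivalences tested on models -/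

namespace Recoll

section

variable {A B : Type*} [Category A] [HasZeroObject A] [HasShift A ℤ] [Preadditive A]
  [∀ n : ℤ, (shiftFunctor A n).Additive] [Pretriangulated A]
  [Category B] [HasZeroObject B] [HasShift B ℤ] [Preadditive B]
  [∀ n : ℤ, (shiftFunctor B n).Additive] [Pretriangulated B]

/-- Zero objects are the right orthogonal of the whole category. Kernels of triangle functors, being
inverse images of them, are then triangulated. -/
instance isTriangulated_isZero : ObjectProperty.IsTriangulated (C := A) IsZero := by
  have : (IsZero : ObjectProperty A) = (⊤ : ObjectProperty A).rightOrthogonal := by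
    ext X
    exact ⟨fun h Y f _ => h.eq_of_tgt _ _, fun h => (IsZero.iff_id_eq_zero X).2 (h _ trivial)⟩
  rw [this]
  infer_instance

lemma isTriangulated_kernel (F : A ⥤ B) [F.CommShift ℤ] [F.IsTriangulated] :
    F.kernel.IsTriangulated := inferInstance

lemma triangleEquivalent_of_isEquivalence (F : A ⥤ B) [F.CommShift ℤ] [F.IsTriangulated]
    [F.IsEquivalence] : TriangleEquivalent B A := by
  let adj : F ⊣ F.inv := F.asEquivalence.toAdjunction
  letI := adj.rightAdjointCommShift ℤ
  have := adj.commShift_of_leftAdjoint ℤ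
  exact ⟨F.inv, inferInstance, adj.isTriangulated_rightAdjoint, inferInstance⟩

/-- Objects of the subcategory are only isomorphic to models; conjugating by these isomorphisms
reduces fullness and faithfulness to the models themselves. -/
lemma triangleEquivalent_of_models {M : Type*} [Category M] (P : ObjectProperty M) (q : M ⥤ A)
    [(P.map q).IsTriangulated] (F : A ⥤ B) [F.CommShift ℤ] [F.IsTriangulated]
    (hfull : ∀ α β, P α → P β → ∀ g : F.obj (q.obj α) ⟶ F.obj (q.obj β), ∃ f, F.map f = g)
    (hfaithful : ∀ α β, P α → P β → ∀ f : q.obj α ⟶ q.obj β, F.map f = 0 → f = 0)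
    (hsurj : ∀ X : B, ∃ α, P α ∧ Nonempty (F.obj (q.obj α) ≅ X)) :
    TriangleEquivalent B (P.map q).FullSubcategory := by
  let G := (P.map q).ι ⋙ F
  have : G.Faithful := ⟨fun {X Y f g} h => by
    obtain ⟨X, α, hα, ⟨a⟩⟩ := X
    obtain ⟨Y, β, hβ, ⟨b⟩⟩ := Y
    apply ObjectProperty.hom_ext
    have h' : F.map f.hom = F.map g.hom := h
    have h₀ : a.hom ≫ (f.hom - g.hom) ≫ b.inv = 0 := hfaithful _ _ hα hβ _ (by
      rw [Functor.map_comp, Functor.map_comp, Functor.map_sub, h', sub_self, zero_comp, comp_zero])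
    rw [← sub_eq_zero, ← cancel_epi a.hom, ← cancel_mono b.inv, Category.assoc, h₀]
    simp⟩
  have : G.Full := ⟨fun {X Y} g => by
    obtain ⟨X, α, hα, ⟨a⟩⟩ := X
    obtain ⟨Y, β, hβ, ⟨b⟩⟩ := Y
    change F.obj X ⟶ F.obj Y at g
    obtain ⟨f, hf⟩ := hfull _ _ hα hβ (F.map a.hom ≫ g ≫ F.map b.inv)
    refine ⟨ObjectProperty.homMk (a.inv ≫ f ≫ b.hom), ?_⟩
    change F.map (a.inv ≫ f ≫ b.hom) = g
    have ha : F.map a.inv ≫ F.map a.hom = 𝟙 _ := (F.mapIso a).inv_hom_id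
    have hb : F.map b.inv ≫ F.map b.hom = 𝟙 _ := (F.mapIso b).inv_hom_id
    rw [Functor.map_comp, Functor.map_comp, hf, Category.assoc, Category.assoc, hb, reassoc_of% ha]
    exact Category.comp_id _⟩
  have : G.EssSurj := ⟨fun X => by
    obtain ⟨α, hα, ⟨e⟩⟩ := hsurj X
    exact ⟨⟨_, P.prop_map_obj q hα⟩, ⟨e⟩⟩⟩
  have : G.IsEquivalence := { }
  exact triangleEquivalent_of_isEquivalence G

end

end Recoll

namespace Frobenius

lemma relProjective_of_isZero {C : Type*} [Category C] [Preadditive C] [HasBinaryBiproducts C]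
    [HasZeroObject C] {E : ObjectProperty (ShortComplex C)} {X : C}
    (h : IsZero ((toStable E).obj X)) : relProjective E X := by
  have h' : (toStable E).map (𝟙 X) = 0 := h.eq_of_src _ _
  obtain ⟨Q, hQ, a, b, hab⟩ := (toStable_map_eq_zero_iff _).1 h'
  intro S hS f
  obtain ⟨g, hg⟩ := hQ S hS (b ≫ f)
  exact ⟨a ≫ g, by rw [Category.assoc, hg, ← Category.assoc, ← hab, Category.id_comp]⟩

end Frobenius

namespace Recoll

lemma hom_eq_zero_of_models {M A : Type*} [Category M] [Category A] [Preadditive A]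
    {P P' : ObjectProperty M} {q : M ⥤ A} [q.Full]
    (h : ∀ α β, P α → P' β → ∀ f : α ⟶ β, q.map f = 0) :
    ∀ ⦃X Y : A⦄, P.map q X → P'.map q Y → ∀ f : X ⟶ Y, f = 0 := by
  rintro X Y ⟨α, hα, ⟨a⟩⟩ ⟨β, hβ, ⟨b⟩⟩ f
  obtain ⟨g, hg⟩ := q.map_surjective (a.hom ≫ f ≫ b.inv)
  rw [h _ _ hα hβ g] at hg
  rw [← cancel_epi a.hom, ← cancel_mono b.inv, Category.assoc, ← hg]
  simp

end Recoll

/-! ### The three subcategories: decompositions, orthogonality, equivalences -/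

namespace Gorenstein

open Frobenius Recoll

variable {R : Type u} [Ring R]

lemma eq_zero_of_isZero {X : CM R} (h : IsZero X) (x : X.obj) : x = 0 :=
  lin_eq_of_eq (h.eq_of_src (𝟙 X) 0) x

lemma isZero_rf {α : MorE R} (h : IsZero α.obj.right) : IsZero ((rf R).obj α) :=
  IsZero.of_full_of_faithful_of_isZero (isCM R).ι _ h

lemma surjective_zero (X : CM R) : Function.Surjective (lin (0 : X ⟶ 0)) := fun y =>
  ⟨0, ((eq_zero_of_isZero (isZero_zero _) _).trans (eq_zero_of_isZero (isZero_zero _) y).symm)⟩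

lemma surjective_id (X : CM R) : Function.Surjective (lin (𝟙 X)) := Function.surjective_id

/-- The object `X ⟶ 0`. -/
noncomputable abbrev mkZero (X : CM R) : MorE R := mkMorE (0 : X ⟶ 0) (surjective_zero X)

/-- The object `T ⟶ T`. -/
abbrev mkId (T : CM R) : MorE R := mkMorE (𝟙 T) (surjective_id T)

lemma isZero_mkZero (X : CM R) : IsZero (mkZero X).obj.right :=
  (isCM R).ι.map_isZero (isZero_zero (CM R))

lemma projective_of_isZero {X : CM R} (h : IsZero X) : Module.Projective Rᵐᵒᵖ X.obj := by
  have : Subsingleton X.obj :=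
    ⟨fun x y => (eq_zero_of_isZero h x).trans (eq_zero_of_isZero h y).symm⟩
  infer_instance

lemma isIso_arr {α : MorE R}
    (h : ∃ T : ModuleCat.{u} Rᵐᵒᵖ, Nonempty (α.obj ≅ Arrow.mk (𝟙 T))) : IsIso (arr α) := by
  obtain ⟨T, ⟨e⟩⟩ := h
  have hw : e.hom.left ≫ 𝟙 T = α.obj.hom ≫ e.hom.right := e.hom.w
  have h : e.hom.left = α.obj.hom ≫ e.hom.right := (Category.comp_id _).symm.trans hw
  have : IsIso (α.obj.hom ≫ e.hom.right) := h ▸ inferInstanceAs (IsIso e.hom.left)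
  have h' : IsIso α.obj.hom := IsIso.of_isIso_comp_right _ e.hom.right
  have : IsIso ((isCM R).ι.map (arr α)) := h'
  exact isIso_of_fully_faithful (isCM R).ι (arr α)

/-- A morphism that factors through a map of projective modules vanishes stably. -/
lemma toStable_map_eq_zero {α β : MorE R} (g : α ⟶ β) {X T : CM R} (f : X ⟶ T)
    (hf : Function.Surjective (lin f)) (hX : Module.Projective Rᵐᵒᵖ X.obj)
    (hT : Module.Projective Rᵐᵒᵖ T.obj)
    (a : (lf R).obj α ⟶ X) (b : (rf R).obj α ⟶ T) (w : a ≫ f = arr α ≫ b)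
    (a' : X ⟶ (lf R).obj β) (b' : T ⟶ (rf R).obj β) (w' : a' ≫ arr β = f ≫ b')
    (h₁ : a ≫ a' = (lf R).map g) (h₂ : b ≫ b' = (rf R).map g) :
    (toStable (morEConflation R)).map g = 0 := by
  refine (toStable_map_eq_zero_iff g).2 ⟨mkMorE f hf,
    relProjective_morEConflation_of_projective hX hT, morHom (β := mkMorE f hf) a b w,
    morHom (α := mkMorE f hf) a' b' w', mor_hom_ext ?_ ?_⟩
  · rw [Functor.map_comp]
    exact h₁.symm
  · rw [Functor.map_comp]
    exact h₂.symm

lemma cmConflation_of_isZero {S : ShortComplex (CM R)} (h₁ : IsZero S.X₁) (h : IsIso S.g) :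
    cmConflation R S := by
  have hinj : Function.Injective (lin S.g) := fun x y hxy => by
    have h₁ := lin_eq_of_eq (IsIso.hom_inv_id S.g) x
    have h₂ := lin_eq_of_eq (IsIso.hom_inv_id S.g) y
    exact h₁.symm.trans ((congrArg (lin (inv S.g)) hxy).trans h₂)
  refine (cmConflation_iff S).2 ⟨fun x y _ =>
    (eq_zero_of_isZero h₁ x).trans (eq_zero_of_isZero h₁ y).symm, fun x => ⟨fun hx => ⟨0, ?_⟩, ?_⟩,
    fun y => ⟨lin (inv S.g) y, lin_eq_of_eq (IsIso.inv_hom_id S.g) y⟩⟩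
  · rw [map_zero]
    exact (hinj (hx.trans (map_zero _).symm)).symm
  · rintro ⟨y, rfl⟩
    exact lin_eq_of_eq S.zero y

lemma exists_conflation_mkZero_mkId [IsNoetherianRing Rᵐᵒᵖ] (α : MorE R) :
    ∃ (K : CM R) (i : mkZero K ⟶ α) (p : α ⟶ mkId ((rf R).obj α)) (w : i ≫ p = 0),
      morEConflation R (ShortComplex.mk i p w) := by
  obtain ⟨K, k, w, h⟩ := exists_cmConflation_of_surjective (arr α) (arr_surjective α)
  refine ⟨K, morHom (α := mkZero K) k (0 : (0 : CM R) ⟶ _) (w.trans comp_zero.symm),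
    morHom (β := mkId ((rf R).obj α)) (arr α) (𝟙 _) rfl, mor_hom_ext w ?_, h, ?_⟩
  · exact (isZero_zero (CM R)).eq_of_src _ _
  · exact cmConflation_of_isZero (S := ShortComplex.mk (0 : (0 : CM R) ⟶ (rf R).obj α)
      (𝟙 ((rf R).obj α)) zero_comp) (isZero_zero _) inferInstance

/-- Replace the source by a free cover while keeping the target; the kernel is the syzygy of the
source over 0. -/
lemma exists_conflation_mkZero_free [IsNoetherianRing Rᵐᵒᵖ] (α : MorE R) :
    ∃ (K : CM R) (β : MorE R) (_ : Module.Projective Rᵐᵒᵖ β.obj.left) (i : mkZero K ⟶ β)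
      (p : β ⟶ α) (w : i ≫ p = 0), morEConflation R (ShortComplex.mk i p w) := by
  obtain ⟨n, K, k, p, w, h⟩ := exists_free_conflation ((lf R).obj α)
  have hs : Function.Surjective (lin (p ≫ arr α)) :=
    (arr_surjective α).comp ((cmConflation_iff _).1 h).2.2
  have w' : k ≫ p ≫ arr α = 0 := by rw [← Category.assoc, w, zero_comp]
  refine ⟨K, mkMorE (p ≫ arr α) hs, inferInstanceAs (Module.Projective Rᵐᵒᵖ (free R n).obj),
    morHom (α := mkZero K) (β := mkMorE (p ≫ arr α) hs) k (0 : (0 : CM R) ⟶ (rf R).obj α)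
      (w'.trans comp_zero.symm),
    morHom (α := mkMorE (p ≫ arr α) hs) p (𝟙 ((rf R).obj α)) (Category.comp_id _).symm,
    mor_hom_ext w ?_, h, ?_⟩
  · exact (isZero_zero (CM R)).eq_of_src _ _
  · exact cmConflation_of_isZero (S := ShortComplex.mk (0 : (0 : CM R) ⟶ (rf R).obj α)
      (𝟙 ((rf R).obj α)) zero_comp) (isZero_zero _) inferInstance

/-- Embed the source into a free module and divide by the image of the kernel of the arrow. By the
third isomorphism theorem the cokernels at source and target coincide. -/
lemma exists_conflation_free_mkId (hR : IsIwanagaGorenstein R) (α : MorE R) :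
    ∃ (β : MorE R) (_ : Module.Projective Rᵐᵒᵖ β.obj.left) (T : CM R) (i : α ⟶ β)
      (p : β ⟶ mkId T) (w : i ≫ p = 0), morEConflation R (ShortComplex.mk i p w) := by
  have := hR.right_noetherian
  obtain ⟨n, f, hf⟩ := exists_inflation_free hR ((lf R).obj α)
  obtain ⟨T, g, w, h⟩ := exists_cmConflation hf
  obtain ⟨K, k, w', h'⟩ := exists_cmConflation_of_surjective (arr α) (arr_surjective α)
  obtain ⟨S, s, ws, m₁, m₃, wm, hs, hm, hm₁, hm₃⟩ :=
    (isFrobenius_cmConflation hR).exists_comp h' h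
  have hs' : Function.Surjective (lin s) := ((cmConflation_iff _).1 hs).2.2
  exact ⟨mkMorE s hs', inferInstanceAs (Module.Projective Rᵐᵒᵖ (free R n).obj), T,
    morHom (β := mkMorE s hs') f m₁ hm₁.symm,
    morHom (α := mkMorE s hs') (β := mkId T) g m₃ ((Category.comp_id _).trans hm₃.symm),
    mor_hom_ext w wm, h, hm⟩

/-- With P the source of α, the map factors through the projective object P → 0. -/
lemma mor01_mor10_zero (α β : MorE R) (hα : Module.Projective Rᵐᵒᵖ α.obj.left)
    (hβ : IsZero β.obj.right) (f : α ⟶ β) :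
    (toStable (morEConflation R)).map f = 0 := by
  have h₀ : (rf R).map f = 0 := (isZero_rf hβ).eq_of_tgt _ _
  refine toStable_map_eq_zero f (0 : (lf R).obj α ⟶ 0) (surjective_zero _) hα
    (projective_of_isZero (isZero_zero _)) (𝟙 _) 0 (by simp) ((lf R).map f) 0 ?_
    (Category.id_comp _) ?_
  · rw [arr_naturality, h₀, comp_zero, comp_zero]
  · rw [h₀, comp_zero]

lemma mor10_mor11_zero (α β : MorE R) (hα : IsZero α.obj.right) (hβ : IsIso (arr β))
    (f : α ⟶ β) : f = 0 := by
  have h₀ : (rf R).map f = 0 := (isZero_rf hα).eq_of_src _ _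
  refine mor_hom_ext ?_ ?_
  · rw [← cancel_mono (arr β), arr_naturality, h₀, Functor.map_zero, comp_zero, zero_comp]
  · rw [h₀, Functor.map_zero]

/-- With P the source of β, the map factors through the projective object P = P. -/
lemma mor11_mor01_zero (α β : MorE R) (hα : IsIso (arr α))
    (hβ : Module.Projective Rᵐᵒᵖ β.obj.left) (f : α ⟶ β) :
    (toStable (morEConflation R)).map f = 0 := by
  refine toStable_map_eq_zero f (𝟙 ((lf R).obj β)) (surjective_id _) hβ hβ ((lf R).map f)
    (inv (arr α) ≫ (lf R).map f) (by simp) (𝟙 _) (arr β) (by simp) (Category.comp_id _) ?_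
  rw [Category.assoc, arr_naturality, IsIso.inv_hom_id_assoc]

lemma relProjective_lf [IsNoetherianRing Rᵐᵒᵖ] (α : MorE R)
    (h : relProjective (morEConflation R) α) : relProjective (cmConflation R) ((lf R).obj α) :=
  relProjective_cmConflation_of_projective ((relProjective_morEConflation_iff α).1 h).1

lemma relProjective_rf [IsNoetherianRing Rᵐᵒᵖ] (α : MorE R)
    (h : relProjective (morEConflation R) α) : relProjective (cmConflation R) ((rf R).obj α) :=
  relProjective_cmConflation_of_projective ((relProjective_morEConflation_iff α).1 h).2

variable (R) in
/-- The stable source functor. -/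
abbrev stableLf [IsNoetherianRing Rᵐᵒᵖ] : StableMorE R ⥤ StableCM R :=
  stableFunctor (lf R) relProjective_lf

variable (R) in
/-- The stable target functor. -/
abbrev stableRf [IsNoetherianRing Rᵐᵒᵖ] : StableMorE R ⥤ StableCM R :=
  stableFunctor (rf R) relProjective_rf

instance : (mor01 R).IsClosedUnderIsomorphisms := by unfold mor01; infer_instance

instance : (mor10 R).IsClosedUnderIsomorphisms := by unfold mor10; infer_instance

instance : (mor11 R).IsClosedUnderIsomorphisms := by unfold mor11; infer_instance

/-- An object is stably zero exactly when it is projective, so the stable source functor kills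
precisely the arrows with projective source. -/
lemma mor01_eq_kernel [IsNoetherianRing Rᵐᵒᵖ] : mor01 R = (stableLf R).kernel := by
  ext X
  constructor
  · rintro ⟨α, hα, ⟨e⟩⟩
    have h : IsZero ((stableLf R).obj ((toStable (morEConflation R)).obj α)) :=
      isZero_toStable_obj (E := cmConflation R) (Q := (lf R).obj α)
        (relProjective_cmConflation_of_projective hα)
    exact h.of_iso ((stableLf R).mapIso e.symm)
  · intro hX
    obtain ⟨α⟩ := X
    exact ⟨α, projective_of_relProjective (X := (lf R).obj α) (relProjective_of_isZero hX),
      ⟨Iso.refl _⟩⟩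

section

variable [StableTriangulation (morEConflation R)]

/-- If the target is projective, its identity is a projective object, and the conflation (K → 0) → α
→ (T = T) makes α stably isomorphic to K → 0. -/
lemma mor10_eq_kernel (hR : IsIwanagaGorenstein R) [IsNoetherianRing Rᵐᵒᵖ] :
    mor10 R = (stableRf R).kernel := by
  ext X
  constructor
  · rintro ⟨α, hα, ⟨e⟩⟩
    have h : IsZero ((stableRf R).obj ((toStable (morEConflation R)).obj α)) :=
      isZero_toStable_obj (E := cmConflation R) (Q := (rf R).obj α)
        (relProjective_cmConflation_of_projective (projective_of_isZero (isZero_rf hα)))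
    exact h.of_iso ((stableRf R).mapIso e.symm)
  · intro hX
    obtain ⟨α⟩ := X
    obtain ⟨K, i, p, w, h⟩ := exists_conflation_mkZero_mkId α
    have hα : Module.Projective Rᵐᵒᵖ ((rf R).obj α).obj :=
      projective_of_relProjective (relProjective_of_isZero hX)
    have h₃ : IsZero ((toStable (morEConflation R)).obj (mkId ((rf R).obj α))) :=
      isZero_toStable_obj (relProjective_morEConflation_of_projective hα hα)
    have hi : IsIso ((toStable (morEConflation R)).map i) :=
      (Triangle.isZero₃_iff_isIso₁ _
        (tri_distinguished (isFrobenius_morEConflation hR) _ h)).1 h₃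
    exact ⟨_, isZero_mkZero K, ⟨asIso ((toStable (morEConflation R)).map i)⟩⟩

/-- Rotating the triangle of (K → 0) → β → α puts β on the left and the translation of K → 0 on the
right, hence the need for shift stability. -/
lemma hasTriangles_mor01_mor10 (hR : IsIwanagaGorenstein R)
    [(mor10 R).IsStableUnderShift ℤ] : HasTriangles (mor01 R) (mor10 R) := by
  rintro ⟨α⟩
  have := hR.right_noetherian
  obtain ⟨K, β, hβ, i, p, w, h⟩ := exists_conflation_mkZero_free α
  exact ⟨_, _, ⟨β, hβ, ⟨Iso.refl _⟩⟩,
    (mor10 R).le_shift (1 : ℤ) _ ⟨mkZero K, isZero_mkZero K, ⟨Iso.refl _⟩⟩, _, _, _,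
    rot_of_distTriang _ (tri_distinguished (isFrobenius_morEConflation hR) _ h)⟩

omit [StableTriangulation (morEConflation R)] in
lemma mkId_iso (T : CM R) :
    ∃ T' : ModuleCat.{u} Rᵐᵒᵖ, Nonempty ((mkId T).obj ≅ Arrow.mk (𝟙 T')) :=
  ⟨T.obj, ⟨Iso.refl _⟩⟩

lemma hasTriangles_mor10_mor11 (hR : IsIwanagaGorenstein R) :
    HasTriangles (mor10 R) (mor11 R) := by
  rintro ⟨α⟩
  have := hR.right_noetherian
  obtain ⟨K, i, p, w, h⟩ := exists_conflation_mkZero_mkId α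
  exact ⟨_, _, ⟨mkZero K, isZero_mkZero K, ⟨Iso.refl _⟩⟩, ⟨mkId _, mkId_iso _, ⟨Iso.refl _⟩⟩, _, _,
    _, tri_distinguished (isFrobenius_morEConflation hR) _ h⟩

/-- Here the triangle of α → β → (T = T) is rotated backwards, putting the inverse translation of T
= T on the left. -/
lemma hasTriangles_mor11_mor01 (hR : IsIwanagaGorenstein R)
    [(mor11 R).IsStableUnderShift ℤ] : HasTriangles (mor11 R) (mor01 R) := by
  rintro ⟨α⟩
  obtain ⟨β, hβ, T, i, p, w, h⟩ := exists_conflation_free_mkId hR α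
  exact ⟨_, _, (mor11 R).le_shift (-1 : ℤ) _ ⟨mkId T, mkId_iso T, ⟨Iso.refl _⟩⟩,
    ⟨β, hβ, ⟨Iso.refl _⟩⟩, _, _, _,
    inv_rot_of_distTriang _ (tri_distinguished (isFrobenius_morEConflation hR) _ h)⟩

end

lemma mor01_mor10_hom_eq_zero :
    ∀ ⦃X Y : StableMorE R⦄, mor01 R X → mor10 R Y → ∀ f : X ⟶ Y, f = 0 :=
  hom_eq_zero_of_models fun α β hα hβ f => mor01_mor10_zero α β hα hβ f

lemma mor10_mor11_hom_eq_zero :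
    ∀ ⦃X Y : StableMorE R⦄, mor10 R X → mor11 R Y → ∀ f : X ⟶ Y, f = 0 :=
  hom_eq_zero_of_models fun α β hα hβ f => by
    rw [mor10_mor11_zero α β hα (isIso_arr hβ) f, Functor.map_zero]

lemma mor11_mor01_hom_eq_zero :
    ∀ ⦃X Y : StableMorE R⦄, mor11 R X → mor01 R Y → ∀ f : X ⟶ Y, f = 0 :=
  hom_eq_zero_of_models fun α β hα hβ f => mor11_mor01_zero α β (isIso_arr hα) hβ f

section Equivalences

variable [StableTriangulation (cmConflation R)] [StableTriangulation (morEConflation R)]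
  [IsNoetherianRing Rᵐᵒᵖ]

/-- A factorization of the source map through a projective Q extends to one through Q → 0, as the
target of β is zero. -/
lemma triangleEquivalent_mor10 [(mor10 R).IsTriangulated] [(stableLf R).CommShift ℤ]
    [(stableLf R).IsTriangulated] : TriangleEquivalent (StableCM R) (mor10 R).FullSubcategory := by
  have : (ObjectProperty.map (fun α : MorE R => IsZero α.obj.right)
      (toStable (morEConflation R))).IsTriangulated := ‹(mor10 R).IsTriangulated›
  refine triangleEquivalent_of_models (fun α : MorE R => IsZero α.obj.right)
    (toStable (morEConflation R)) (stableLf R) ?_ ?_ ?_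
  · intro α β hα hβ g
    obtain ⟨g, rfl⟩ := (toStable (cmConflation R)).map_surjective (X := (lf R).obj α)
      (Y := (lf R).obj β) g
    exact ⟨(toStable _).map (morHom g 0 ((isZero_rf hβ).eq_of_tgt _ _)), rfl⟩
  · intro α β hα hβ f hf
    obtain ⟨f, rfl⟩ := (toStable (morEConflation R)).map_surjective f
    obtain ⟨Q, hQ, a, b, hab⟩ := (toStable_map_eq_zero_iff (E := cmConflation R)
      ((lf R).map f)).1 hf
    have hQ' : Module.Projective Rᵐᵒᵖ Q.obj := projective_of_relProjective hQ
    exact toStable_map_eq_zero f (0 : Q ⟶ 0) (surjective_zero Q) hQ'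
      (projective_of_isZero (isZero_zero _)) a 0 ((isZero_zero _).eq_of_tgt _ _) b 0
      ((isZero_rf hβ).eq_of_tgt _ _) hab.symm ((isZero_rf hβ).eq_of_tgt _ _)
  · rintro ⟨X⟩
    exact ⟨mkZero X, isZero_mkZero X, ⟨Iso.refl _⟩⟩

/-- When arrows are isomorphisms the target map determines everything, and factorizations through Q
become factorizations through Q = Q. -/
lemma triangleEquivalent_mor11 [(mor11 R).IsTriangulated] [(stableRf R).CommShift ℤ]
    [(stableRf R).IsTriangulated] : TriangleEquivalent (StableCM R) (mor11 R).FullSubcategory := by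
  have : (ObjectProperty.map (fun α : MorE R =>
      ∃ T : ModuleCat.{u} Rᵐᵒᵖ, Nonempty (α.obj ≅ Arrow.mk (𝟙 T)))
      (toStable (morEConflation R))).IsTriangulated := ‹(mor11 R).IsTriangulated›
  refine triangleEquivalent_of_models
    (fun α : MorE R => ∃ T : ModuleCat.{u} Rᵐᵒᵖ, Nonempty (α.obj ≅ Arrow.mk (𝟙 T)))
    (toStable (morEConflation R)) (stableRf R) ?_ ?_ ?_
  · intro α β hα hβ g
    have := isIso_arr hβ
    obtain ⟨g, rfl⟩ := (toStable (cmConflation R)).map_surjective (X := (rf R).obj α)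
      (Y := (rf R).obj β) g
    exact ⟨(toStable _).map (morHom (arr α ≫ g ≫ inv (arr β)) g (by simp)), rfl⟩
  · intro α β hα hβ f hf
    have := isIso_arr hβ
    obtain ⟨f, rfl⟩ := (toStable (morEConflation R)).map_surjective f
    obtain ⟨Q, hQ, a, b, hab⟩ := (toStable_map_eq_zero_iff (E := cmConflation R)
      ((rf R).map f)).1 hf
    have hQ' : Module.Projective Rᵐᵒᵖ Q.obj := projective_of_relProjective hQ
    refine toStable_map_eq_zero f (𝟙 Q) (surjective_id Q) hQ' hQ' (arr α ≫ a) a (by simp)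
      (b ≫ inv (arr β)) b (by simp) ?_ hab.symm
    rw [← cancel_mono (arr β), arr_naturality, hab]
    simp
  · rintro ⟨X⟩
    exact ⟨mkId X, mkId_iso X, ⟨Iso.refl _⟩⟩

lemma triangleEquivalent_mor01 [(mor01 R).IsTriangulated] [(stableRf R).CommShift ℤ]
    [(stableRf R).IsTriangulated] : TriangleEquivalent (StableCM R) (mor01 R).FullSubcategory := by
  have : (ObjectProperty.map (fun α : MorE R => Module.Projective Rᵐᵒᵖ α.obj.left)
      (toStable (morEConflation R))).IsTriangulated := ‹(mor01 R).IsTriangulated›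
  refine triangleEquivalent_of_models
    (fun α : MorE R => Module.Projective Rᵐᵒᵖ α.obj.left)
    (toStable (morEConflation R)) (stableRf R) ?_ ?_ ?_
  · intro α β hα hβ g
    obtain ⟨g, rfl⟩ := (toStable (cmConflation R)).map_surjective (X := (rf R).obj α)
      (Y := (rf R).obj β) g
    have hα' : Module.Projective Rᵐᵒᵖ ((lf R).obj α).obj := hα
    obtain ⟨l, hl⟩ := Module.projective_lifting_property (lin (arr β)) (lin (arr α ≫ g))
      (arr_surjective β)
    exact ⟨(toStable _).map (morHom (cmHom l) g (cm_hom_ext fun x => LinearMap.congr_fun hl x)),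
      rfl⟩
  · intro α β hα hβ f hf
    obtain ⟨f, rfl⟩ := (toStable (morEConflation R)).map_surjective f
    obtain ⟨Q, hQ, a, b, hab⟩ := (toStable_map_eq_zero_iff (E := cmConflation R)
      ((rf R).map f)).1 hf
    have hQ' : Module.Projective Rᵐᵒᵖ Q.obj := projective_of_relProjective hQ
    obtain ⟨l, hl⟩ := Module.projective_lifting_property (lin (arr β)) (lin b)
      (arr_surjective β)
    let b' : Q ⟶ (lf R).obj β := cmHom l
    have hb' : b' ≫ arr β = b := cm_hom_ext fun x => LinearMap.congr_fun hl x
    -- `g` has the same target component as `f` and factors through Q = Q. The difference has zero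
    -- target component, so it factors through P → 0 with P the projective source of α.
    let g : α ⟶ β := morHom (arr α ≫ a ≫ b') (a ≫ b) (by simp [hb'])
    have hg : (toStable (morEConflation R)).map g = 0 :=
      toStable_map_eq_zero g (𝟙 Q) (surjective_id Q) hQ' hQ' (arr α ≫ a) a (by simp)
        b' b (by simp [hb']) (Category.assoc _ _ _) rfl
    have h₀ : (rf R).map (f - g) = 0 := by
      rw [Functor.map_sub, hab, rf_map_morHom, sub_self]
    have hfg : (toStable (morEConflation R)).map (f - g) = 0 := by
      refine toStable_map_eq_zero (f - g) (0 : (lf R).obj α ⟶ 0) (surjective_zero _) hα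
        (projective_of_isZero (isZero_zero _)) (𝟙 _) 0 (by simp) ((lf R).map (f - g)) 0 ?_
        (Category.id_comp _) ?_
      · rw [arr_naturality, h₀, comp_zero, comp_zero]
      · rw [h₀, comp_zero]
    rw [Functor.map_sub, hg, sub_zero] at hfg
    exact hfg
  · rintro ⟨X⟩
    obtain ⟨n, K, k, p, w, h⟩ := exists_free_conflation X
    exact ⟨mkMorE p ((cmConflation_iff _).1 h).2.2,
      inferInstanceAs (Module.Projective Rᵐᵒᵖ (free R n).obj), ⟨Iso.refl _⟩⟩

end Equivalences

end Gorenstein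

theorem mainTheorem6 (R : Type u) [Ring R] (hR : Gorenstein.IsIwanagaGorenstein R) :
    Nonempty (Frobenius.StableTriangulation (Gorenstein.cmConflation R)) ∧
    Nonempty (Frobenius.StableTriangulation (Gorenstein.morEConflation R)) ∧
    ∀ [Frobenius.StableTriangulation (Gorenstein.cmConflation R)]
      [Frobenius.StableTriangulation (Gorenstein.morEConflation R)],
      ∃ (_ : (Gorenstein.mor01 R).IsTriangulated) (_ : (Gorenstein.mor10 R).IsTriangulated)
        (_ : (Gorenstein.mor11 R).IsTriangulated),
        Recoll.IsTriangleOfRecollements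
          (Gorenstein.mor01 R) (Gorenstein.mor10 R) (Gorenstein.mor11 R) ∧
        (∃ r : Recoll.Recollement (Gorenstein.mor10 R).ι (Gorenstein.mor10 R).trW.Q,
          r.jShriek.essImage = Gorenstein.mor01 R ∧ r.jStar.essImage = Gorenstein.mor11 R) ∧
        Recoll.TriangleEquivalent
          (Gorenstein.StableCM R) (Gorenstein.mor10 R).FullSubcategory ∧
        Recoll.TriangleEquivalent
          (Gorenstein.StableCM R) (Gorenstein.mor11 R).FullSubcategory ∧
        Recoll.TriangleEquivalent
          (Gorenstein.StableCM R) (Gorenstein.mor01 R).FullSubcategory := by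
  have hcm := Gorenstein.isFrobenius_cmConflation hR
  have hmor := Gorenstein.isFrobenius_morEConflation hR
  refine ⟨hcm.nonempty_stableTriangulation, hmor.nonempty_stableTriangulation, ?_⟩
  intro _ _
  have := hR.right_noetherian
  -- The source and target functors are exact and preserve projectives, so they are triangle
  -- functors for whichever triangulations are given.
  obtain ⟨_, _⟩ := Frobenius.exists_isTriangulated_stableFunctor (Gorenstein.lf R)
    Gorenstein.relProjective_lf hmor hcm (fun _ hS => Gorenstein.cmConflation_map_lf hS)
  obtain ⟨_, _⟩ := Frobenius.exists_isTriangulated_stableFunctor (Gorenstein.rf R)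
    Gorenstein.relProjective_rf hmor hcm (fun _ hS => Gorenstein.cmConflation_map_rf hS)
  have h01 : (Gorenstein.mor01 R).IsTriangulated := by
    rw [Gorenstein.mor01_eq_kernel]
    exact Recoll.isTriangulated_kernel _
  have h10 : (Gorenstein.mor10 R).IsTriangulated := by
    rw [Gorenstein.mor10_eq_kernel hR]
    exact Recoll.isTriangulated_kernel _
  -- The order matters: shift stability of `mor10` is needed for both orthogonality statements, and
  -- `mor11` is seen to be triangulated only through the second one.
  have e01 : Gorenstein.mor01 R = (Gorenstein.mor10 R).leftOrthogonal :=
    Recoll.eq_leftOrthogonal Gorenstein.mor01_mor10_hom_eq_zero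
      (Gorenstein.hasTriangles_mor01_mor10 hR)
  have e11 : Gorenstein.mor11 R = (Gorenstein.mor10 R).rightOrthogonal :=
    Recoll.eq_rightOrthogonal Gorenstein.mor10_mor11_hom_eq_zero
      (Gorenstein.hasTriangles_mor10_mor11 hR)
  have h11 : (Gorenstein.mor11 R).IsTriangulated := by
    rw [e11]
    infer_instance
  refine ⟨h01, h10, h11, ⟨?_, ?_, ?_⟩, ?_, Gorenstein.triangleEquivalent_mor10,
    Gorenstein.triangleEquivalent_mor11, Gorenstein.triangleEquivalent_mor01⟩
  · exact Recoll.isStableTStructure Gorenstein.mor01_mor10_hom_eq_zero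
      (Gorenstein.hasTriangles_mor01_mor10 hR)
  · exact Recoll.isStableTStructure Gorenstein.mor10_mor11_hom_eq_zero
      (Gorenstein.hasTriangles_mor10_mor11 hR)
  · exact Recoll.isStableTStructure Gorenstein.mor11_mor01_hom_eq_zero
      (Gorenstein.hasTriangles_mor11_mor01 hR)
  · rw [e01, e11]
    exact Recoll.exists_recollement
      (e01 ▸ Gorenstein.hasTriangles_mor01_mor10 hR)
      (e11 ▸ Gorenstein.hasTriangles_mor10_mor11 hR)
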